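/- Let $\Omega\subset\mathbb R^n$ be a bounded domain, $T>0$, $Q_T=\Omega\times(0,T)$, $k>0$, $m_3\ge1$, $m_4\ge1$. For $A\subset Q_T$ open put $A_\tau=\{(x,t)\in A: t\ge\tau\}$, $$\mathcal U(A)=\{u\in L^\infty(A):\ \partial_tu,\nabla u\in L^2(A_\tau)\ \text{for every }\tau>0\},\qquad \mathcal V(A)=\{v\in L^\infty(A):\ \partial_tv\in L^1(A)\},$$ with weak derivatives. For nonnegative $u\in\mathcal U(A)$, $v\in\mathcal V(A)$ we call $(u,v)$ a weak supersolution pair in $A$, and write $$\partial_tu\ge\Delta u-kuv,\qquad \partial_tv\le-ku^{m_3}v^{m_4}\qquad\text{in }A, \tag{1}$$ if for every nonnegative $\phi\in C_c^\infty(A)$ $$\int_A\bigl(-u\,\partial_t\phi+\nabla u\cdot\nabla\phi+kuv\,\phi\bigr)\,dx\,dt\ge0,\qquad \int_A\bigl(-v\,\partial_t\phi+ku^{m_3}v^{m_4}\phi\bigr)\,dx\,dt\le0 .$$ **Theorem.** Let $N\ge1$, let $A_1,\dots,A_N\subset Q_T$ be subdomains with Lipschitz boundary and $A=\bigcup_{i=1}^NA_i$.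 For each $i$ let $u_i\in\mathcal U(A_i)$ and $v_i\in\mathcal V(A_i)$ be nonnegative functions, defined at every point of $A_i$, such that $(u_i,v_i)$ is a weak supersolution pair in $A_i$. Assume that the representatives of the $u_i$ are chosen so that $$u_i(z)\ \ge\ \operatorname*{ess\,lim\,inf}_{w\to z}u_i(w)\qquad\text{for every } z\in A_i\cap\bigcup_{j=1}^N\partial A_j$$ (for instance, $u_i$ continuous). For $z=(x,t)\in A$ let $$\ell(z)=\min\Bigl\{i:\ z\in A_i,\ u_i(z)=\min_{j:\,z\in A_j}u_j(z)\Bigr\},\qquad u(z)=u_{\ell(z)}(z).$$ Suppose that 1. for every $x$, the function $t\mapsto v_{\ell(x,t)}(x,t)$ is nonincreasing on $\{t:(x,t)\in A\}$; 2. $u$ is continuous in $A$; 3. for every compact set $B\subset A$ there are $\delta>0$ and an open set $\tilde B\subset A$ containing $B\cap\bigcup_{i=1}^N\partial A_i$ such that $u(z)+\delta<u_i(z)$ whenever $z\in\tilde B$, $z\in A_i$ and $i\ne\ell(z)$. Then $u\in\mathcal U(A)$ and there exists a nonnegative function $v\in\mathcal V(A)$ such that $(u,v)$ is a weak supersolution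 pair in $A$, i.e. (1) holds in $A$. -/

import Mathlib

open MeasureTheory Set Filter Topology
open scoped ContDiff RealInnerProductSpace

namespace FastReaction

noncomputable section

/-- Points `(x, t)` of space-time `ℝⁿ × ℝ`; it carries the product Lebesgue measure `volume`. -/
abbrev SpaceTime (n : ℕ) : Type := EuclideanSpace ℝ (Fin n) × ℝ

/-- The cylinder `Q_T = Ω × (0, T)`. -/
def cylinder {n : ℕ} (Ω : Set (EuclideanSpace ℝ (Fin n))) (T : ℝ) : Set (SpaceTime n) :=
  Ω ×ˢ Ioo 0 T

/-- The boundary of `A` is locally the graph of a Lipschitz function, with `A` lying strictly on one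
side of it. Here `τ` is the vertical coordinate, `e` the vertical direction (`τ e = 1`), and
`w - τ w • e` is the horizontal part of `w`, i.e. its projection along `e` onto the hyperplane
`ker τ`. Oblique coordinates give the same class of sets as orthonormal ones. -/
def HasLipschitzBoundary {X : Type*} [NormedAddCommGroup X] [NormedSpace ℝ X] (A : Set X) : Prop :=
  ∀ z ∈ frontier A, ∃ (τ : X →L[ℝ] ℝ) (e : X) (g : X → ℝ) (K : NNReal),
    τ e = 1 ∧ LipschitzWith K g ∧ ∀ᶠ w in 𝓝 z, (w ∈ A ↔ g (w - τ w • e) < τ w)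

/-- A domain (nonempty connected open set) with Lipschitz boundary. -/
structure IsLipschitzDomain {X : Type*} [NormedAddCommGroup X] [NormedSpace ℝ X]
    (A : Set X) : Prop where
  isOpen : IsOpen A
  isConnected : IsConnected A
  lipschitz : HasLipschitzBoundary A

variable {n : ℕ}

/-- The space of test functions `C_c^∞(A)`. -/
structure IsTestFunction (A : Set (SpaceTime n)) (φ : SpaceTime n → ℝ) : Prop where
  smooth : ContDiff ℝ ∞ φ
  compactSupport : HasCompactSupport φ
  support_subset : tsupport φ ⊆ A

/-- The classical time derivative `∂_t φ`. -/
def timeDeriv (φ : SpaceTime n → ℝ) (z : SpaceTime n) : ℝ :=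
  deriv (fun t => φ (z.1, t)) z.2

/-- The classical spatial gradient `∇φ`. -/
def spaceGrad (φ : SpaceTime n → ℝ) (z : SpaceTime n) : EuclideanSpace ℝ (Fin n) :=
  gradient (fun x => φ (x, z.2)) z.1

/-- `g` is the weak (distributional) time derivative of `w` in `A`. -/
structure HasWeakTimeDeriv (A : Set (SpaceTime n)) (w g : SpaceTime n → ℝ) : Prop where
  locallyIntegrable : LocallyIntegrableOn w A
  locallyIntegrable_deriv : LocallyIntegrableOn g A
  integral_eq : ∀ φ, IsTestFunction A φ →
    ∫ z in A, w z * timeDeriv φ z = - ∫ z in A, g z * φ z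

/-- `G` is the weak (distributional) spatial gradient of `w` in `A`. -/
structure HasWeakSpaceGrad (A : Set (SpaceTime n)) (w : SpaceTime n → ℝ)
    (G : SpaceTime n → EuclideanSpace ℝ (Fin n)) : Prop where
  locallyIntegrable : LocallyIntegrableOn w A
  locallyIntegrable_grad : LocallyIntegrableOn G A
  integral_eq : ∀ φ, IsTestFunction A φ →
    ∫ z in A, w z • spaceGrad φ z = - ∫ z in A, φ z • G z

/-- `A_τ = {(x, t) ∈ A | t ≥ τ}`. -/
def lateTimes (A : Set (SpaceTime n)) (τ : ℝ) : Set (SpaceTime n) := {z | z ∈ A ∧ τ ≤ z.2}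

/-- The class `𝓤(A)`: bounded functions whose weak derivatives `∂_t u` and `∇u` belong to
`L²(A_τ)` for every `τ > 0`. -/
structure MemU (A : Set (SpaceTime n)) (u : SpaceTime n → ℝ) : Prop where
  bounded : MemLp u ⊤ (volume.restrict A)
  time : ∃ g, HasWeakTimeDeriv A u g ∧ ∀ τ > 0, MemLp g 2 (volume.restrict (lateTimes A τ))
  space : ∃ G, HasWeakSpaceGrad A u G ∧ ∀ τ > 0, MemLp G 2 (volume.restrict (lateTimes A τ))

/-- The class `𝓥(A)`: bounded functions whose weak derivative `∂_t v` belongs to `L¹(A)`. -/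
structure MemV (A : Set (SpaceTime n)) (v : SpaceTime n → ℝ) : Prop where
  bounded : MemLp v ⊤ (volume.restrict A)
  time : ∃ g, HasWeakTimeDeriv A v g ∧ IntegrableOn g A

/-- `∂_t u ≥ Δu - f` in `A` in the weak formulation. (The weak gradient `G` of `u` is unique up to
null sets.) -/
def WeakDiffusionGE (A : Set (SpaceTime n)) (u f : SpaceTime n → ℝ) : Prop :=
  ∃ G, HasWeakSpaceGrad A u G ∧ ∀ φ, IsTestFunction A φ → (∀ z, 0 ≤ φ z) →
    0 ≤ ∫ z in A, (- u z * timeDeriv φ z + ⟪G z, spaceGrad φ z⟫ + f z * φ z)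

/-- `∂_t v ≤ -f` in `A` in the weak formulation. -/
def WeakReactionLE (A : Set (SpaceTime n)) (v f : SpaceTime n → ℝ) : Prop :=
  ∀ φ, IsTestFunction A φ → (∀ z, 0 ≤ φ z) →
    ∫ z in A, (- v z * timeDeriv φ z + f z * φ z) ≤ 0

/-- `(u, v)` is a nonnegative weak supersolution pair in `A`: `u ∈ 𝓤(A)`, `v ∈ 𝓥(A)` and
`∂_t u ≥ Δu - k u v`, `∂_t v ≤ -k u^{m₃} v^{m₄}` in `A` in the weak formulation. -/
structure IsSupersolutionPair (k m₃ m₄ : ℝ) (A : Set (SpaceTime n)) (u v : SpaceTime n → ℝ) :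
    Prop where
  memU : MemU A u
  memV : MemV A v
  u_nonneg : ∀ z ∈ A, 0 ≤ u z
  v_nonneg : ∀ z ∈ A, 0 ≤ v z
  diffusion : WeakDiffusionGE A u (fun z => k * u z * v z)
  reaction : WeakReactionLE A v (fun z => k * u z ^ m₃ * v z ^ m₄)

/-- The indices `i` at which the minimum `min_j u_j(z)` is attained; since `u_j` is a function on
`A_j`, only indices `j` with `z ∈ A_j` enter. -/
def argminSet {N : ℕ} (A : Fin N → Set (SpaceTime n)) (u : Fin N → SpaceTime n → ℝ)
    (z : SpaceTime n) : Set (Fin N) :=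
  {i | z ∈ A i ∧ ∀ j, z ∈ A j → u i z ≤ u j z}

open Classical in
/-- The index map `ℓ(z)`: the least index at which the minimum is attained
(and the irrelevant value `0` if `z` lies in no `A_i`). -/
def minIndex {N : ℕ} [NeZero N] (A : Fin N → Set (SpaceTime n)) (u : Fin N → SpaceTime n → ℝ)
    (z : SpaceTime n) : Fin N :=
  if h : (Finset.univ.filter (· ∈ argminSet A u z)).Nonempty then
    (Finset.univ.filter (· ∈ argminSet A u z)).min' h
  else 0

theorem minIndex_isLeast {N : ℕ} [NeZero N] (A : Fin N → Set (SpaceTime n))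
    (u : Fin N → SpaceTime n → ℝ) {z : SpaceTime n} (hz : z ∈ ⋃ i, A i) :
    IsLeast (argminSet A u z) (minIndex A u z) := by
  classical
  obtain ⟨i₀, hi₀⟩ := mem_iUnion.1 hz
  have hne : (Finset.univ.filter (fun i => z ∈ A i)).Nonempty := ⟨i₀, by simpa using hi₀⟩
  obtain ⟨i, hi, hmin⟩ := Finset.exists_min_image _ (fun i => u i z) hne
  have h : (Finset.univ.filter (· ∈ argminSet A u z)).Nonempty :=
    ⟨i, by
      simp only [Finset.mem_filter, Finset.mem_univ, true_and] at hi hmin ⊢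
      exact ⟨hi, hmin⟩⟩
  have hl : minIndex A u z = (Finset.univ.filter (· ∈ argminSet A u z)).min' h := by
    unfold minIndex
    rw [dif_pos]
  rw [hl]
  have := Finset.isLeast_min' _ h
  simpa using this

/-- The patched function `w_ℓ(z) = w_{ℓ(z)}(z)`, where `ℓ` is the index map of the family `u`. For
`w = u` this is the pointwise minimum of the `u_i`. -/
def patch {N : ℕ} [NeZero N] (A : Fin N → Set (SpaceTime n)) (u w : Fin N → SpaceTime n → ℝ)
    (z : SpaceTime n) : ℝ :=
  w (minIndex A u z) z

/-- `w(z)` is not below the essential lower limit of `w` at `z`: every constant which is a lower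
bound for `w` almost everywhere near `z` is also a lower bound for the value `w(z)`. -/
def EssLiminfLE (w : SpaceTime n → ℝ) (z : SpaceTime n) : Prop :=
  ∀ c : ℝ, (∀ᶠ y in 𝓝 z ⊓ ae volume, c ≤ w y) → c ≤ w z

end

end FastReaction

/-! The function u is the pointwise minimum of the u_i. A minimum of weak supersolutions is again
one, here with source k u v_ℓ. The patched reactant v_ℓ is monotone in time but may jump, so it need
not lie in `MemV`. It is replaced by the solution V of ∂_t V = -k u^{m₃} V^{m₄} on each time line,
where u^{m₃} is set to zero outside A and V equals a constant M at t = 0 that bounds all the v_i.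
The reaction relation for V is an equality. Once v_ℓ ≤ V almost everywhere, u ≥ 0 gives k u v_ℓ ≤ k
u V, so the diffusion inequality survives the replacement.

Minimum property. It is local and is glued by a partition of unity. Off the boundaries of the A_i
the set of available indices is locally constant. Two supersolutions are handled by testing one with
φ η(u₁ - u₂) and the other with φ (1 - η(u₁ - u₂)), where η is a smooth decreasing step: the extra
term φ η' |∇(u₁ - u₂)|² is nonpositive, and η may then be sharpened to an indicator
(`IsLocalSupersolution.blend`, `IsLocalSupersolution.ite_le`, `IsLocalSupersolution.argmin`). At a
boundary point z with i = ℓ(z), continuity of u and the gap δ force u_i to omit an interval of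
values near z. A function with square integrable weak derivatives cannot jump over an interval
(`IsLocalSupersolution.le_or_ge_of_gap`), and the choice of representative excludes the upper side.
Hence ℓ = i a.e. near z, and u coincides there with one supersolution.

Comparison v_ℓ ≤ V. On almost every time line v_ℓ is monotone, hence differentiable a.e. At almost
every time the current index i = ℓ recurs at times accumulating from the right, and difference
quotients along these times inherit the integrated inequality for v_i
(`deriv_le_neg_of_accumulation`). Composing with the inverse Φ of the ODE solution gives a monotone
function whose a.e. derivative is at least u^{m₃}. Its singular part has the favourable sign, so
integration yields the bound (`IsReactionProfile.antitoneOn_le`). -/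

namespace FastReaction

/-! ### Mollification and its convergence in L² -/

section Mollifier

open scoped Convolution
open ContinuousLinearMap

variable {X : Type*} [NormedAddCommGroup X] [NormedSpace ℝ X] [FiniteDimensional ℝ X]

/-- A sequence of bump functions shrinking to the origin. -/
noncomputable def shrinkingBump (X : Type*) [NormedAddCommGroup X] [NormedSpace ℝ X]
    [FiniteDimensional ℝ X] (n : ℕ) : ContDiffBump (0 : X) where
  rIn := 1 / (2 * ((n : ℝ) + 1))
  rOut := 1 / ((n : ℝ) + 1)
  rIn_pos := by positivity
  rIn_lt_rOut := by
    apply one_div_lt_one_div_of_lt <;> linarith [(Nat.cast_nonneg n : (0 : ℝ) ≤ n)]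

theorem tendsto_shrinkingBump_rOut :
    Tendsto (fun n => (shrinkingBump X n).rOut) atTop (𝓝 0) :=
  tendsto_one_div_add_atTop_nhds_zero_nat

variable [MeasurableSpace X]

/-- The mollification of `f` at scale `1 / (n + 1)`. -/
noncomputable def mollify (μ : Measure X) (n : ℕ) (f : X → ℝ) : X → ℝ :=
  (shrinkingBump X n).normed μ ⋆[lsmul ℝ ℝ, μ] f

variable {μ : Measure X}

theorem mollify_apply (n : ℕ) (f : X → ℝ) (x : X) :
    mollify μ n f x = ∫ y, (shrinkingBump X n).normed μ y * f (x - y) ∂μ := rfl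

variable [BorelSpace X] [μ.IsAddHaarMeasure]

theorem mollify_apply_swap (n : ℕ) (f : X → ℝ) (x : X) :
    mollify μ n f x = ∫ y, (shrinkingBump X n).normed μ (x - y) * f y ∂μ := by
  unfold mollify
  rw [convolution_eq_swap]
  rfl

theorem contDiff_mollify {f : X → ℝ} (hf : LocallyIntegrable f μ) (n : ℕ) :
    ContDiff ℝ ∞ (mollify μ n f) :=
  (shrinkingBump X n).hasCompactSupport_normed.contDiff_convolution_left _
    (shrinkingBump X n).contDiff_normed hf

theorem ae_tendsto_mollify {f : X → ℝ} (hf : LocallyIntegrable f μ) :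
    ∀ᵐ x ∂μ, Tendsto (fun n => mollify μ n f x) atTop (𝓝 (f x)) := by
  refine ContDiffBump.ae_convolution_tendsto_right_of_locallyIntegrable (K := 2)
    tendsto_shrinkingBump_rOut (Eventually.of_forall fun n => ?_) hf
  simp only [shrinkingBump]
  apply le_of_eq
  field_simp

theorem mollify_sub {f g : X → ℝ} (hf : LocallyIntegrable f μ) (hg : LocallyIntegrable g μ)
    (n : ℕ) : mollify μ n (f - g) = mollify μ n f - mollify μ n g := by
  have hρ := (shrinkingBump X n).hasCompactSupport_normed (μ := μ)
  have hc := (shrinkingBump X n).continuous_normed (μ := μ)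
  have h1 : ConvolutionExists _ f (lsmul ℝ ℝ) μ := hρ.convolutionExists_left (lsmul ℝ ℝ) hc hf
  have h2 : ConvolutionExists _ g (lsmul ℝ ℝ) μ := hρ.convolutionExists_left (lsmul ℝ ℝ) hc hg
  funext x
  simp only [mollify_apply, Pi.sub_apply, mul_sub]
  exact integral_sub (h1 x) (h2 x)

theorem abs_mollify_le {f : X → ℝ} {C : ℝ} (hC : ∀ᵐ x ∂μ, |f x| ≤ C) (n : ℕ) (x : X) :
    |mollify μ n f x| ≤ C := by
  rw [mollify_apply_swap]
  have hint : Integrable (fun y => (shrinkingBump X n).normed μ (x - y)) μ :=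
    ((shrinkingBump X n).integrable_normed (μ := μ)).comp_sub_left x
  have h1 : ∫ y, (shrinkingBump X n).normed μ (x - y) ∂μ = 1 := by
    rw [integral_sub_left_eq_self (fun y => (shrinkingBump X n).normed μ y) μ x]
    exact (shrinkingBump X n).integral_normed
  calc |∫ y, (shrinkingBump X n).normed μ (x - y) * f y ∂μ|
      ≤ ∫ y, (shrinkingBump X n).normed μ (x - y) * C ∂μ := by
        rw [← Real.norm_eq_abs]
        refine norm_integral_le_of_norm_le (hint.mul_const C) ?_
        filter_upwards [hC] with y hy
        rw [norm_mul, Real.norm_eq_abs, Real.norm_eq_abs,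
          abs_of_nonneg ((shrinkingBump X n).nonneg_normed _)]
        exact mul_le_mul_of_nonneg_left hy ((shrinkingBump X n).nonneg_normed _)
    _ = C := by rw [integral_mul_const, h1, one_mul]

theorem mollify_congr_ae {f g : X → ℝ} (h : f =ᵐ[μ] g) (n : ℕ) :
    mollify μ n f = mollify μ n g := by
  funext x
  rw [mollify_apply_swap, mollify_apply_swap]
  refine integral_congr_ae ?_
  filter_upwards [h] with y hy
  rw [hy]

/-- The kernel is a probability density, so Jensen bounds the square of the average by the average
of the squares; Tonelli and translation invariance finish. Tonelli is the reason for passing to a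
measurable representative. -/
theorem eLpNorm_mollify_le {f : X → ℝ} (hf : AEStronglyMeasurable f μ) (n : ℕ) :
    eLpNorm (mollify μ n f) 2 μ ≤ eLpNorm f 2 μ := by
  rw [eLpNorm_congr_ae hf.ae_eq_mk, mollify_congr_ae hf.ae_eq_mk]
  set h := hf.mk f with hh
  have hm : Measurable h := hf.stronglyMeasurable_mk.measurable
  set ρ := (shrinkingBump X n).normed μ with hρ
  have hρc : Continuous ρ := (shrinkingBump X n).continuous_normed
  have hρ0 : ∀ y, 0 ≤ ρ y := (shrinkingBump X n).nonneg_normed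
  set ν := μ.withDensity (fun y => ENNReal.ofReal (ρ y)) with hν
  have hρm : Measurable fun y => ENNReal.ofReal (ρ y) := hρc.measurable.ennreal_ofReal
  have : IsProbabilityMeasure ν := by
    constructor
    rw [hν, withDensity_apply _ MeasurableSet.univ, Measure.restrict_univ,
      ← ofReal_integral_eq_lintegral_ofReal (shrinkingBump X n).integrable_normed
        (Eventually.of_forall hρ0), ContDiffBump.integral_normed, ENNReal.ofReal_one]
  have key : ∀ x, ‖mollify μ n h x‖ₑ ^ 2 ≤ ∫⁻ y, ‖h (x - y)‖ₑ ^ 2 ∂ν := by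
    intro x
    have hmx : Measurable fun y => h (x - y) := hm.comp (measurable_const.sub measurable_id)
    have h1 : ‖mollify μ n h x‖ₑ ≤ ∫⁻ y, ‖h (x - y)‖ₑ ∂ν := by
      rw [mollify_apply, hν, lintegral_withDensity_eq_lintegral_mul _ hρm hmx.enorm]
      refine (enorm_integral_le_lintegral_enorm _).trans (le_of_eq ?_)
      refine lintegral_congr fun y => ?_
      rw [enorm_mul, Pi.mul_apply, Real.enorm_of_nonneg (hρ0 y)]
    have h2 := eLpNorm_le_eLpNorm_of_exponent_le (μ := ν) (p := 1) (q := 2) (by norm_num)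
      hmx.aestronglyMeasurable
    rw [eLpNorm_one_eq_lintegral_enorm, eLpNorm_eq_lintegral_rpow_enorm_toReal (by norm_num)
      (by norm_num)] at h2
    have h3 := h1.trans h2
    calc ‖mollify μ n h x‖ₑ ^ 2
        ≤ ((∫⁻ y, ‖h (x - y)‖ₑ ^ (2 : ENNReal).toReal ∂ν) ^ (1 / (2 : ENNReal).toReal)) ^ 2 := by
          gcongr
      _ = ∫⁻ y, ‖h (x - y)‖ₑ ^ 2 ∂ν := by
          rw [← ENNReal.rpow_natCast, ← ENNReal.rpow_mul]
          norm_num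
  rw [eLpNorm_eq_lintegral_rpow_enorm_toReal (by norm_num) (by norm_num),
    eLpNorm_eq_lintegral_rpow_enorm_toReal (by norm_num) (by norm_num)]
  gcongr ?_ ^ _
  simp only [ENNReal.toReal_ofNat, ENNReal.rpow_ofNat]
  calc ∫⁻ x, ‖mollify μ n h x‖ₑ ^ 2 ∂μ ≤ ∫⁻ x, ∫⁻ y, ‖h (x - y)‖ₑ ^ 2 ∂ν ∂μ := lintegral_mono key
    _ = ∫⁻ y, ∫⁻ x, ‖h (x - y)‖ₑ ^ 2 ∂μ ∂ν := by
        refine lintegral_lintegral_swap (Measurable.aemeasurable ?_)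
        exact ((hm.comp (measurable_fst.sub measurable_snd)).enorm).pow_const 2
    _ = ∫⁻ y, ∫⁻ x, ‖h x‖ₑ ^ 2 ∂μ ∂ν := by
        refine lintegral_congr fun y => ?_
        exact lintegral_sub_right_eq_self (fun x => ‖h x‖ₑ ^ 2) y
    _ = ∫⁻ x, ‖h x‖ₑ ^ 2 ∂μ := by simp

/-- Uniform continuity makes the difference uniformly small. As all radii are at most 1, it lives on
the compact 1-thickening of the support, whose measure is finite. -/
theorem tendsto_eLpNorm_mollify_sub_of_continuous {g : X → ℝ} (hg : Continuous g)
    (hgs : HasCompactSupport g) :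
    Tendsto (fun n => eLpNorm (mollify μ n g - g) 2 μ) atTop (𝓝 0) := by
  have hK : IsCompact (Metric.cthickening 1 (tsupport g)) := hgs.isCompact.cthickening
  set K := Metric.cthickening 1 (tsupport g) with hKdef
  have hsupp : ∀ n x, x ∉ K → (mollify μ n g - g) x = 0 := by
    intro n x hx
    have hb : ∀ y ∈ Metric.ball x (shrinkingBump X n).rOut, g y = 0 := by
      intro y hy
      by_contra hne
      refine hx (Metric.mem_cthickening_of_dist_le x y 1 _ (subset_tsupport _ hne) ?_)
      rw [dist_comm]
      refine (Metric.mem_ball.1 hy).le.trans ?_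
      simp only [shrinkingBump]
      rw [div_le_one (by positivity)]
      linarith [(Nat.cast_nonneg n : (0 : ℝ) ≤ n)]
    have h0 : g x = 0 := hb x (Metric.mem_ball_self (shrinkingBump X n).rOut_pos)
    rw [Pi.sub_apply, mollify, ContDiffBump.normed_convolution_eq_right, sub_self]
    intro y hy
    rw [hb y hy, h0]
  have huc : UniformContinuous g := hgs.uniformContinuous_of_continuous hg
  rw [ENNReal.tendsto_nhds_zero]
  intro ε hε
  obtain ⟨η, hη, hηε⟩ : ∃ η : ℝ, 0 < η ∧
      μ K ^ (1 / (2 : ENNReal).toReal) * ENNReal.ofReal η ≤ ε := by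
    have hfin : μ K ^ (1 / (2 : ENNReal).toReal) ≠ ⊤ :=
      ENNReal.rpow_ne_top_of_nonneg (by norm_num) hK.measure_lt_top.ne
    have : Tendsto (fun η : ℝ => μ K ^ (1 / (2 : ENNReal).toReal) * ENNReal.ofReal η)
        (𝓝[>] 0) (𝓝 (μ K ^ (1 / (2 : ENNReal).toReal) * ENNReal.ofReal 0)) :=
      ENNReal.Tendsto.const_mul
        ((ENNReal.continuous_ofReal.tendsto 0).mono_left nhdsWithin_le_nhds) (Or.inr hfin)
    rw [ENNReal.ofReal_zero, mul_zero] at this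
    obtain ⟨η, h1, h2⟩ := (((ENNReal.tendsto_nhds_zero.1 this) ε hε).and
      self_mem_nhdsWithin).exists
    exact ⟨η, h2, h1⟩
  obtain ⟨d, hd, hdist⟩ := Metric.uniformContinuous_iff.1 huc η hη
  filter_upwards [(tendsto_shrinkingBump_rOut (X := X)).eventually (gt_mem_nhds hd)] with n hn
  have hbound : ∀ x, ‖(mollify μ n g - g) x‖ ≤ η := by
    intro x
    rw [Pi.sub_apply, ← dist_eq_norm]
    refine ContDiffBump.dist_normed_convolution_le hg.aestronglyMeasurable fun y hy => ?_
    exact (hdist ((Metric.mem_ball.1 hy).trans hn)).le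
  have heq : mollify μ n g - g = K.indicator (mollify μ n g - g) := by
    funext x
    by_cases hx : x ∈ K
    · rw [indicator_of_mem hx]
    · rw [indicator_of_notMem hx, hsupp n x hx]
  rw [heq, eLpNorm_indicator_eq_eLpNorm_restrict hK.isClosed.measurableSet]
  refine (eLpNorm_le_of_ae_bound (Eventually.of_forall hbound)).trans ?_
  rw [Measure.restrict_apply_univ]
  refine le_trans (le_of_eq ?_) hηε
  norm_num

/-- Density of compactly supported continuous functions, together with the fact that mollification
is an L² contraction. -/
theorem tendsto_eLpNorm_mollify_sub {f : X → ℝ} (hf : MemLp f 2 μ) :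
    Tendsto (fun n => eLpNorm (mollify μ n f - f) 2 μ) atTop (𝓝 0) := by
  rw [ENNReal.tendsto_nhds_zero]
  intro ε hε
  have hε3 : ε / 3 ≠ 0 := by simp [hε.ne']
  obtain ⟨g, hgs, hfg, hgc, hgm⟩ :=
    hf.exists_hasCompactSupport_eLpNorm_sub_le (by norm_num) hε3
  have hfl : LocallyIntegrable f μ := hf.locallyIntegrable (by norm_num)
  have hgl : LocallyIntegrable g μ := hgc.locallyIntegrable
  filter_upwards [(ENNReal.tendsto_nhds_zero.1
    (tendsto_eLpNorm_mollify_sub_of_continuous (μ := μ) hgc hgs)) (ε / 3)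
      (pos_iff_ne_zero.2 hε3)] with n hn
  have hdec : mollify μ n f - f = mollify μ n (f - g) + ((mollify μ n g - g) + (g - f)) := by
    rw [mollify_sub hfl hgl]
    abel
  have m1 : AEStronglyMeasurable (mollify μ n (f - g)) μ :=
    (contDiff_mollify (hfl.sub hgl) n).continuous.aestronglyMeasurable
  have m2 : AEStronglyMeasurable (mollify μ n g - g) μ :=
    ((contDiff_mollify hgl n).continuous.sub hgc).aestronglyMeasurable
  have m3 : AEStronglyMeasurable (g - f) μ := hgm.1.sub hf.1
  rw [hdec]
  calc _ ≤ eLpNorm (mollify μ n (f - g)) 2 μ + (eLpNorm (mollify μ n g - g) 2 μ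
        + eLpNorm (g - f) 2 μ) := by
        refine (eLpNorm_add_le m1 (m2.add m3) (by norm_num)).trans ?_
        gcongr
        exact eLpNorm_add_le m2 m3 (by norm_num)
    _ ≤ ε / 3 + (ε / 3 + ε / 3) := by
        gcongr
        · exact (eLpNorm_mollify_le (hf.1.sub hgm.1) n).trans hfg
        · rw [eLpNorm_sub_comm]
          exact hfg
    _ = ε := by
        rw [← add_assoc]
        exact ENNReal.add_thirds ε

end Mollifier

/-! ### Limits of integrals of products -/

section HolderLimits

variable {X : Type*} [MeasurableSpace X] {ν : Measure X}

theorem integrable_mul_of_memLp_two {f g : X → ℝ} (hf : MemLp f 2 ν) (hg : MemLp g 2 ν) :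
    Integrable (fun x => f x * g x) ν := hf.integrable_mul hg

theorem tendsto_lintegral_enorm_sub_mul {b : X → ℝ} {bs : ℕ → X → ℝ} {c : X → ℝ}
    (hb : AEStronglyMeasurable b ν) (hbs : ∀ n, AEStronglyMeasurable (bs n) ν)
    (hlim : Tendsto (fun n => eLpNorm (bs n - b) 2 ν) atTop (𝓝 0)) (hc : MemLp c 2 ν) :
    Tendsto (fun n => ∫⁻ x, ‖(bs n x - b x) * c x‖ₑ ∂ν) atTop (𝓝 0) := by
  have h1 : Tendsto (fun n => eLpNorm (bs n - b) 2 ν * eLpNorm c 2 ν) atTop (𝓝 0) := by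
    simpa using ENNReal.Tendsto.mul_const hlim (Or.inr hc.2.ne)
  refine tendsto_of_tendsto_of_tendsto_of_le_of_le tendsto_const_nhds h1
    (fun _ => zero_le) fun n => ?_
  have h2 := eLpNorm_smul_le_mul_eLpNorm (p := 2) (q := 2) (r := 1) (μ := ν) hc.1
    ((hbs n).sub hb)
  rw [eLpNorm_one_eq_lintegral_enorm] at h2
  exact h2

/-- Split off `as n * (bs n - b) * c`, which is small in L¹ by Hölder; dominated convergence treats
`as n * b * c`. In the applications `as n` is a nonlinear function of a mollification and `bs n` a
mollified derivative. -/
theorem tendsto_integral_mul_mul {a b c : X → ℝ} {as bs : ℕ → X → ℝ} {C : ℝ}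
    (has : ∀ n, AEStronglyMeasurable (as n) ν) (hC : ∀ n x, |as n x| ≤ C)
    (ha : ∀ᵐ x ∂ν, Tendsto (fun n => as n x) atTop (𝓝 (a x)))
    (hb : MemLp b 2 ν) (hbs : ∀ n, MemLp (bs n) 2 ν)
    (hlim : Tendsto (fun n => eLpNorm (bs n - b) 2 ν) atTop (𝓝 0)) (hc : MemLp c 2 ν) :
    Tendsto (fun n => ∫ x, as n x * (bs n x * c x) ∂ν) atTop (𝓝 (∫ x, a x * (b x * c x) ∂ν)) := by
  have hbc : Integrable (fun x => b x * c x) ν := hb.integrable_mul hc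
  have hdc : ∀ n, Integrable (fun x => (bs n x - b x) * c x) ν := fun n =>
    ((hbs n).sub hb).integrable_mul hc
  have hmul : ∀ n {f : X → ℝ}, Integrable f ν → Integrable (fun x => as n x * f x) ν :=
    fun n f hf => hf.bdd_mul (has n) (Eventually.of_forall (hC n))
  have h1 : Tendsto (fun n => ∫ x, as n x * ((bs n x - b x) * c x) ∂ν) atTop (𝓝 0) := by
    have := tendsto_integral_of_L1 (μ := ν) (fun _ => (0 : ℝ)) aestronglyMeasurable_const
      (F := fun n x => as n x * ((bs n x - b x) * c x)) (l := atTop)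
      (Eventually.of_forall fun n => hmul n (hdc n)) ?_
    · simpa using this
    have h2 := tendsto_lintegral_enorm_sub_mul hb.1 (fun n => (hbs n).1) hlim hc
    have h3 : Tendsto (fun n => ENNReal.ofReal C * ∫⁻ x, ‖(bs n x - b x) * c x‖ₑ ∂ν) atTop
        (𝓝 0) := by
      simpa using ENNReal.Tendsto.const_mul h2 (Or.inr ENNReal.ofReal_ne_top)
    refine tendsto_of_tendsto_of_tendsto_of_le_of_le tendsto_const_nhds h3
      (fun _ => zero_le) fun n => ?_
    dsimp only
    rw [← lintegral_const_mul' _ _ ENNReal.ofReal_ne_top]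
    refine lintegral_mono fun x => ?_
    rw [sub_zero, enorm_mul]
    gcongr
    rw [Real.enorm_eq_ofReal_abs]
    exact ENNReal.ofReal_le_ofReal (hC n x)
  have h2 : Tendsto (fun n => ∫ x, as n x * (b x * c x) ∂ν) atTop
      (𝓝 (∫ x, a x * (b x * c x) ∂ν)) := by
    refine tendsto_integral_of_dominated_convergence (fun x => C * ‖b x * c x‖)
      (fun n => (has n).mul hbc.1) (hbc.norm.const_mul C) (fun n => Eventually.of_forall fun x => ?_)
      ?_
    · rw [norm_mul]
      exact mul_le_mul_of_nonneg_right (hC n x) (norm_nonneg _)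
    · filter_upwards [ha] with x hx using hx.mul_const _
  have h3 := h1.add h2
  rw [zero_add] at h3
  refine h3.congr fun n => ?_
  rw [← integral_add (hmul n (hdc n)) (hmul n hbc)]
  refine integral_congr_ae (Eventually.of_forall fun x => ?_)
  ring

end HolderLimits

/-! ### Directional weak derivatives and mollification -/

section WeakDerivatives

variable {n : ℕ}

/-- `g` is the weak derivative of `w` in the direction `d` on `U`, tested against `C_c^∞(U)`. -/
def HasWeakDirDeriv (U : Set (SpaceTime n)) (w g : SpaceTime n → ℝ) (d : SpaceTime n) : Prop :=
  ∀ φ, IsTestFunction U φ → ∫ z in U, w z * fderiv ℝ φ z d = - ∫ z in U, g z * φ z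

instance : (volume : Measure (SpaceTime n)).IsAddHaarMeasure :=
  inferInstanceAs ((volume : Measure (EuclideanSpace ℝ (Fin n))).prod
    (volume : Measure ℝ)).IsAddHaarMeasure

namespace IsTestFunction

variable {U V : Set (SpaceTime n)} {φ : SpaceTime n → ℝ}

theorem mono (h : IsTestFunction U φ) (hUV : U ⊆ V) : IsTestFunction V φ :=
  ⟨h.smooth, h.compactSupport, h.support_subset.trans hUV⟩

theorem continuous (h : IsTestFunction U φ) : Continuous φ := h.smooth.continuous

theorem differentiable (h : IsTestFunction U φ) : Differentiable ℝ φ :=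
  h.smooth.differentiable (by simp)

theorem continuous_fderiv_apply (h : IsTestFunction U φ) (d : SpaceTime n) :
    Continuous fun z => fderiv ℝ φ z d :=
  (h.smooth.continuous_fderiv (by simp)).clm_apply continuous_const

theorem hasCompactSupport_fderiv_apply (h : IsTestFunction U φ) (d : SpaceTime n) :
    HasCompactSupport fun z => fderiv ℝ φ z d := h.compactSupport.fderiv_apply ℝ d

theorem fderiv_eq_zero (_h : IsTestFunction U φ) {z : SpaceTime n} (hz : z ∉ tsupport φ)
    (d : SpaceTime n) : fderiv ℝ φ z d = 0 := by
  have : fderiv ℝ φ z = 0 := by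
    by_contra hne
    exact hz (support_fderiv_subset ℝ hne)
  simp [this]

theorem eq_zero {z : SpaceTime n} (hz : z ∉ tsupport φ) : φ z = 0 :=
  image_eq_zero_of_notMem_tsupport hz

theorem memLp (h : IsTestFunction U φ) {p : ENNReal} {ν : Measure (SpaceTime n)}
    [IsFiniteMeasureOnCompacts ν] : MemLp φ p ν :=
  h.continuous.memLp_of_hasCompactSupport h.compactSupport

theorem memLp_fderiv (h : IsTestFunction U φ) (d : SpaceTime n) {p : ENNReal}
    {ν : Measure (SpaceTime n)} [IsFiniteMeasureOnCompacts ν] :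
    MemLp (fun z => fderiv ℝ φ z d) p ν :=
  (h.continuous_fderiv_apply d).memLp_of_hasCompactSupport (h.hasCompactSupport_fderiv_apply d)

theorem exists_bound (h : IsTestFunction U φ) : ∃ C, ∀ z, |φ z| ≤ C :=
  h.continuous.bounded_above_of_compact_support h.compactSupport

theorem eventually_closedBall_subset (h : IsTestFunction U φ) (hU : IsOpen U) :
    ∀ᶠ k in atTop, ∀ z ∈ tsupport φ,
      Metric.closedBall z (shrinkingBump (SpaceTime n) k).rOut ⊆ U := by
  obtain ⟨δ, hδ, hsub⟩ := h.compactSupport.isCompact.exists_cthickening_subset_open hU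
    h.support_subset
  filter_upwards [(tendsto_shrinkingBump_rOut (X := SpaceTime n)).eventually (gt_mem_nhds hδ)]
    with k hk z hz
  exact ((Metric.closedBall_subset_closedBall hk.le).trans
    (Metric.closedBall_subset_cthickening hz δ)).trans hsub

end IsTestFunction

theorem setIntegral_mul_eq_of_tsupport_subset {V A : Set (SpaceTime n)} {f φ : SpaceTime n → ℝ}
    (hVA : V ⊆ A) (hA : MeasurableSet A) (hφ : ∀ z, z ∉ V → φ z = 0) :
    ∫ z in A, f z * φ z = ∫ z in V, f z * φ z :=
  (setIntegral_eq_of_subset_of_forall_sdiff_eq_zero hA hVA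
    fun z hz => by rw [hφ z hz.2, mul_zero])

theorem isTestFunction_shrinkingBump {U : Set (SpaceTime n)} {z : SpaceTime n} {k : ℕ}
    (hz : Metric.closedBall z (shrinkingBump (SpaceTime n) k).rOut ⊆ U) :
    IsTestFunction U fun y => (shrinkingBump (SpaceTime n) k).normed volume (z - y) := by
  have hsupp : tsupport (fun y => (shrinkingBump (SpaceTime n) k).normed volume (z - y)) ⊆
      Metric.closedBall z (shrinkingBump (SpaceTime n) k).rOut := by
    refine closure_minimal (fun y hy => ?_) Metric.isClosed_closedBall
    have : z - y ∈ Function.support ((shrinkingBump (SpaceTime n) k).normed volume) := hy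
    rw [ContDiffBump.support_normed_eq, Metric.mem_ball, dist_zero_right] at this
    rw [Metric.mem_closedBall, dist_comm, dist_eq_norm]
    exact this.le
  exact ⟨(ContDiffBump.contDiff_normed _).comp (contDiff_const.sub contDiff_id),
    HasCompactSupport.of_support_subset_isCompact (isCompact_closedBall z _)
      ((subset_tsupport _).trans hsupp), hsupp.trans hz⟩

theorem mollify_indicator {U : Set (SpaceTime n)} (hU : MeasurableSet U) (f : SpaceTime n → ℝ)
    (k : ℕ) (z : SpaceTime n) :
    mollify volume k (U.indicator f) z =
      ∫ y in U, f y * (shrinkingBump (SpaceTime n) k).normed volume (z - y) := by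
  rw [mollify_apply_swap, ← integral_indicator hU]
  refine integral_congr_ae (Eventually.of_forall fun y => ?_)
  by_cases hy : y ∈ U <;> simp [hy, mul_comm]

/-- The derivative is placed on the kernel; the sign arises because the kernel is differentiated in
`y` rather than `z`. This is the form in which the weak formulation can be applied. -/
theorem fderiv_mollify_indicator {U : Set (SpaceTime n)} (hU : MeasurableSet U)
    {f : SpaceTime n → ℝ} (hf : IntegrableOn f U) (k : ℕ) (z d : SpaceTime n) :
    fderiv ℝ (mollify volume k (U.indicator f)) z d = - ∫ y in U, f y *
      fderiv ℝ (fun y => (shrinkingBump (SpaceTime n) k).normed volume (z - y)) y d := by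
  set ρ := (shrinkingBump (SpaceTime n) k).normed volume with hρ
  have hρs : ContDiff ℝ 1 ρ := ContDiffBump.contDiff_normed _
  have hρc : HasCompactSupport ρ := ContDiffBump.hasCompactSupport_normed _
  have hloc : LocallyIntegrable (U.indicator f) volume :=
    (hf.integrable_indicator hU).locallyIntegrable
  have h1 := hρc.hasFDerivAt_convolution_left (ContinuousLinearMap.lsmul ℝ ℝ) hρs hloc z
  have h2 : fderiv ℝ (mollify volume k (U.indicator f)) z = _ := h1.fderiv
  have hex := (hρc.fderiv ℝ).convolutionExists_left
    ((ContinuousLinearMap.lsmul ℝ ℝ : ℝ →L[ℝ] ℝ →L[ℝ] ℝ).precompL (SpaceTime n))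
    (hρs.continuous_fderiv one_ne_zero) hloc z
  rw [h2, convolution_def, ContinuousLinearMap.integral_apply hex, ← integral_neg,
    ← integral_indicator hU, ← integral_sub_left_eq_self _ volume z]
  refine integral_congr_ae (Eventually.of_forall fun y => ?_)
  have hd : fderiv ℝ (fun y => ρ (z - y)) y = - fderiv ℝ ρ (z - y) := by
    have := ((hρs.differentiable one_ne_zero) (z - y)).hasFDerivAt.comp y
      ((hasFDerivAt_const z y).sub (hasFDerivAt_id y))
    rw [HasFDerivAt.fderiv (f := fun y => ρ (z - y)) this]
    ext <;> simp
  by_cases hy : y ∈ U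
  · simp [hy, hd, ContinuousLinearMap.precompL_apply, mul_comm]
  · simp [hy]

/-- When the ball of the kernel fits into U, the reflected and translated kernel is itself an
admissible test function. -/
theorem HasWeakDirDeriv.fderiv_mollify {U : Set (SpaceTime n)} {w g : SpaceTime n → ℝ}
    {d : SpaceTime n} (h : HasWeakDirDeriv U w g d) (hU : MeasurableSet U)
    (hw : IntegrableOn w U) {k : ℕ} {z : SpaceTime n}
    (hz : Metric.closedBall z (shrinkingBump (SpaceTime n) k).rOut ⊆ U) :
    fderiv ℝ (mollify volume k (U.indicator w)) z d = mollify volume k (U.indicator g) z := by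
  rw [fderiv_mollify_indicator hU hw, mollify_indicator hU, h _ (isTestFunction_shrinkingBump hz),
    neg_neg]

theorem ae_restrict_tendsto_mollify {U : Set (SpaceTime n)} (hU : MeasurableSet U)
    {f : SpaceTime n → ℝ} (hf : IntegrableOn f U) :
    ∀ᵐ z ∂volume.restrict U,
      Tendsto (fun k => mollify volume k (U.indicator f) z) atTop (𝓝 (f z)) := by
  rw [ae_restrict_iff' hU]
  filter_upwards [ae_tendsto_mollify (hf.integrable_indicator hU).locallyIntegrable] with z hz hzU
  rwa [indicator_of_mem hzU] at hz

theorem tendsto_eLpNorm_mollify_sub_restrict {U : Set (SpaceTime n)} (hU : MeasurableSet U)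
    {f : SpaceTime n → ℝ} (hf : MemLp f 2 (volume.restrict U)) :
    Tendsto (fun k => eLpNorm (mollify volume k (U.indicator f) - f) 2 (volume.restrict U)) atTop
      (𝓝 0) := by
  have h := tendsto_eLpNorm_mollify_sub ((memLp_indicator_iff_restrict hU).2 hf)
  refine tendsto_of_tendsto_of_tendsto_of_le_of_le tendsto_const_nhds h
    (fun _ => zero_le) fun k => ?_
  refine le_trans (le_of_eq (eLpNorm_congr_ae ?_)) (eLpNorm_mono_measure _ Measure.restrict_le_self)
  filter_upwards [ae_restrict_mem hU] with z hz
  simp [hz]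

theorem memLp_mollify_restrict {U : Set (SpaceTime n)} (hU : MeasurableSet U)
    {f : SpaceTime n → ℝ} (hf : MemLp f 2 (volume.restrict U)) (k : ℕ) :
    MemLp (mollify volume k (U.indicator f)) 2 (volume.restrict U) := by
  have hi : MemLp (U.indicator f) 2 volume := (memLp_indicator_iff_restrict hU).2 hf
  have hs := contDiff_mollify (hi.locallyIntegrable (by norm_num)) k
  exact MemLp.restrict U ⟨hs.continuous.aestronglyMeasurable,
    (eLpNorm_mollify_le hi.1 k).trans_lt hi.2⟩

end WeakDerivatives

/-! ### Smooth approximations of the indicator of the nonpositive half-line -/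

section SmoothStep

/-- A smooth antitone function equal to `1` on `(-∞, 0]` and to `0` on `[1 / c, ∞)`. -/
noncomputable def stepDown (c s : ℝ) : ℝ := 1 - Real.smoothTransition (c * s)

theorem contDiff_stepDown (c : ℝ) : ContDiff ℝ ∞ (stepDown c) :=
  contDiff_const.sub (Real.smoothTransition.contDiff.comp (contDiff_const.mul contDiff_id))

theorem continuous_stepDown (c : ℝ) : Continuous (stepDown c) := (contDiff_stepDown c).continuous

theorem stepDown_nonneg (c s : ℝ) : 0 ≤ stepDown c s :=
  sub_nonneg.2 (Real.smoothTransition.le_one _)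

theorem stepDown_le_one (c s : ℝ) : stepDown c s ≤ 1 :=
  sub_le_self _ (Real.smoothTransition.nonneg _)

theorem stepDown_of_nonpos {c s : ℝ} (hc : 0 < c) (hs : s ≤ 0) : stepDown c s = 1 := by
  rw [stepDown, Real.smoothTransition.zero_of_nonpos (mul_nonpos_of_nonneg_of_nonpos hc.le hs),
    sub_zero]

theorem stepDown_of_le {c s : ℝ} (hs : 1 ≤ c * s) : stepDown c s = 0 := by
  rw [stepDown, Real.smoothTransition.one_of_one_le hs, sub_self]

theorem antitone_stepDown {c : ℝ} (hc : 0 < c) : Antitone (stepDown c) := fun _ _ h =>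
  sub_le_sub_left (Real.smoothTransition.monotone (mul_le_mul_of_nonneg_left h hc.le)) _

theorem deriv_stepDown_of_neg {c s : ℝ} (hc : 0 < c) (hs : s < 0) : deriv (stepDown c) s = 0 := by
  have : stepDown c =ᶠ[𝓝 s] fun _ => 1 := by
    filter_upwards [gt_mem_nhds hs] with t ht using stepDown_of_nonpos hc ht.le
  rw [this.deriv_eq, deriv_const]

theorem deriv_stepDown_of_lt {c s : ℝ} (hs : 1 < c * s) : deriv (stepDown c) s = 0 := by
  have hev : ∀ᶠ t in 𝓝 s, 1 < c * t :=
    (continuous_const.mul continuous_id).continuousAt.eventually (lt_mem_nhds hs)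
  have : stepDown c =ᶠ[𝓝 s] fun _ => 0 := by
    filter_upwards [hev] with t ht using stepDown_of_le ht.le
  rw [this.deriv_eq, deriv_const]

theorem exists_bound_deriv_stepDown {c : ℝ} (hc : 0 < c) : ∃ C, ∀ s, |deriv (stepDown c) s| ≤ C := by
  have hcont : Continuous (deriv (stepDown c)) := (contDiff_stepDown c).continuous_deriv (by simp)
  have hsupp : HasCompactSupport (deriv (stepDown c)) := by
    refine HasCompactSupport.of_support_subset_isCompact (isCompact_Icc (a := 0) (b := 1 / c))
      fun s hs => ?_
    constructor
    · by_contra! h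
      exact hs (deriv_stepDown_of_neg hc h)
    · by_contra! h
      refine hs (deriv_stepDown_of_lt ?_)
      rw [div_lt_iff₀ hc] at h
      linarith
  exact hcont.bounded_above_of_compact_support hsupp

/-- The transition lies to the right of the origin, so the limit at 0 is 1. Ties `w₁ = w₂` therefore
select the first function, in agreement with the convention of the least index. -/
theorem tendsto_stepDown (s : ℝ) :
    Tendsto (fun k : ℕ => stepDown ((k : ℝ) + 1) s) atTop (𝓝 (if s ≤ 0 then 1 else 0)) := by
  split_ifs with hs
  · refine tendsto_const_nhds.congr fun k => ?_
    rw [stepDown_of_nonpos (by positivity) hs]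
  · push Not at hs
    refine tendsto_const_nhds.congr' ?_
    filter_upwards [(tendsto_natCast_atTop_atTop (R := ℝ)).eventually_ge_atTop (1 / s)] with k hk
    rw [stepDown_of_le]
    rw [div_le_iff₀ hs] at hk
    nlinarith

/-- The primitive of `stepDown c` vanishing at the origin. -/
noncomputable def stepDownPrimitive (c s : ℝ) : ℝ := ∫ t in (0 : ℝ)..s, stepDown c t

theorem hasDerivAt_stepDownPrimitive (c s : ℝ) :
    HasDerivAt (stepDownPrimitive c) (stepDown c s) s :=
  (continuous_stepDown c).integral_hasStrictDerivAt 0 s |>.hasDerivAt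

theorem deriv_stepDownPrimitive (c : ℝ) : deriv (stepDownPrimitive c) = stepDown c :=
  funext fun s => (hasDerivAt_stepDownPrimitive c s).deriv

theorem contDiff_stepDownPrimitive (c : ℝ) : ContDiff ℝ 1 (stepDownPrimitive c) := by
  rw [contDiff_one_iff_deriv, deriv_stepDownPrimitive]
  exact ⟨fun s => (hasDerivAt_stepDownPrimitive c s).differentiableAt, continuous_stepDown c⟩

theorem abs_stepDownPrimitive_le (c s : ℝ) : |stepDownPrimitive c s| ≤ |s| := by
  have h := intervalIntegral.norm_integral_le_of_norm_le_const (a := 0) (b := s) (C := 1)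
    (f := stepDown c) fun x _ => by
      rw [Real.norm_of_nonneg (stepDown_nonneg c x)]
      exact stepDown_le_one c x
  simpa [stepDownPrimitive] using h

theorem tendsto_stepDownPrimitive (s : ℝ) :
    Tendsto (fun k : ℕ => stepDownPrimitive ((k : ℝ) + 1) s) atTop (𝓝 (min s 0)) := by
  have h : Tendsto (fun k : ℕ => stepDownPrimitive ((k : ℝ) + 1) s) atTop
      (𝓝 (∫ t in (0 : ℝ)..s, if t ≤ 0 then 1 else 0)) := by
    refine intervalIntegral.tendsto_integral_filter_of_dominated_convergence (fun _ => 1)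
      (Eventually.of_forall fun k => (continuous_stepDown _).aestronglyMeasurable)
      (Eventually.of_forall fun k => Eventually.of_forall fun t _ => ?_)
      intervalIntegrable_const (Eventually.of_forall fun t _ => tendsto_stepDown t)
    rw [Real.norm_of_nonneg (stepDown_nonneg _ t)]
    exact stepDown_le_one _ t
  convert h using 2
  rcases le_or_gt s 0 with hs | hs
  · rw [min_eq_left hs, intervalIntegral.integral_congr (g := fun _ => (1 : ℝ))]
    · simp
    · intro t ht
      rw [uIcc_of_ge hs] at ht
      simp [ht.2]
  · rw [min_eq_right hs.le, intervalIntegral.integral_congr_ae (g := fun _ => (0 : ℝ))]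
    · simp
    · refine Eventually.of_forall fun t ht => ?_
      rw [uIoc_of_le hs.le] at ht
      simp [ht.1]

end SmoothStep

/-! ### Chain rule and weak derivative of a minimum -/

section ChainRule

variable {n : ℕ} {U : Set (SpaceTime n)}

/-- Finiteness of the measure absorbs the constant `F 0`, which need not vanish. -/
theorem memLp_comp_of_abs_sub_le {X : Type*} [MeasurableSpace X] {ν : Measure X}
    [IsFiniteMeasure ν] {w : X → ℝ} {F : ℝ → ℝ} {C : ℝ} {p : ENNReal} (hF : Continuous F)
    (hlip : ∀ a b, |F a - F b| ≤ C * |a - b|) (hw : MemLp w p ν) :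
    MemLp (fun z => F (w z)) p ν := by
  have hc : MemLp (fun _ : X => |F 0|) p ν := memLp_const _
  have hg : MemLp (fun z => |F 0| + C * ‖w z‖) p ν := hc.add (hw.norm.const_mul C)
  refine hg.mono (hF.comp_aestronglyMeasurable hw.1) (Eventually.of_forall fun z => ?_)
  have h1 := hlip (w z) 0
  have h2 := abs_sub_abs_le_abs_sub (F (w z)) (F 0)
  have h3 := le_abs_self (|F 0| + C * |w z|)
  rw [sub_zero] at h1
  rw [Real.norm_eq_abs, Real.norm_eq_abs, Real.norm_eq_abs]
  linarith

/-- The classical chain rule holds for mollifications. The left side converges because F is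
Lipschitz; on the right the factor `deriv F` is bounded and converges a.e., while the mollified
derivative converges in L². -/
theorem HasWeakDirDeriv.comp (hU : IsOpen U) (hfin : volume U ≠ ⊤) {w g : SpaceTime n → ℝ}
    {d : SpaceTime n} (h : HasWeakDirDeriv U w g d) (hw : MemLp w 2 (volume.restrict U))
    (hg : MemLp g 2 (volume.restrict U)) {F : ℝ → ℝ} (hF : ContDiff ℝ 1 F) {C : ℝ}
    (hC : ∀ x, |deriv F x| ≤ C) :
    HasWeakDirDeriv U (fun z => F (w z)) (fun z => deriv F (w z) * g z) d := by
  intro φ hφ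
  have : IsFiniteMeasure (volume.restrict U) := isFiniteMeasure_restrict.2 hfin
  have hUm := hU.measurableSet
  have hwi : IntegrableOn w U := hw.integrable (by norm_num)
  have hdF : Continuous (deriv F) := hF.continuous_deriv le_rfl
  have hlip : ∀ a b, |F a - F b| ≤ C * |a - b| := fun a b =>
    convex_univ.norm_image_sub_le_of_norm_deriv_le
      (fun x _ => (hF.differentiable one_ne_zero) x) (fun x _ => hC x) (mem_univ b) (mem_univ a)
  set ws := fun k => mollify volume k (U.indicator w) with hws
  set gs := fun k => mollify volume k (U.indicator g) with hgs
  have hws_diff : ∀ k, ContDiff ℝ ∞ (ws k) := fun k =>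
    contDiff_mollify (hwi.integrable_indicator hUm).locallyIntegrable k
  have hwlim := ae_restrict_tendsto_mollify hUm hwi
  have hFws : ∀ k, ContDiff ℝ 1 (fun z => F (ws k z)) := fun k =>
    hF.comp ((hws_diff k).of_le (by simp))
  have hFw : MemLp (fun z => F (w z)) 2 (volume.restrict U) :=
    memLp_comp_of_abs_sub_le hF.continuous hlip hw
  have hlhs : Tendsto (fun k => ∫ z in U, F (ws k z) * fderiv ℝ φ z d) atTop
      (𝓝 (∫ z in U, F (w z) * fderiv ℝ φ z d)) := by
    have hφm : MemLp (fun z => fderiv ℝ φ z d) 2 (volume.restrict U) := hφ.memLp_fderiv d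
    refine tendsto_integral_of_L1 _ (integrable_mul_of_memLp_two hFw hφm).1 (Eventually.of_forall fun k => ?_) ?_
    · exact ((hFws k).continuous.mul (hφ.continuous_fderiv_apply d)).integrable_of_hasCompactSupport
        (hφ.hasCompactSupport_fderiv_apply d).mul_left |>.integrableOn
    · have h2 := tendsto_lintegral_enorm_sub_mul hw.1
        (fun k => (memLp_mollify_restrict hUm hw k).1)
        (tendsto_eLpNorm_mollify_sub_restrict hUm hw) hφm
      have h3 := ENNReal.Tendsto.const_mul (a := ENNReal.ofReal C) h2
        (Or.inr ENNReal.ofReal_ne_top)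
      rw [mul_zero] at h3
      refine tendsto_of_tendsto_of_tendsto_of_le_of_le tendsto_const_nhds h3
        (fun _ => zero_le) fun k => ?_
      dsimp only
      rw [← lintegral_const_mul' _ _ ENNReal.ofReal_ne_top]
      refine lintegral_mono fun z => ?_
      rw [← sub_mul, enorm_mul, enorm_mul, ← mul_assoc]
      gcongr
      rw [Real.enorm_eq_ofReal_abs, Real.enorm_eq_ofReal_abs,
        ← ENNReal.ofReal_mul ((abs_nonneg _).trans (hC 0))]
      exact ENNReal.ofReal_le_ofReal (hlip _ _)
  have hrhs : Tendsto (fun k => ∫ z in U, deriv F (ws k z) * (gs k z * φ z)) atTop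
      (𝓝 (∫ z in U, deriv F (w z) * (g z * φ z))) := by
    refine tendsto_integral_mul_mul (C := C)
      (fun k => (hdF.comp (hws_diff k).continuous).aestronglyMeasurable) (fun k z => hC _) ?_ hg
      (fun k => memLp_mollify_restrict hUm hg k) (tendsto_eLpNorm_mollify_sub_restrict hUm hg)
      hφ.memLp
    filter_upwards [hwlim] with z hz using (hdF.tendsto _).comp hz
  -- Classical integration by parts over the whole space. Once the kernel radius is small, the
  -- derivative of the mollified `w` equals the mollified `g` on the support of φ.
  have heq : ∀ᶠ k in atTop, ∫ z in U, F (ws k z) * fderiv ℝ φ z d =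
      - ∫ z in U, deriv F (ws k z) * (gs k z * φ z) := by
    filter_upwards [hφ.eventually_closedBall_subset hU] with k hk
    have hd : ∀ z, fderiv ℝ (fun z => F (ws k z)) z d = deriv F (ws k z) * fderiv ℝ (ws k) z d := by
      intro z
      have h1 := ((hF.differentiable one_ne_zero) (ws k z)).hasDerivAt.comp_hasFDerivAt z
        (((hws_diff k).differentiable (by simp)) z).hasFDerivAt
      rw [HasFDerivAt.fderiv (f := fun z => F (ws k z)) h1]
      simp
    have hout : ∀ z, z ∉ U → φ z = 0 := fun z hz =>
      IsTestFunction.eq_zero fun h => hz (hφ.support_subset h)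
    have hcd : Continuous fun z => fderiv ℝ (fun z => F (ws k z)) z d :=
      ((hFws k).continuous_fderiv one_ne_zero).clm_apply continuous_const
    have hibp := integral_mul_fderiv_eq_neg_fderiv_mul_of_integrable (μ := volume)
      (f := fun z => F (ws k z)) (g := φ) (v := d)
      ((hcd.mul hφ.continuous).integrable_of_hasCompactSupport hφ.compactSupport.mul_left)
      (((hFws k).continuous.mul (hφ.continuous_fderiv_apply d)).integrable_of_hasCompactSupport
        (hφ.hasCompactSupport_fderiv_apply d).mul_left)
      (((hFws k).continuous.mul hφ.continuous).integrable_of_hasCompactSupport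
        hφ.compactSupport.mul_left)
      (fun z _ => (hFws k).differentiable one_ne_zero z) (fun z _ => hφ.differentiable z)
    rw [← setIntegral_eq_integral_of_forall_compl_eq_zero (s := U) (fun z hz => by
        rw [hφ.fderiv_eq_zero (fun h => hz (hφ.support_subset h)) d, mul_zero]),
      ← setIntegral_eq_integral_of_forall_compl_eq_zero (s := U)
        (f := fun z => fderiv ℝ (fun z => F (ws k z)) z d * φ z) (fun z hz => by
        rw [hout z hz, mul_zero])] at hibp
    rw [hibp]
    congr 1
    refine integral_congr_ae (Eventually.of_forall fun z => ?_)
    dsimp only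
    by_cases hz : z ∈ tsupport φ
    · rw [hd, h.fderiv_mollify hUm hwi (hk z hz), mul_assoc]
    · simp [IsTestFunction.eq_zero hz]
  simp only [mul_assoc]
  exact tendsto_nhds_unique (hlhs.congr' heq) hrhs.neg

theorem HasWeakDirDeriv.sub {w₁ w₂ g₁ g₂ : SpaceTime n → ℝ} {d : SpaceTime n}
    (h₁ : HasWeakDirDeriv U w₁ g₁ d) (h₂ : HasWeakDirDeriv U w₂ g₂ d)
    (hw₁ : MemLp w₁ 2 (volume.restrict U)) (hw₂ : MemLp w₂ 2 (volume.restrict U))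
    (hg₁ : MemLp g₁ 2 (volume.restrict U)) (hg₂ : MemLp g₂ 2 (volume.restrict U)) :
    HasWeakDirDeriv U (w₁ - w₂) (g₁ - g₂) d := by
  intro φ hφ
  simp only [Pi.sub_apply, sub_mul]
  have hφm : MemLp φ 2 (volume.restrict U) := hφ.memLp
  have hdφm : MemLp (fun z => fderiv ℝ φ z d) 2 (volume.restrict U) := hφ.memLp_fderiv d
  rw [integral_sub (integrable_mul_of_memLp_two hw₁ hdφm) (integrable_mul_of_memLp_two hw₂ hdφm),
    integral_sub (integrable_mul_of_memLp_two hg₁ hφm) (integrable_mul_of_memLp_two hg₂ hφm), h₁ φ hφ, h₂ φ hφ]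
  ring

/-- The weak derivative of a minimum. -/
theorem HasWeakDirDeriv.ite_le (hU : IsOpen U) (hfin : volume U ≠ ⊤)
    {w₁ w₂ g₁ g₂ : SpaceTime n → ℝ} {d : SpaceTime n}
    (h₁ : HasWeakDirDeriv U w₁ g₁ d) (h₂ : HasWeakDirDeriv U w₂ g₂ d)
    (hw₁ : MemLp w₁ 2 (volume.restrict U)) (hw₂ : MemLp w₂ 2 (volume.restrict U))
    (hg₁ : MemLp g₁ 2 (volume.restrict U)) (hg₂ : MemLp g₂ 2 (volume.restrict U)) :
    HasWeakDirDeriv U (fun z => if w₁ z ≤ w₂ z then w₁ z else w₂ z)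
      (fun z => if w₁ z ≤ w₂ z then g₁ z else g₂ z) d := by
  intro φ hφ
  have hφm : MemLp φ 2 (volume.restrict U) := hφ.memLp
  have hdφm : MemLp (fun z => fderiv ℝ φ z d) 2 (volume.restrict U) := hφ.memLp_fderiv d
  have hs : MemLp (w₁ - w₂) 2 (volume.restrict U) := hw₁.sub hw₂
  have hσ : MemLp (g₁ - g₂) 2 (volume.restrict U) := hg₁.sub hg₂
  have hsub := h₁.sub h₂ hw₁ hw₂ hg₁ hg₂
  have hsi := integrable_mul_of_memLp_two hs hdφm
  have hσi := integrable_mul_of_memLp_two hσ hφm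
  -- Write the minimum as `w₂ + min (w₁ - w₂) 0` and approximate the second term by C¹ functions of
  -- `w₁ - w₂`.
  have hk : ∀ k : ℕ,
      ∫ z in U, stepDownPrimitive ((k : ℝ) + 1) ((w₁ - w₂) z) * fderiv ℝ φ z d =
      - ∫ z in U, stepDown ((k : ℝ) + 1) ((w₁ - w₂) z) * (g₁ - g₂) z * φ z := by
    intro k
    have h := hsub.comp hU hfin hs hσ (contDiff_stepDownPrimitive ((k : ℝ) + 1)) (C := 1)
      (fun x => by
        rw [deriv_stepDownPrimitive, abs_of_nonneg (stepDown_nonneg _ _)]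
        exact stepDown_le_one _ _) φ hφ
    rwa [deriv_stepDownPrimitive] at h
  have hm1 : ∀ k : ℕ, AEStronglyMeasurable (fun z => stepDownPrimitive ((k : ℝ) + 1) ((w₁ - w₂) z)
      * fderiv ℝ φ z d) (volume.restrict U) := fun k =>
    ((contDiff_stepDownPrimitive _).continuous.comp_aestronglyMeasurable hs.1).mul hdφm.1
  have hm2 : ∀ k : ℕ, AEStronglyMeasurable (fun z => stepDown ((k : ℝ) + 1) ((w₁ - w₂) z)
      * (g₁ - g₂) z * φ z) (volume.restrict U) := fun k =>
    (((continuous_stepDown _).comp_aestronglyMeasurable hs.1).mul hσ.1).mul hφm.1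
  have hb1 : ∀ k : ℕ, ∀ᵐ z ∂volume.restrict U, ‖stepDownPrimitive ((k : ℝ) + 1) ((w₁ - w₂) z)
      * fderiv ℝ φ z d‖ ≤ ‖(w₁ - w₂) z * fderiv ℝ φ z d‖ := fun k =>
    Eventually.of_forall fun z => by
      rw [norm_mul, norm_mul]
      exact mul_le_mul_of_nonneg_right (abs_stepDownPrimitive_le _ _) (norm_nonneg _)
  have hb2 : ∀ k : ℕ, ∀ᵐ z ∂volume.restrict U, ‖stepDown ((k : ℝ) + 1) ((w₁ - w₂) z)
      * (g₁ - g₂) z * φ z‖ ≤ ‖(g₁ - g₂) z * φ z‖ := fun k => Eventually.of_forall fun z => by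
      rw [mul_assoc, norm_mul, Real.norm_of_nonneg (stepDown_nonneg _ _)]
      exact mul_le_of_le_one_left (norm_nonneg _) (stepDown_le_one _ _)
  have ht1 : ∀ᵐ z ∂volume.restrict U, Tendsto (fun k : ℕ => stepDownPrimitive ((k : ℝ) + 1)
      ((w₁ - w₂) z) * fderiv ℝ φ z d) atTop (𝓝 (min ((w₁ - w₂) z) 0 * fderiv ℝ φ z d)) :=
    Eventually.of_forall fun z => (tendsto_stepDownPrimitive _).mul_const _
  have ht2 : ∀ᵐ z ∂volume.restrict U, Tendsto (fun k : ℕ => stepDown ((k : ℝ) + 1)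
      ((w₁ - w₂) z) * (g₁ - g₂) z * φ z) atTop
      (𝓝 ((if (w₁ - w₂) z ≤ 0 then 1 else 0) * (g₁ - g₂) z * φ z)) :=
    Eventually.of_forall fun z => ((tendsto_stepDown _).mul_const _).mul_const _
  have hl1 := tendsto_integral_of_dominated_convergence _ hm1 hsi.norm hb1 ht1
  have hl2 := tendsto_integral_of_dominated_convergence _ hm2 hσi.norm hb2 ht2
  have hlim := tendsto_nhds_unique (hl1.congr hk) hl2.neg
  have hi1 : Integrable (fun z => min ((w₁ - w₂) z) 0 * fderiv ℝ φ z d) (volume.restrict U) :=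
    hsi.norm.mono' (aestronglyMeasurable_of_tendsto_ae _ hm1 ht1) (by
      filter_upwards [ht1, ae_all_iff.2 hb1] with z h h'
      exact le_of_tendsto' h.norm h')
  have hi2 : Integrable (fun z => (if (w₁ - w₂) z ≤ 0 then 1 else 0) * (g₁ - g₂) z * φ z)
      (volume.restrict U) :=
    hσi.norm.mono' (aestronglyMeasurable_of_tendsto_ae _ hm2 ht2) (by
      filter_upwards [ht2, ae_all_iff.2 hb2] with z h h'
      exact le_of_tendsto' h.norm h')
  have hw := h₂ φ hφ
  have e1 : ∀ z, (if w₁ z ≤ w₂ z then w₁ z else w₂ z) * fderiv ℝ φ z d =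
      min ((w₁ - w₂) z) 0 * fderiv ℝ φ z d + w₂ z * fderiv ℝ φ z d := by
    intro z
    rw [← add_mul]
    congr 1
    rw [Pi.sub_apply]
    split_ifs with h
    · rw [min_eq_left (by linarith)]; ring
    · rw [min_eq_right (by linarith)]; ring
  have e2 : ∀ z, (if w₁ z ≤ w₂ z then g₁ z else g₂ z) * φ z =
      (if (w₁ - w₂) z ≤ 0 then 1 else 0) * (g₁ - g₂) z * φ z + g₂ z * φ z := by
    intro z
    simp only [Pi.sub_apply, sub_nonpos]
    split_ifs <;> ring
  simp only [e1, e2]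
  rw [integral_add hi1 (integrable_mul_of_memLp_two hw₂ hdφm), integral_add hi2 (integrable_mul_of_memLp_two hg₂ hφm), hw,
    hlim]
  ring

end ChainRule

/-! ### The minimum of two supersolutions -/

section LocalSupersolutions

variable {n : ℕ}

/-- The functions are measurable only up to null sets, so a comparison set such as `u₁ ≤ u₂` is
merely null measurable. -/
theorem memLp_ite {X F : Type*} [MeasurableSpace X] [NormedAddCommGroup F] {ν : Measure X}
    {P : X → Prop} [DecidablePred P] {f g : X → F} {p : ENNReal}
    (hP : NullMeasurableSet {x | P x} ν) (hf : MemLp f p ν) (hg : MemLp g p ν) :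
    MemLp (fun x => if P x then f x else g x) p ν := by
  classical
  obtain ⟨t, -, ht, hPt⟩ := hP.exists_measurable_superset_ae_eq
  have h : MemLp (t.piecewise f g) p ν := MemLp.piecewise ht (hf.restrict t) (hg.restrict tᶜ)
  refine h.ae_eq ?_
  filter_upwards [hPt.mem_iff] with x hx
  simp only [piecewise, hx]

/-- The direction of time in space-time. -/
def timeDir (n : ℕ) : SpaceTime n := (0, 1)

/-- The `i`-th spatial direction in space-time. -/
noncomputable def spaceDir {n : ℕ} (i : Fin n) : SpaceTime n := (EuclideanSpace.single i 1, 0)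

/-- `u` has square integrable weak derivatives `∂_t u = g`, `∇u = G` in `U` and satisfies
`g ≥ div G - f` weakly. -/
structure IsLocalSupersolution (U : Set (SpaceTime n)) (u g : SpaceTime n → ℝ)
    (G : SpaceTime n → EuclideanSpace ℝ (Fin n)) (f : SpaceTime n → ℝ) : Prop where
  memLp : MemLp u 2 (volume.restrict U)
  memLp_time : MemLp g 2 (volume.restrict U)
  memLp_space : MemLp G 2 (volume.restrict U)
  memLp_source : MemLp f 2 (volume.restrict U)
  time : HasWeakDirDeriv U u g (timeDir n)
  space : ∀ i, HasWeakDirDeriv U u (fun z => G z i) (spaceDir i)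
  super : ∀ φ, IsTestFunction U φ → (∀ z, 0 ≤ φ z) →
    0 ≤ ∫ z in U, (∑ i, G z i * fderiv ℝ φ z (spaceDir i)) + (g z + f z) * φ z

theorem memLp_coord {X : Type*} [MeasurableSpace X] {ν : Measure X} {p : ENNReal}
    {G : X → EuclideanSpace ℝ (Fin n)} (hG : MemLp G p ν) (i : Fin n) :
    MemLp (fun z => G z i) p ν :=
  (EuclideanSpace.proj (𝕜 := ℝ) i).comp_memLp' hG

theorem IsLocalSupersolution.congr {U : Set (SpaceTime n)} {u u' g g' f f' : SpaceTime n → ℝ}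
    {G G' : SpaceTime n → EuclideanSpace ℝ (Fin n)} (h : IsLocalSupersolution U u g G f)
    (hu : u =ᵐ[volume.restrict U] u') (hg : g =ᵐ[volume.restrict U] g')
    (hG : G =ᵐ[volume.restrict U] G') (hf : f =ᵐ[volume.restrict U] f') :
    IsLocalSupersolution U u' g' G' f' where
  memLp := h.memLp.ae_eq hu
  memLp_time := h.memLp_time.ae_eq hg
  memLp_space := h.memLp_space.ae_eq hG
  memLp_source := h.memLp_source.ae_eq hf
  time φ hφ := by
    have h1 := h.time φ hφ
    rwa [integral_congr_ae (f := fun z => u z * fderiv ℝ φ z (timeDir n))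
        (g := fun z => u' z * fderiv ℝ φ z (timeDir n))
        (by filter_upwards [hu] with z hz; rw [hz]),
      integral_congr_ae (f := fun z => g z * φ z) (g := fun z => g' z * φ z)
        (by filter_upwards [hg] with z hz; rw [hz])] at h1
  space i φ hφ := by
    have h1 := h.space i φ hφ
    rwa [integral_congr_ae (f := fun z => u z * fderiv ℝ φ z (spaceDir i))
        (g := fun z => u' z * fderiv ℝ φ z (spaceDir i))
        (by filter_upwards [hu] with z hz; rw [hz]),
      integral_congr_ae (f := fun z => G z i * φ z) (g := fun z => G' z i * φ z)
        (by filter_upwards [hG] with z hz; rw [hz])] at h1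
  super φ hφ h0 := by
    have h1 := h.super φ hφ h0
    rwa [integral_congr_ae (g := fun z =>
      (∑ i, G' z i * fderiv ℝ φ z (spaceDir i)) + (g' z + f' z) * φ z)
        (by filter_upwards [hg, hG, hf] with z h1 h2 h3; rw [h1, h2, h3])] at h1

theorem IsLocalSupersolution.mono {U V : Set (SpaceTime n)} {u g f : SpaceTime n → ℝ}
    {G : SpaceTime n → EuclideanSpace ℝ (Fin n)} (h : IsLocalSupersolution U u g G f)
    (hU : MeasurableSet U) (hVU : V ⊆ U) : IsLocalSupersolution V u g G f := by
  have hle : volume.restrict V ≤ volume.restrict U := Measure.restrict_mono hVU le_rfl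
  have key : ∀ {w w' : SpaceTime n → ℝ} {d}, HasWeakDirDeriv U w w' d →
      HasWeakDirDeriv V w w' d := by
    intro w w' d hw φ hφ
    have h1 := hw φ (hφ.mono hVU)
    rwa [setIntegral_mul_eq_of_tsupport_subset hVU hU
        (fun z hz => hφ.fderiv_eq_zero (fun h => hz (hφ.support_subset h)) d),
      setIntegral_mul_eq_of_tsupport_subset hVU hU
        (fun z hz => IsTestFunction.eq_zero fun h => hz (hφ.support_subset h))] at h1
  refine ⟨h.memLp.mono_measure hle, h.memLp_time.mono_measure hle, h.memLp_space.mono_measure hle,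
    h.memLp_source.mono_measure hle, key h.time, fun i => key (h.space i), fun φ hφ h0 => ?_⟩
  have h1 := h.super φ (hφ.mono hVU) h0
  rwa [setIntegral_eq_of_subset_of_forall_sdiff_eq_zero hU hVU] at h1
  intro z hz
  have hzφ : z ∉ tsupport φ := fun h => hz.2 (hφ.support_subset h)
  simp [hφ.fderiv_eq_zero hzφ, IsTestFunction.eq_zero hzφ]

/-- The pointwise minimum of two supersolutions, tested with a smooth transition between them. -/
theorem IsLocalSupersolution.blend {U : Set (SpaceTime n)} (hU : IsOpen U)
    (hfin : volume U ≠ ⊤) {u₁ u₂ g₁ g₂ f₁ f₂ : SpaceTime n → ℝ}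
    {G₁ G₂ : SpaceTime n → EuclideanSpace ℝ (Fin n)} (h₁ : IsLocalSupersolution U u₁ g₁ G₁ f₁)
    (h₂ : IsLocalSupersolution U u₂ g₂ G₂ f₂) {c : ℝ} (hc : 0 < c) {φ : SpaceTime n → ℝ}
    (hφ : IsTestFunction U φ) (h0 : ∀ z, 0 ≤ φ z) :
    0 ≤ ∫ z in U, (stepDown c ((u₁ - u₂) z) *
        ((∑ i, G₁ z i * fderiv ℝ φ z (spaceDir i)) + (g₁ z + f₁ z) * φ z) +
      (1 - stepDown c ((u₁ - u₂) z)) *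
        ((∑ i, G₂ z i * fderiv ℝ φ z (spaceDir i)) + (g₂ z + f₂ z) * φ z)) := by
  have : IsFiniteMeasure (volume.restrict U) := isFiniteMeasure_restrict.2 hfin
  have hUm := hU.measurableSet
  set P₁ := fun z => (∑ i, G₁ z i * fderiv ℝ φ z (spaceDir i)) + (g₁ z + f₁ z) * φ z with hP₁
  set P₂ := fun z => (∑ i, G₂ z i * fderiv ℝ φ z (spaceDir i)) + (g₂ z + f₂ z) * φ z with hP₂
  have hφm : MemLp φ 2 (volume.restrict U) := hφ.memLp
  have hP : ∀ {u g f : SpaceTime n → ℝ} {G : SpaceTime n → EuclideanSpace ℝ (Fin n)}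
      {ψ : SpaceTime n → ℝ}, IsLocalSupersolution U u g G f → IsTestFunction U ψ →
      Integrable (fun z => (∑ i, G z i * fderiv ℝ ψ z (spaceDir i)) + (g z + f z) * ψ z)
        (volume.restrict U) := by
    intro u g f G ψ h hψ
    refine (integrable_finsetSum _ fun i _ => integrable_mul_of_memLp_two
      (memLp_coord h.memLp_space i) (hψ.memLp_fderiv _)).add
      (integrable_mul_of_memLp_two (h.memLp_time.add h.memLp_source) hψ.memLp)
  have hP₁i : Integrable P₁ (volume.restrict U) := hP h₁ hφ
  have hP₂i : Integrable P₂ (volume.restrict U) := hP h₂ hφ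
  have hs : MemLp (u₁ - u₂) 2 (volume.restrict U) := h₁.memLp.sub h₂.memLp
  have hsi : IntegrableOn (u₁ - u₂) U := hs.integrable (by norm_num)
  have hD : ∀ i, MemLp (fun z => G₁ z i - G₂ z i) 2 (volume.restrict U) := fun i =>
    (memLp_coord h₁.memLp_space i).sub (memLp_coord h₂.memLp_space i)
  have hDw : ∀ i, HasWeakDirDeriv U (u₁ - u₂) (fun z => G₁ z i - G₂ z i) (spaceDir i) := fun i =>
    (h₁.space i).sub (h₂.space i) h₁.memLp h₂.memLp (memLp_coord h₁.memLp_space i)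
      (memLp_coord h₂.memLp_space i)
  set s := fun k => mollify volume k (U.indicator (u₁ - u₂)) with hsdef
  set D := fun (i : Fin n) k => mollify volume k (U.indicator fun z => G₁ z i - G₂ z i) with hDdef
  have hsd : ∀ k, ContDiff ℝ ∞ (s k) := fun k =>
    contDiff_mollify (hsi.integrable_indicator hUm).locallyIntegrable k
  have hηs : ∀ k, ContDiff ℝ ∞ (fun z => stepDown c (s k z)) := fun k =>
    (contDiff_stepDown c).comp (hsd k)
  have hslim := ae_restrict_tendsto_mollify hUm hsi
  have hη' : Continuous (deriv (stepDown c)) := (contDiff_stepDown c).continuous_deriv (by simp)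
  obtain ⟨C, hC⟩ := exists_bound_deriv_stepDown hc
  obtain ⟨M, hM⟩ := hφ.exists_bound
  -- The difference `u₁ - u₂` is mollified so that both weights give smooth test functions. In the
  -- sum of the two inequalities the derivatives of the weights combine with `G₁ - G₂`. The time
  -- derivative stays on the solution, so no time derivative of a weight occurs.
  have hineq : ∀ᶠ k in atTop, 0 ≤ (∫ z in U, (stepDown c (s k z) * P₁ z +
      (1 - stepDown c (s k z)) * P₂ z)) +
      ∑ i, ∫ z in U, (φ z * deriv (stepDown c) (s k z)) * (D i k z * (G₁ z i - G₂ z i)) := by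
    filter_upwards [hφ.eventually_closedBall_subset hU] with k hk
    have hψ₁ : IsTestFunction U fun z => φ z * stepDown c (s k z) :=
      ⟨hφ.smooth.mul (hηs k), hφ.compactSupport.mul_right,
        (tsupport_mul_subset_left).trans hφ.support_subset⟩
    have hψ₂ : IsTestFunction U fun z => φ z * (1 - stepDown c (s k z)) :=
      ⟨hφ.smooth.mul (contDiff_const.sub (hηs k)), hφ.compactSupport.mul_right,
        (tsupport_mul_subset_left).trans hφ.support_subset⟩
    have e₁ := h₁.super _ hψ₁ fun z => mul_nonneg (h0 z) (stepDown_nonneg _ _)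
    have e₂ := h₂.super _ hψ₂ fun z => mul_nonneg (h0 z) (sub_nonneg.2 (stepDown_le_one _ _))
    have hbd : ∀ z, ‖φ z * deriv (stepDown c) (s k z)‖ ≤ M * C := fun z => by
      rw [norm_mul]
      exact mul_le_mul (hM z) (hC _) (norm_nonneg _) ((abs_nonneg _).trans (hM z))
    have hTi : ∀ i, Integrable (fun z => (φ z * deriv (stepDown c) (s k z)) *
        (D i k z * (G₁ z i - G₂ z i))) (volume.restrict U) := fun i =>
      (integrable_mul_of_memLp_two (memLp_mollify_restrict hUm (hD i) k) (hD i)).bdd_mul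
        (hφ.continuous.mul (hη'.comp (hsd k).continuous)).aestronglyMeasurable
        (Eventually.of_forall hbd)
    have hblend : Integrable (fun z => stepDown c (s k z) * P₁ z +
        (1 - stepDown c (s k z)) * P₂ z) (volume.restrict U) := by
      refine (hP₁i.bdd_mul (c := 1) (hηs k).continuous.aestronglyMeasurable
        (Eventually.of_forall fun z => ?_)).add (hP₂i.bdd_mul (c := 1)
        (continuous_const.sub (hηs k).continuous).aestronglyMeasurable
        (Eventually.of_forall fun z => ?_))
      · rw [Real.norm_of_nonneg (stepDown_nonneg _ _)]
        exact stepDown_le_one _ _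
      · rw [Real.norm_of_nonneg (sub_nonneg.2 (stepDown_le_one _ _))]
        linarith [stepDown_nonneg c (s k z)]
    have hsum := add_nonneg e₁ e₂
    rw [← integral_add (hP h₁ hψ₁) (hP h₂ hψ₂)] at hsum
    rw [← integral_finsetSum _ fun i _ => hTi i, ← integral_add hblend
      (integrable_finsetSum _ fun i _ => hTi i)]
    refine hsum.trans_eq (integral_congr_ae (Eventually.of_forall fun z => ?_))
    dsimp only
    have hdη : HasFDerivAt (fun z => stepDown c (s k z))
        (deriv (stepDown c) (s k z) • fderiv ℝ (s k) z) z :=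
      (((contDiff_stepDown c).differentiable (by simp)) (s k z)).hasDerivAt.comp_hasFDerivAt z
        (((hsd k).differentiable (by simp)) z).hasFDerivAt
    have hdφ : HasFDerivAt φ (fderiv ℝ φ z) z := (hφ.differentiable z).hasFDerivAt
    have d₁ := (hdφ.mul hdη).fderiv
    have d₂ := (hdφ.mul ((hasFDerivAt_const (1 : ℝ) z).sub hdη)).fderiv
    have hds : ∀ i, φ z * (fderiv ℝ (s k) z (spaceDir i)) = φ z * D i k z := by
      intro i
      by_cases hz : z ∈ tsupport φ
      · rw [(hDw i).fderiv_mollify hUm hsi (hk z hz)]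
      · simp [IsTestFunction.eq_zero hz]
    have d₁' : ∀ i, fderiv ℝ (fun z => φ z * stepDown c (s k z)) z (spaceDir i) =
        stepDown c (s k z) * fderiv ℝ φ z (spaceDir i) +
          deriv (stepDown c) (s k z) * (φ z * D i k z) := by
      intro i
      erw [d₁]
      rw [← hds]
      simp
      ring
    have d₂' : ∀ i, fderiv ℝ (fun z => φ z * (1 - stepDown c (s k z))) z (spaceDir i) =
        (1 - stepDown c (s k z)) * fderiv ℝ φ z (spaceDir i) -
          deriv (stepDown c) (s k z) * (φ z * D i k z) := by
      intro i
      erw [d₂]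
      rw [← hds]
      simp
      ring
    have S₁ : ∑ i, G₁ z i * fderiv ℝ (fun z => φ z * stepDown c (s k z)) z (spaceDir i) =
        stepDown c (s k z) * ∑ i, G₁ z i * fderiv ℝ φ z (spaceDir i) +
          ∑ i, G₁ z i * (deriv (stepDown c) (s k z) * (φ z * D i k z)) := by
      rw [Finset.mul_sum, ← Finset.sum_add_distrib]
      exact Finset.sum_congr rfl fun i _ => by rw [d₁']; ring
    have S₂ : ∑ i, G₂ z i * fderiv ℝ (fun z => φ z * (1 - stepDown c (s k z))) z (spaceDir i) =
        (1 - stepDown c (s k z)) * ∑ i, G₂ z i * fderiv ℝ φ z (spaceDir i) -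
          ∑ i, G₂ z i * (deriv (stepDown c) (s k z) * (φ z * D i k z)) := by
      rw [Finset.mul_sum, ← Finset.sum_sub_distrib]
      exact Finset.sum_congr rfl fun i _ => by rw [d₂']; ring
    have S₃ : ∑ i, (φ z * deriv (stepDown c) (s k z)) * (D i k z * (G₁ z i - G₂ z i)) =
        ∑ i, G₁ z i * (deriv (stepDown c) (s k z) * (φ z * D i k z)) -
          ∑ i, G₂ z i * (deriv (stepDown c) (s k z) * (φ z * D i k z)) := by
      rw [← Finset.sum_sub_distrib]
      exact Finset.sum_congr rfl fun i _ => by ring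
    rw [S₁, S₂, S₃, hP₁, hP₂]
    ring
  have hlim1 : Tendsto (fun k => ∫ z in U, (stepDown c (s k z) * P₁ z +
      (1 - stepDown c (s k z)) * P₂ z)) atTop (𝓝 (∫ z in U, (stepDown c ((u₁ - u₂) z) * P₁ z +
      (1 - stepDown c ((u₁ - u₂) z)) * P₂ z))) := by
    refine tendsto_integral_of_dominated_convergence (fun z => ‖P₁ z‖ + ‖P₂ z‖) (fun k => ?_)
      (hP₁i.norm.add hP₂i.norm) (fun k => Eventually.of_forall fun z => ?_) ?_
    · exact ((hηs k).continuous.aestronglyMeasurable.mul hP₁i.1).add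
        ((continuous_const.sub (hηs k).continuous).aestronglyMeasurable.mul hP₂i.1)
    · refine (norm_add_le _ _).trans (add_le_add ?_ ?_)
      · rw [norm_mul, Real.norm_of_nonneg (stepDown_nonneg _ _)]
        exact mul_le_of_le_one_left (norm_nonneg _) (stepDown_le_one _ _)
      · rw [norm_mul, Real.norm_of_nonneg (sub_nonneg.2 (stepDown_le_one _ _))]
        exact mul_le_of_le_one_left (norm_nonneg _) (by linarith [stepDown_nonneg c (s k z)])
    · filter_upwards [hslim] with z hz
      have hz' := ((continuous_stepDown c).tendsto _).comp hz
      exact (hz'.mul_const _).add ((tendsto_const_nhds.sub hz').mul_const _)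
  have hlim2 : Tendsto (fun k => ∑ i, ∫ z in U, (φ z * deriv (stepDown c) (s k z)) *
      (D i k z * (G₁ z i - G₂ z i))) atTop
      (𝓝 (∑ i, ∫ z in U, (φ z * deriv (stepDown c) ((u₁ - u₂) z)) *
      ((G₁ z i - G₂ z i) * (G₁ z i - G₂ z i)))) := by
    refine tendsto_finsetSum _ fun i _ => ?_
    refine tendsto_integral_mul_mul (C := M * C) (fun k =>
      (hφ.continuous.mul (hη'.comp (hsd k).continuous)).aestronglyMeasurable) (fun k z => ?_) ?_
      (hD i) (fun k => memLp_mollify_restrict hUm (hD i) k)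
      (tendsto_eLpNorm_mollify_sub_restrict hUm (hD i)) (hD i)
    · rw [abs_mul]
      exact mul_le_mul (hM z) (hC _) (abs_nonneg _) ((abs_nonneg _).trans (hM z))
    · filter_upwards [hslim] with z hz using ((hη'.tendsto _).comp hz).const_mul _
  -- In the limit the extra term carries the square of `G₁ - G₂` and the nonpositive derivative of
  -- the step, so it can be dropped.
  have hnonpos : ∑ i, ∫ z in U, (φ z * deriv (stepDown c) ((u₁ - u₂) z)) *
      ((G₁ z i - G₂ z i) * (G₁ z i - G₂ z i)) ≤ 0 := by
    refine Finset.sum_nonpos fun i _ => integral_nonpos fun z => ?_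
    exact mul_nonpos_of_nonpos_of_nonneg (mul_nonpos_of_nonneg_of_nonpos (h0 z)
      (antitone_stepDown hc).deriv_nonpos) (mul_self_nonneg _)
  have := ge_of_tendsto (hlim1.add hlim2) hineq
  linarith

/-- The blended inequality holds for every steepness with no remainder, so dominated convergence
lets the steepness tend to infinity. -/
theorem IsLocalSupersolution.ite_le {U : Set (SpaceTime n)} (hU : IsOpen U)
    (hfin : volume U ≠ ⊤) {u₁ u₂ g₁ g₂ f₁ f₂ : SpaceTime n → ℝ}
    {G₁ G₂ : SpaceTime n → EuclideanSpace ℝ (Fin n)} (h₁ : IsLocalSupersolution U u₁ g₁ G₁ f₁)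
    (h₂ : IsLocalSupersolution U u₂ g₂ G₂ f₂) :
    IsLocalSupersolution U (fun z => if u₁ z ≤ u₂ z then u₁ z else u₂ z)
      (fun z => if u₁ z ≤ u₂ z then g₁ z else g₂ z) (fun z => if u₁ z ≤ u₂ z then G₁ z else G₂ z)
      (fun z => if u₁ z ≤ u₂ z then f₁ z else f₂ z) := by
  have hnull : NullMeasurableSet {z | u₁ z ≤ u₂ z} (volume.restrict U) :=
    nullMeasurableSet_le h₁.memLp.1.aemeasurable h₂.memLp.1.aemeasurable
  refine ⟨memLp_ite hnull h₁.memLp h₂.memLp, memLp_ite hnull h₁.memLp_time h₂.memLp_time,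
    memLp_ite hnull h₁.memLp_space h₂.memLp_space, memLp_ite hnull h₁.memLp_source h₂.memLp_source,
    h₁.time.ite_le hU hfin h₂.time h₁.memLp h₂.memLp h₁.memLp_time h₂.memLp_time,
    fun i => ?_, fun φ hφ h0 => ?_⟩
  · have h := (h₁.space i).ite_le hU hfin (h₂.space i) h₁.memLp h₂.memLp
      (memLp_coord h₁.memLp_space i) (memLp_coord h₂.memLp_space i)
    convert h using 2
    split_ifs <;> rfl
  · set P₁ := fun z => (∑ i, G₁ z i * fderiv ℝ φ z (spaceDir i)) + (g₁ z + f₁ z) * φ z with hP₁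
    set P₂ := fun z => (∑ i, G₂ z i * fderiv ℝ φ z (spaceDir i)) + (g₂ z + f₂ z) * φ z with hP₂
    have hP : ∀ {u g f : SpaceTime n → ℝ} {G : SpaceTime n → EuclideanSpace ℝ (Fin n)},
        IsLocalSupersolution U u g G f →
        Integrable (fun z => (∑ i, G z i * fderiv ℝ φ z (spaceDir i)) + (g z + f z) * φ z)
          (volume.restrict U) := by
      intro u g f G h
      refine (integrable_finsetSum _ fun i _ => integrable_mul_of_memLp_two
        (memLp_coord h.memLp_space i) (hφ.memLp_fderiv _)).add
        (integrable_mul_of_memLp_two (h.memLp_time.add h.memLp_source) hφ.memLp)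
    have hP₁i : Integrable P₁ (volume.restrict U) := hP h₁
    have hP₂i : Integrable P₂ (volume.restrict U) := hP h₂
    have hsm : AEStronglyMeasurable (u₁ - u₂) (volume.restrict U) := h₁.memLp.1.sub h₂.memLp.1
    have hlim : Tendsto (fun k : ℕ => ∫ z in U, (stepDown ((k : ℝ) + 1) ((u₁ - u₂) z) * P₁ z +
        (1 - stepDown ((k : ℝ) + 1) ((u₁ - u₂) z)) * P₂ z)) atTop
        (𝓝 (∫ z in U, ((if (u₁ - u₂) z ≤ 0 then 1 else 0) * P₁ z +
        (1 - (if (u₁ - u₂) z ≤ 0 then 1 else 0)) * P₂ z))) := by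
      refine tendsto_integral_of_dominated_convergence (fun z => ‖P₁ z‖ + ‖P₂ z‖) (fun k => ?_)
        (hP₁i.norm.add hP₂i.norm) (fun k => Eventually.of_forall fun z => ?_)
        (Eventually.of_forall fun z => ?_)
      · have hm := (continuous_stepDown ((k : ℝ) + 1)).comp_aestronglyMeasurable hsm
        exact (hm.mul hP₁i.1).add ((aestronglyMeasurable_const.sub hm).mul hP₂i.1)
      · refine (norm_add_le _ _).trans (add_le_add ?_ ?_)
        · rw [norm_mul, Real.norm_of_nonneg (stepDown_nonneg _ _)]
          exact mul_le_of_le_one_left (norm_nonneg _) (stepDown_le_one _ _)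
        · rw [norm_mul, Real.norm_of_nonneg (sub_nonneg.2 (stepDown_le_one _ _))]
          exact mul_le_of_le_one_left (norm_nonneg _)
            (by linarith [stepDown_nonneg ((k : ℝ) + 1) ((u₁ - u₂) z)])
      · have hz' := tendsto_stepDown ((u₁ - u₂) z)
        exact (hz'.mul_const _).add ((tendsto_const_nhds.sub hz').mul_const _)
    have hge := ge_of_tendsto' hlim fun k => h₁.blend hU hfin h₂ (c := (k : ℝ) + 1) (by positivity)
      hφ h0
    refine hge.trans_eq (integral_congr_ae (Eventually.of_forall fun z => ?_))
    simp only [Pi.sub_apply, sub_nonpos, hP₁, hP₂]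
    split_ifs <;> simp

end LocalSupersolutions

/-! ### Coordinate form of the weak formulation, finite minima, functions with a gap in their values
-/

section Localization

variable {n : ℕ}

theorem IsTestFunction.timeDeriv_eq {U : Set (SpaceTime n)} {φ : SpaceTime n → ℝ}
    (h : IsTestFunction U φ) (z : SpaceTime n) : timeDeriv φ z = fderiv ℝ φ z (timeDir n) := by
  have h1 : HasDerivAt (fun t : ℝ => ((z.1, t) : SpaceTime n)) (timeDir n) z.2 :=
    (hasDerivAt_const z.2 z.1).prodMk (hasDerivAt_id z.2)
  exact ((h.differentiable z).hasFDerivAt.comp_hasDerivAt z.2 h1).deriv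

theorem IsTestFunction.spaceGrad_eq {U : Set (SpaceTime n)} {φ : SpaceTime n → ℝ}
    (h : IsTestFunction U φ) (z : SpaceTime n) (i : Fin n) :
    spaceGrad φ z i = fderiv ℝ φ z (spaceDir i) := by
  have h1 : HasFDerivAt (fun x => ((x, z.2) : SpaceTime n))
      ((ContinuousLinearMap.id ℝ (EuclideanSpace ℝ (Fin n))).prod 0) z.1 :=
    (hasFDerivAt_id z.1).prodMk (hasFDerivAt_const z.2 z.1)
  have h2 := (h.differentiable z).hasFDerivAt.comp z.1 h1
  have h3 : inner ℝ (spaceGrad φ z) (EuclideanSpace.single i 1) = spaceGrad φ z i := by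
    rw [EuclideanSpace.inner_single_right]
    simp
  rw [← h3, spaceGrad, gradient, InnerProductSpace.toDual_symm_apply,
    HasFDerivAt.fderiv (f := fun x => φ (x, z.2)) h2]
  rfl

theorem IsTestFunction.inner_spaceGrad {U : Set (SpaceTime n)} {φ : SpaceTime n → ℝ}
    (h : IsTestFunction U φ) (z : SpaceTime n) (G : EuclideanSpace ℝ (Fin n)) :
    ⟪G, spaceGrad φ z⟫ = ∑ i, G i * fderiv ℝ φ z (spaceDir i) := by
  rw [PiLp.inner_apply]
  refine Finset.sum_congr rfl fun i _ => ?_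
  rw [h.spaceGrad_eq]
  simp [mul_comm]

theorem integrableOn_smul_of_tsupport_subset {F : Type*} [NormedAddCommGroup F] [NormedSpace ℝ F]
    {A K : Set (SpaceTime n)} {w : SpaceTime n → F} {ψ : SpaceTime n → ℝ}
    (hw : LocallyIntegrableOn w A) (hψ : Continuous ψ) (hK : IsCompact K) (hKA : K ⊆ A)
    (h0 : ∀ z, z ∉ K → ψ z = 0) : Integrable (fun z => ψ z • w z) := by
  have h1 : IntegrableOn (fun z => ψ z • w z) K :=
    (hw.integrableOn_compact_subset hKA hK).continuousOn_smul hψ.continuousOn hK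
  refine (integrableOn_iff_integrable_of_support_subset fun z hz => ?_).1 h1
  by_contra hzK
  exact hz (by simp [h0 z hzK])

theorem IsTestFunction.integrable_mul {A : Set (SpaceTime n)} {φ w : SpaceTime n → ℝ}
    (h : IsTestFunction A φ) (hw : LocallyIntegrableOn w A) :
    Integrable (fun z => w z * φ z) := by
  have := integrableOn_smul_of_tsupport_subset hw h.continuous h.compactSupport.isCompact
    h.support_subset fun z hz => IsTestFunction.eq_zero hz
  simpa only [smul_eq_mul, mul_comm] using this

theorem IsTestFunction.integrable_mul_fderiv {A : Set (SpaceTime n)} {φ w : SpaceTime n → ℝ}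
    (h : IsTestFunction A φ) (hw : LocallyIntegrableOn w A) (d : SpaceTime n) :
    Integrable (fun z => w z * fderiv ℝ φ z d) := by
  have := integrableOn_smul_of_tsupport_subset hw (h.continuous_fderiv_apply d)
    h.compactSupport.isCompact h.support_subset fun z hz => h.fderiv_eq_zero hz d
  simpa only [smul_eq_mul, mul_comm] using this

theorem locallyIntegrableOn_coord {A : Set (SpaceTime n)}
    {G : SpaceTime n → EuclideanSpace ℝ (Fin n)} (hG : LocallyIntegrableOn G A) (i : Fin n) :
    LocallyIntegrableOn (fun z => G z i) A := fun z hz =>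
  let ⟨s, hs, h⟩ := hG z hz
  ⟨s, hs, (EuclideanSpace.proj (𝕜 := ℝ) i).integrable_comp h⟩

theorem HasWeakTimeDeriv.hasWeakDirDeriv {A : Set (SpaceTime n)} {w g : SpaceTime n → ℝ}
    (h : HasWeakTimeDeriv A w g) : HasWeakDirDeriv A w g (timeDir n) := fun φ hφ => by
  simpa only [hφ.timeDeriv_eq] using h.integral_eq φ hφ

theorem hasWeakTimeDeriv_of_dir {A : Set (SpaceTime n)} {w g : SpaceTime n → ℝ}
    (hw : LocallyIntegrableOn w A) (hg : LocallyIntegrableOn g A)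
    (h : HasWeakDirDeriv A w g (timeDir n)) : HasWeakTimeDeriv A w g :=
  ⟨hw, hg, fun φ hφ => by simpa only [hφ.timeDeriv_eq] using h φ hφ⟩

theorem IsTestFunction.integrable_smul_spaceGrad {A : Set (SpaceTime n)}
    {φ w : SpaceTime n → ℝ} (h : IsTestFunction A φ) (hw : LocallyIntegrableOn w A) :
    Integrable (fun z => w z • spaceGrad φ z) := by
  have hc : ∀ i, Integrable (fun z => (w z • spaceGrad φ z) i) := fun i => by
    simpa only [PiLp.smul_apply, smul_eq_mul, h.spaceGrad_eq] using
      h.integrable_mul_fderiv hw (spaceDir i)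
  have hsum : Integrable fun z => ∑ i, (w z • spaceGrad φ z) i • EuclideanSpace.single i (1 : ℝ) :=
    integrable_finsetSum _ fun i _ => (hc i).smul_const _
  refine hsum.congr (Eventually.of_forall fun z => ?_)
  have := (EuclideanSpace.basisFun (Fin n) ℝ).sum_repr (w z • spaceGrad φ z)
  simpa using this

theorem HasWeakSpaceGrad.hasWeakDirDeriv {A : Set (SpaceTime n)} {w : SpaceTime n → ℝ}
    {G : SpaceTime n → EuclideanSpace ℝ (Fin n)} (h : HasWeakSpaceGrad A w G) (i : Fin n) :
    HasWeakDirDeriv A w (fun z => G z i) (spaceDir i) := fun φ hφ => by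
  have h1 := congrArg (EuclideanSpace.proj (𝕜 := ℝ) i) (h.integral_eq φ hφ)
  rw [map_neg, ← ContinuousLinearMap.integral_comp_comm _
      (hφ.integrable_smul_spaceGrad h.locallyIntegrable).integrableOn,
    ← ContinuousLinearMap.integral_comp_comm _
      (integrableOn_smul_of_tsupport_subset h.locallyIntegrable_grad hφ.continuous
        hφ.compactSupport.isCompact hφ.support_subset
        fun z hz => IsTestFunction.eq_zero hz).integrableOn] at h1
  simpa [hφ.spaceGrad_eq, mul_comm] using h1

theorem hasWeakSpaceGrad_of_dir {A : Set (SpaceTime n)} {w : SpaceTime n → ℝ}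
    {G : SpaceTime n → EuclideanSpace ℝ (Fin n)} (hw : LocallyIntegrableOn w A)
    (hG : LocallyIntegrableOn G A)
    (h : ∀ i, HasWeakDirDeriv A w (fun z => G z i) (spaceDir i)) : HasWeakSpaceGrad A w G := by
  refine ⟨hw, hG, fun φ hφ => ?_⟩
  ext i
  have h1 := h i φ hφ
  change EuclideanSpace.proj (𝕜 := ℝ) i (∫ z in A, w z • spaceGrad φ z) =
    EuclideanSpace.proj (𝕜 := ℝ) i (- ∫ z in A, φ z • G z)
  rw [map_neg, ← ContinuousLinearMap.integral_comp_comm _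
      (hφ.integrable_smul_spaceGrad hw).integrableOn,
    ← ContinuousLinearMap.integral_comp_comm _
      (integrableOn_smul_of_tsupport_subset hG hφ.continuous
        hφ.compactSupport.isCompact hφ.support_subset
        fun z hz => IsTestFunction.eq_zero hz).integrableOn]
  simpa [hφ.spaceGrad_eq, mul_comm] using h1

/-- `MemU` and `WeakDiffusionGE` each provide a gradient of their own; uniqueness transfers the L²
bounds from one to the other. -/
theorem HasWeakSpaceGrad.ae_eq {A : Set (SpaceTime n)} (hA : IsOpen A) {w : SpaceTime n → ℝ}
    {G G' : SpaceTime n → EuclideanSpace ℝ (Fin n)} (h : HasWeakSpaceGrad A w G)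
    (h' : HasWeakSpaceGrad A w G') : G =ᵐ[volume.restrict A] G' := by
  have h0 := hA.ae_eq_zero_of_integral_contDiff_smul_eq_zero (μ := volume)
    (h.locallyIntegrable_grad.sub h'.locallyIntegrable_grad) fun φ hs hc hsub => by
    have hφ : IsTestFunction A φ := ⟨hs, hc, hsub⟩
    have hi : ∀ {H : SpaceTime n → EuclideanSpace ℝ (Fin n)}, LocallyIntegrableOn H A →
        Integrable (fun z => φ z • H z) := fun hH =>
      integrableOn_smul_of_tsupport_subset hH hφ.continuous
        hφ.compactSupport.isCompact hφ.support_subset fun z hz => IsTestFunction.eq_zero hz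
    have e : ∫ z in A, φ z • G z = ∫ z in A, φ z • G' z := by
      rw [← neg_inj, ← h.integral_eq φ hφ, h'.integral_eq φ hφ]
    have hz : ∀ {H : SpaceTime n → EuclideanSpace ℝ (Fin n)},
        ∫ z in A, φ z • H z = ∫ z, φ z • H z := fun {H} =>
      setIntegral_eq_integral_of_forall_compl_eq_zero fun z hz => by
        rw [IsTestFunction.eq_zero fun h => hz (hsub h), zero_smul]
    simp only [Pi.sub_apply, smul_sub]
    rw [integral_sub (hi h.locallyIntegrable_grad) (hi h'.locallyIntegrable_grad), ← hz, ← hz, e,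
      sub_self]
  rw [EventuallyEq, ae_restrict_iff' hA.measurableSet]
  filter_upwards [h0] with z hz hzA
  exact sub_eq_zero.1 (hz hzA)

theorem locallyIntegrableOn_of_memLp_top {A : Set (SpaceTime n)} {w : SpaceTime n → ℝ}
    (hw : MemLp w ⊤ (volume.restrict A)) : LocallyIntegrableOn w A :=
  locallyIntegrableOn_of_locallyIntegrable_restrict (hw.locallyIntegrable le_top)

/-- Bounded weak supersolutions of `∂_t u ≥ Δu - f` in `A` with weak derivatives `∂_t u = g` and
`∇u = G` square integrable away from the initial time. -/
structure IsRegularSupersolution (A : Set (SpaceTime n)) (u g : SpaceTime n → ℝ)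
    (G : SpaceTime n → EuclideanSpace ℝ (Fin n)) (f : SpaceTime n → ℝ) : Prop where
  bounded : MemLp u ⊤ (volume.restrict A)
  bounded_source : MemLp f ⊤ (volume.restrict A)
  memLp_time : ∀ τ > 0, MemLp g 2 (volume.restrict (lateTimes A τ))
  memLp_space : ∀ τ > 0, MemLp G 2 (volume.restrict (lateTimes A τ))
  time : HasWeakDirDeriv A u g (timeDir n)
  space : ∀ i, HasWeakDirDeriv A u (fun z => G z i) (spaceDir i)
  super : ∀ φ, IsTestFunction A φ → (∀ z, 0 ≤ φ z) →
    0 ≤ ∫ z in A, (∑ i, G z i * fderiv ℝ φ z (spaceDir i)) + (g z + f z) * φ z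

/-- Moving the time derivative from the test function back to u gives the form needed for cutoffs
that depend on the solution. -/
theorem IsSupersolutionPair.exists_isRegularSupersolution {k m₃ m₄ : ℝ} {A : Set (SpaceTime n)}
    (hA : IsOpen A) {u v : SpaceTime n → ℝ} (h : IsSupersolutionPair k m₃ m₄ A u v) :
    ∃ g G, IsRegularSupersolution A u g G (fun z => k * u z * v z) := by
  obtain ⟨g, hg, hgL⟩ := h.memU.time
  obtain ⟨G', hG', hGL'⟩ := h.memU.space
  obtain ⟨G, hG, hsup⟩ := h.diffusion
  have hGe := hG'.ae_eq hA hG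
  have hf : MemLp (fun z => k * u z * v z) ⊤ (volume.restrict A) :=
    MemLp.mul (p := ⊤) (q := ⊤) h.memV.bounded (h.memU.bounded.const_mul k)
  refine ⟨g, G, h.memU.bounded, hf, hgL, fun τ hτ => (hGL' τ hτ).ae_eq ?_, hg.hasWeakDirDeriv,
    hG.hasWeakDirDeriv, fun φ hφ h0 => ?_⟩
  · exact ae_mono (Measure.restrict_mono (fun z hz => hz.1) le_rfl) hGe
  · have h1 := hsup φ hφ h0
    have hd := hg.hasWeakDirDeriv φ hφ
    simp only [hφ.timeDeriv_eq, hφ.inner_spaceGrad] at h1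
    have i1 : Integrable (fun z => u z * fderiv ℝ φ z (timeDir n)) (volume.restrict A) :=
      (hφ.integrable_mul_fderiv hg.locallyIntegrable _).integrableOn
    have i1' : Integrable (fun z => -(u z * fderiv ℝ φ z (timeDir n))) (volume.restrict A) :=
      i1.neg
    have i2 : Integrable (fun z => ∑ i, G z i * fderiv ℝ φ z (spaceDir i)) (volume.restrict A) :=
      integrable_finsetSum _ fun i _ => (hφ.integrable_mul_fderiv
        (locallyIntegrableOn_coord hG.locallyIntegrable_grad i) _).integrableOn
    have i3 : Integrable (fun z => k * u z * v z * φ z) (volume.restrict A) :=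
      (hφ.integrable_mul (locallyIntegrableOn_of_memLp_top hf)).integrableOn
    have i4 : Integrable (fun z => g z * φ z) (volume.restrict A) :=
      (hφ.integrable_mul hg.locallyIntegrable_deriv).integrableOn
    simp only [neg_mul, add_mul] at h1 ⊢
    rw [integral_add (by exact i1'.add i2) i3, integral_add i1' i2, integral_neg, hd,
      neg_neg] at h1
    rw [integral_add i2 (by exact i4.add i3), integral_add i4 i3]
    linarith

theorem IsRegularSupersolution.isLocalSupersolution {A V : Set (SpaceTime n)}
    {u g f : SpaceTime n → ℝ} {G : SpaceTime n → EuclideanSpace ℝ (Fin n)}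
    (h : IsRegularSupersolution A u g G f) (hA : MeasurableSet A) {τ : ℝ} (hτ : 0 < τ)
    (hV : V ⊆ lateTimes A τ) (hfin : volume V ≠ ⊤) : IsLocalSupersolution V u g G f := by
  have : IsFiniteMeasure (volume.restrict V) := isFiniteMeasure_restrict.2 hfin
  have hVA : V ⊆ A := fun z hz => (hV hz).1
  have hle : volume.restrict V ≤ volume.restrict A := Measure.restrict_mono hVA le_rfl
  have hle' : volume.restrict V ≤ volume.restrict (lateTimes A τ) := Measure.restrict_mono hV le_rfl
  have key : ∀ {w w' : SpaceTime n → ℝ} {d}, HasWeakDirDeriv A w w' d →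
      HasWeakDirDeriv V w w' d := by
    intro w w' d hw φ hφ
    have h1 := hw φ (hφ.mono hVA)
    rwa [setIntegral_mul_eq_of_tsupport_subset hVA hA
        (fun z hz => hφ.fderiv_eq_zero (fun h => hz (hφ.support_subset h)) d),
      setIntegral_mul_eq_of_tsupport_subset hVA hA
        (fun z hz => IsTestFunction.eq_zero fun h => hz (hφ.support_subset h))] at h1
  refine ⟨(h.bounded.mono_measure hle).mono_exponent le_top, (h.memLp_time τ hτ).mono_measure hle',
    (h.memLp_space τ hτ).mono_measure hle',
    (h.bounded_source.mono_measure hle).mono_exponent le_top, key h.time,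
    fun i => key (h.space i), fun φ hφ h0 => ?_⟩
  have h1 := h.super φ (hφ.mono hVA) h0
  rwa [setIntegral_eq_of_subset_of_forall_sdiff_eq_zero hA hVA] at h1
  intro z hz
  have hzφ : z ∉ tsupport φ := fun h => hz.2 (hφ.support_subset h)
  simp [hφ.fderiv_eq_zero hzφ, IsTestFunction.eq_zero hzφ]

theorem exists_isLeast_argmin {N : ℕ} {J : Finset (Fin N)} (hJ : J.Nonempty) (c : Fin N → ℝ) :
    ∃ i, IsLeast {i | i ∈ J ∧ ∀ j ∈ J, c i ≤ c j} i := by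
  classical
  obtain ⟨i, hi, hmin⟩ := Finset.exists_min_image J c hJ
  have hne : (J.filter fun i => ∀ j ∈ J, c i ≤ c j).Nonempty :=
    ⟨i, Finset.mem_filter.2 ⟨hi, hmin⟩⟩
  exact ⟨_, by simpa using Finset.isLeast_min' _ hne⟩

/-- The minimum of finitely many supersolutions, ties being resolved by the least index. -/
theorem IsLocalSupersolution.argmin {N : ℕ} {U : Set (SpaceTime n)} (hU : IsOpen U)
    (hfin : volume U ≠ ⊤) {u g f : Fin N → SpaceTime n → ℝ}
    {G : Fin N → SpaceTime n → EuclideanSpace ℝ (Fin n)} {J : Finset (Fin N)} (hJ : J.Nonempty)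
    (h : ∀ j ∈ J, IsLocalSupersolution U (u j) (g j) (G j) (f j)) {l : SpaceTime n → Fin N}
    (hl : ∀ z ∈ U, IsLeast {i | i ∈ J ∧ ∀ j ∈ J, u i z ≤ u j z} (l z)) :
    IsLocalSupersolution U (fun z => u (l z) z) (fun z => g (l z) z) (fun z => G (l z) z)
      (fun z => f (l z) z) := by
  classical
  induction J using Finset.induction_on_max generalizing l with
  | empty => exact absurd hJ Finset.not_nonempty_empty
  | insert a s has ih =>
    rcases s.eq_empty_or_nonempty with rfl | hs
    · have hla : ∀ z ∈ U, l z = a := fun z hz => by simpa using (hl z hz).1.1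
      have hae : ∀ᵐ z ∂volume.restrict U, l z = a :=
        (ae_restrict_mem hU.measurableSet).mono hla
      refine (h a (by simp)).congr ?_ ?_ ?_ ?_ <;>
      · filter_upwards [hae] with z hz
        rw [hz]
    · choose l' hl' using fun z => exists_isLeast_argmin hs fun i => u i z
      have h' := ih hs (fun j hj => h j (Finset.mem_insert_of_mem hj)) (l := l') fun z _ => hl' z
      -- The new index `a` exceeds all of `s`, so a tie must keep the old index; this is the tie
      -- rule of `ite_le`.
      have key : ∀ z ∈ U, l z = if u (l' z) z ≤ u a z then l' z else a := by
        intro z hz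
        refine (hl z hz).unique ?_
        have h1 := hl' z
        split_ifs with hle
        · refine ⟨⟨Finset.mem_insert_of_mem h1.1.1, fun j hj => ?_⟩, fun j hj => ?_⟩
          · rcases Finset.mem_insert.1 hj with rfl | hj
            · exact hle
            · exact h1.1.2 j hj
          · rcases Finset.mem_insert.1 hj.1 with rfl | hj'
            · exact (has _ h1.1.1).le
            · exact h1.2 ⟨hj', fun i hi => hj.2 i (Finset.mem_insert_of_mem hi)⟩
        · push Not at hle
          refine ⟨⟨Finset.mem_insert_self _ _, fun j hj => ?_⟩, fun j hj => ?_⟩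
          · rcases Finset.mem_insert.1 hj with rfl | hj
            · exact le_rfl
            · exact hle.le.trans (h1.1.2 j hj)
          · rcases Finset.mem_insert.1 hj.1 with rfl | hj'
            · exact le_rfl
            · have := h1.1.2 j hj'
              have := hj.2 a (Finset.mem_insert_self _ _)
              linarith
      refine (h'.ite_le hU hfin (h a (Finset.mem_insert_self _ _))).congr ?_ ?_ ?_ ?_ <;>
      · filter_upwards [ae_restrict_mem hU.measurableSet] with z hz
        rw [key z hz]
        split_ifs <;> rfl

theorem eq_sum_spaceDir_add_timeDir (d : SpaceTime n) :
    d = ∑ i, d.1 i • spaceDir i + d.2 • timeDir n := by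
  refine Prod.ext ?_ ?_
  · have := (EuclideanSpace.basisFun (Fin n) ℝ).sum_repr d.1
    simp only [EuclideanSpace.basisFun_repr, EuclideanSpace.basisFun_apply] at this
    simp [Prod.fst_sum, spaceDir, timeDir, this]
  · simp [Prod.snd_sum, spaceDir, timeDir]

/-- A function with vanishing weak derivatives on a ball is a.e. constant on the half ball. -/
theorem exists_ae_eq_const_of_hasWeakDirDeriv_zero {z : SpaceTime n} {r : ℝ} (hr : 0 < r)
    {w : SpaceTime n → ℝ} (hw : IntegrableOn w (Metric.ball z r))
    (ht : HasWeakDirDeriv (Metric.ball z r) w 0 (timeDir n))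
    (hx : ∀ i, HasWeakDirDeriv (Metric.ball z r) w 0 (spaceDir i)) :
    ∃ c, ∀ᵐ y ∂volume.restrict (Metric.ball z (r / 2)), w y = c := by
  have hBm : MeasurableSet (Metric.ball z r) := measurableSet_ball
  set s := fun k => mollify volume k ((Metric.ball z r).indicator w) with hs
  have hsd : ∀ k, ContDiff ℝ ∞ (s k) := fun k =>
    contDiff_mollify (hw.integrable_indicator hBm).locallyIntegrable k
  have hconst : ∀ᶠ k in atTop, ∀ y ∈ Metric.ball z (r / 2), s k y = s k z := by
    filter_upwards [(tendsto_shrinkingBump_rOut (X := SpaceTime n)).eventually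
      (gt_mem_nhds (half_pos hr))] with k hk y hy
    have hsub : ∀ y ∈ Metric.ball z (r / 2),
        Metric.closedBall y (shrinkingBump (SpaceTime n) k).rOut ⊆ Metric.ball z r := by
      intro y hy x hx
      rw [Metric.mem_ball] at hy ⊢
      rw [Metric.mem_closedBall] at hx
      linarith [dist_triangle x y z]
    have hzero : EqOn (fderiv ℝ (s k)) 0 (Metric.ball z (r / 2)) := by
      intro y hy
      refine ContinuousLinearMap.ext fun d => ?_
      have hm0 : mollify volume k ((Metric.ball z r).indicator 0) y = 0 := by
        rw [mollify_indicator hBm]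
        simp
      have hx0 : ∀ i, fderiv ℝ (s k) y (spaceDir i) = 0 := fun i =>
        ((hx i).fderiv_mollify hBm hw (hsub y hy)).trans hm0
      have ht0 : fderiv ℝ (s k) y (timeDir n) = 0 :=
        (ht.fderiv_mollify hBm hw (hsub y hy)).trans hm0
      rw [eq_sum_spaceDir_add_timeDir d, map_add, map_sum, map_smul, ht0]
      simp [hx0]
    exact Metric.isOpen_ball.is_const_of_fderiv_eq_zero
      (convex_ball z (r / 2)).isPreconnected
      ((hsd k).differentiable (by simp)).differentiableOn hzero hy
      (Metric.mem_ball_self (half_pos hr))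
  -- The mollifications are eventually constant on the half ball. One and the same sequence of
  -- numbers thus converges to `w y` for a.e. y, and its limit is unique.
  have hlim : ∀ᵐ y ∂volume.restrict (Metric.ball z (r / 2)),
      Tendsto (fun k => s k z) atTop (𝓝 (w y)) := by
    have h1 := ae_mono (Measure.restrict_mono
      (Metric.ball_subset_ball (half_le_self hr.le)) le_rfl) (ae_restrict_tendsto_mollify hBm hw)
    filter_upwards [h1, ae_restrict_mem measurableSet_ball] with y hy hyB
    refine hy.congr' ?_
    filter_upwards [hconst] with k hk using hk y hyB
  have : (ae (volume.restrict (Metric.ball z (r / 2)))).NeBot := by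
    rw [ae_neBot, Ne, Measure.restrict_eq_zero]
    exact (Metric.measure_ball_pos _ _ (half_pos hr)).ne'
  obtain ⟨y, hy⟩ := hlim.exists
  refine ⟨w y, ?_⟩
  filter_upwards [hlim] with x hx using tendsto_nhds_unique hx hy

/-- A function with square integrable weak derivatives cannot jump over an interval of values. -/
theorem IsLocalSupersolution.le_or_ge_of_gap {z : SpaceTime n} {r : ℝ} (hr : 0 < r)
    {u g f : SpaceTime n → ℝ} {G : SpaceTime n → EuclideanSpace ℝ (Fin n)}
    (h : IsLocalSupersolution (Metric.ball z r) u g G f) {a b : ℝ} (hab : a < b)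
    (hgap : ∀ y ∈ Metric.ball z r, u y ≤ a ∨ b ≤ u y) :
    (∀ᵐ y ∂volume.restrict (Metric.ball z (r / 2)), u y ≤ a) ∨
      ∀ᵐ y ∂volume.restrict (Metric.ball z (r / 2)), b ≤ u y := by
  have hfin : volume (Metric.ball z r) ≠ ⊤ := Metric.isBounded_ball.measure_lt_top.ne
  have : IsFiniteMeasure (volume.restrict (Metric.ball z r)) := isFiniteMeasure_restrict.2 hfin
  set c := 1 / (b - a) with hcdef
  have hc : 0 < c := one_div_pos.2 (sub_pos.2 hab)
  -- F equals 1 up to `a` and 0 from `b` on, so all its variation lies in the omitted interval.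
  set F := fun x => stepDown c (x - a) with hF
  have hFd : ContDiff ℝ 1 F :=
    ((contDiff_stepDown c).of_le (by simp)).comp (contDiff_id.sub contDiff_const)
  obtain ⟨C, hC⟩ := exists_bound_deriv_stepDown hc
  have hFC : ∀ x, |deriv F x| ≤ C := fun x => by
    rw [hF, deriv_comp_sub_const]
    exact hC _
  have hF1 : ∀ x, x ≤ a → F x = 1 := fun x hx => stepDown_of_nonpos hc (sub_nonpos.2 hx)
  have hF0 : ∀ x, b ≤ x → F x = 0 := fun x hx => stepDown_of_le <| by
    rw [hcdef, one_div, inv_mul_eq_div, le_div_iff₀ (sub_pos.2 hab)]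
    linarith
  -- Since F has range in [0, 1], these points are extrema, so the derivative also vanishes at `a`
  -- and `b` themselves. Hence `F ∘ u` has zero weak derivatives.
  have hdF : ∀ x, x ≤ a ∨ b ≤ x → deriv F x = 0 := by
    rintro x (hx | hx)
    · refine IsLocalMax.deriv_eq_zero (Eventually.of_forall fun y => ?_)
      rw [hF1 x hx]
      exact stepDown_le_one _ _
    · refine IsLocalMin.deriv_eq_zero (Eventually.of_forall fun y => ?_)
      rw [hF0 x hx]
      exact stepDown_nonneg _ _
  have hweak : ∀ {d w'}, HasWeakDirDeriv (Metric.ball z r) u w' d →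
      MemLp w' 2 (volume.restrict (Metric.ball z r)) →
      HasWeakDirDeriv (Metric.ball z r) (fun y => F (u y)) 0 d := by
    intro d w' hw hm φ hφ
    rw [hw.comp Metric.isOpen_ball hfin h.memLp hm hFd hFC φ hφ]
    congr 1
    refine setIntegral_congr_fun measurableSet_ball fun y hy => ?_
    simp [hdF _ (hgap y hy)]
  have hint : IntegrableOn (fun y => F (u y)) (Metric.ball z r) := by
    refine Integrable.of_bound (hFd.continuous.comp_aestronglyMeasurable h.memLp.1) 1
      (Eventually.of_forall fun y => ?_)
    rw [Real.norm_of_nonneg (stepDown_nonneg _ _)]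
    exact stepDown_le_one _ _
  obtain ⟨m, hm⟩ := exists_ae_eq_const_of_hasWeakDirDeriv_zero hr hint
    (hweak h.time h.memLp_time) fun i => hweak (h.space i) (memLp_coord h.memLp_space i)
  have hmem : ∀ᵐ y ∂volume.restrict (Metric.ball z (r / 2)), u y ≤ a ∨ b ≤ u y :=
    (ae_restrict_mem measurableSet_ball).mono fun y hy =>
      hgap y (Metric.ball_subset_ball (half_le_self hr.le) hy)
  by_cases hm1 : m = 1
  · left
    filter_upwards [hm, hmem] with y hy hy'
    rcases hy' with hy' | hy'
    · exact hy'
    · rw [hF0 _ hy', hm1] at hy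
      exact absurd hy zero_ne_one
  · right
    filter_upwards [hm, hmem] with y hy hy'
    rcases hy' with hy' | hy'
    · exact absurd (hy.symm.trans (hF1 _ hy')) hm1
    · exact hy'

end Localization

/-! ### Local analysis of the patched function and gluing -/

section Patching

variable {n N : ℕ} [NeZero N]

/-- Near a boundary point a single index is selected almost everywhere; near any other point the
minimum runs over a fixed index set. Balls are kept at times above `z.2 / 2`, where the derivatives
are square integrable. -/
theorem exists_isLocalSupersolution_patch {A : Fin N → Set (SpaceTime n)}
    (hA : ∀ i, IsOpen (A i)) (hpos : ∀ i, ∀ z ∈ A i, 0 < z.2) {u g f : Fin N → SpaceTime n → ℝ}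
    {G : Fin N → SpaceTime n → EuclideanSpace ℝ (Fin n)}
    (h : ∀ i, IsRegularSupersolution (A i) (u i) (g i) (G i) (f i))
    (hrep : ∀ i, ∀ z ∈ A i ∩ ⋃ j, frontier (A j), EssLiminfLE (u i) z)
    (hcont : ContinuousOn (patch A u u) (⋃ i, A i))
    (hδ : ∀ z ∈ (⋃ i, A i) ∩ ⋃ i, frontier (A i), ∃ δ > 0, ∃ B' : Set (SpaceTime n), IsOpen B' ∧
      B' ⊆ ⋃ i, A i ∧ z ∈ B' ∧ ∀ y ∈ B', ∀ i, y ∈ A i → i ≠ minIndex A u y →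
        patch A u u y + δ < u i y)
    {z : SpaceTime n} (hz : z ∈ ⋃ i, A i) :
    ∃ V, IsOpen V ∧ z ∈ V ∧ V ⊆ ⋃ i, A i ∧ IsLocalSupersolution V (patch A u u) (patch A u g)
      (fun y => G (minIndex A u y) y) (patch A u f) := by
  classical
  have hzpos : 0 < z.2 := by
    obtain ⟨i, hi⟩ := mem_iUnion.1 hz
    exact hpos i z hi
  have hAo : IsOpen (⋃ i, A i) := isOpen_iUnion hA
  have hlate : ∀ᶠ y in 𝓝 z, z.2 / 2 < y.2 :=
    continuous_snd.continuousAt.eventually (lt_mem_nhds (half_lt_self hzpos))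
  have hfin : ∀ r, volume (Metric.ball z r) ≠ ⊤ := fun r =>
    Metric.isBounded_ball.measure_lt_top.ne
  by_cases hzf : z ∈ ⋃ j, frontier (A j)
  · obtain ⟨δ, hδ0, B', hB'o, hB'A, hzB', hgap⟩ := hδ z ⟨hz, hzf⟩
    set i := minIndex A u z with hi
    have hleast := minIndex_isLeast A u hz
    have hzi : z ∈ A i := hleast.1.1
    have hc : ∀ᶠ y in 𝓝 z, |patch A u u y - patch A u u z| < δ / 4 := by
      have := (hcont.continuousAt (hAo.mem_nhds hz)).eventually
        (Metric.ball_mem_nhds _ (by positivity : 0 < δ / 4))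
      exact this
    obtain ⟨r, hr, hball⟩ := Metric.eventually_nhds_iff_ball.1
      (((hlate.and hc).and ((hA i).mem_nhds hzi)).and (hB'o.mem_nhds hzB'))
    have hloc := (h i).isLocalSupersolution (hA i).measurableSet (half_pos hzpos)
      (V := Metric.ball z r) (fun y hy => ⟨(hball y hy).1.2, (hball y hy).1.1.1.le⟩) (hfin r)
    -- Where i is selected, `u i = u` is within δ/4 of its value at z. Elsewhere `u i` exceeds u by
    -- more than δ, and u loses at most δ/4.
    have hval : ∀ y ∈ Metric.ball z r, (minIndex A u y = i ∧ u i y ≤ u i z + δ / 4) ∨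
        u i z + 3 * δ / 4 ≤ u i y := by
      intro y hy
      have hcy := abs_lt.1 (hball y hy).1.1.2
      have hpz : patch A u u z = u i z := rfl
      by_cases hyi : minIndex A u y = i
      · left
        have hpy : patch A u u y = u i y := by rw [patch, hyi]
        exact ⟨hyi, by linarith⟩
      · right
        have := hgap y (hball y hy).2 i (hball y hy).1.2 (Ne.symm hyi)
        linarith
    have hsub : Metric.ball z (r / 2) ⊆ Metric.ball z r :=
      Metric.ball_subset_ball (half_le_self hr.le)
    rcases hloc.le_or_ge_of_gap hr (a := u i z + δ / 4) (b := u i z + 3 * δ / 4) (by linarith)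
      (fun y hy => (hval y hy).imp_left And.right) with hle | hge
    · refine ⟨Metric.ball z (r / 2), Metric.isOpen_ball, Metric.mem_ball_self (half_pos hr),
        fun y hy => hB'A (hball y (hsub hy)).2, ?_⟩
      have hae : ∀ᵐ y ∂volume.restrict (Metric.ball z (r / 2)), minIndex A u y = i := by
        filter_upwards [hle, ae_restrict_mem measurableSet_ball] with y hy hyB
        rcases hval y (hsub hyB) with hv | hv
        · exact hv.1
        · linarith
      refine (hloc.mono measurableSet_ball hsub).congr ?_ ?_ ?_ ?_ <;>
      · filter_upwards [hae] with y hy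
        simp only [patch, hy]
    -- The upper alternative would put the essential lower limit of `u i` at z at least 3δ/4 above
    -- `u i z`.
    · exfalso
      have := hrep i z ⟨hzi, hzf⟩ (u i z + 3 * δ / 4) (by
        rw [ae_restrict_iff' measurableSet_ball] at hge
        have hb : ∀ᶠ y in 𝓝 z ⊓ ae volume, y ∈ Metric.ball z (r / 2) :=
          mem_inf_of_left (Metric.ball_mem_nhds z (half_pos hr))
        have hge' : ∀ᶠ y in 𝓝 z ⊓ ae volume, y ∈ Metric.ball z (r / 2) →
          u i z + 3 * δ / 4 ≤ u i y := mem_inf_of_right hge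
        filter_upwards [hb, hge'] with y h1 h2 using h2 h1)
      linarith
  -- Off all frontiers, z is interior either to `A j` or to its complement, so J is the set of
  -- available indices in a whole neighbourhood.
  · set J := Finset.univ.filter fun j => z ∈ A j with hJ
    have hmem : ∀ᶠ y in 𝓝 z, ∀ j, y ∈ A j ↔ j ∈ J := by
      refine eventually_all.2 fun j => ?_
      by_cases hj : z ∈ A j
      · filter_upwards [(hA j).mem_nhds hj] with y hy
        simp [hJ, hj, hy]
      · have hcl : z ∉ closure (A j) := fun hcl => hzf <| mem_iUnion.2
          ⟨j, by rw [(hA j).frontier_eq]; exact ⟨hcl, hj⟩⟩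
        filter_upwards [isClosed_closure.isOpen_compl.mem_nhds hcl] with y hy
        have : y ∉ A j := fun hyj => hy (subset_closure hyj)
        simp [hJ, hj, this]
    obtain ⟨r, hr, hball⟩ := Metric.eventually_nhds_iff_ball.1 (hlate.and hmem)
    have hJne : J.Nonempty := by
      obtain ⟨i, hi⟩ := mem_iUnion.1 hz
      exact ⟨i, by simp [hJ, hi]⟩
    obtain ⟨j₀, hj₀⟩ := hJne
    have hBA : Metric.ball z r ⊆ ⋃ i, A i := fun y hy =>
      mem_iUnion.2 ⟨j₀, ((hball y hy).2 j₀).2 hj₀⟩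
    refine ⟨Metric.ball z r, Metric.isOpen_ball, Metric.mem_ball_self hr, hBA, ?_⟩
    refine IsLocalSupersolution.argmin Metric.isOpen_ball (hfin r) ⟨j₀, hj₀⟩ (fun j hj =>
      (h j).isLocalSupersolution (hA j).measurableSet (half_pos hzpos)
        (fun y hy => ⟨((hball y hy).2 j).2 hj, (hball y hy).1.le⟩) (hfin r)) fun y hy => ?_
    have hset : {i | i ∈ J ∧ ∀ j ∈ J, u i y ≤ u j y} = argminSet A u y := by
      ext i
      simp only [argminSet, (hball y hy).2]
    rw [hset]
    exact minIndex_isLeast A u (hBA hy)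

/-- Test functions on a union of open sets are finite sums of test functions on the members. -/
theorem IsTestFunction.exists_decomposition {A : Set (SpaceTime n)} {φ : SpaceTime n → ℝ}
    (h : IsTestFunction A φ) {P : Set (SpaceTime n) → Prop}
    (hP : ∀ z ∈ A, ∃ V, IsOpen V ∧ z ∈ V ∧ P V) :
    ∃ (ι : Type) (s : Finset ι) (ψ : ι → SpaceTime n → ℝ),
      (∀ j, ∃ V, P V ∧ IsTestFunction V (ψ j)) ∧ φ = (fun z => ∑ j ∈ s, ψ j z) ∧
      ((∀ z, 0 ≤ φ z) → ∀ j z, 0 ≤ ψ j z) := by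
  choose! V hVo hVz hVP using hP
  obtain ⟨ρ, hρ⟩ := SmoothPartitionOfUnity.exists_isSubordinate
    (modelWithCornersSelf ℝ (SpaceTime n)) (isClosed_tsupport φ)
    (fun j : tsupport φ => V j) (fun j => hVo _ (h.support_subset j.2))
    (fun z hz => mem_iUnion.2 ⟨⟨z, hz⟩, hVz z (h.support_subset hz)⟩)
  -- Local finiteness leaves only finitely many members that meet the compact support of φ.
  have hfinite := ρ.locallyFinite.finite_nonempty_inter_compact h.compactSupport.isCompact
  refine ⟨tsupport φ, hfinite.toFinset, fun j z => ρ j z * φ z, fun j => ⟨V j, hVP _ (h.support_subset j.2), ?_⟩,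
    ?_, fun h0 j z => mul_nonneg (ρ.nonneg j z) (h0 z)⟩
  · exact ⟨(ρ j).contMDiff.contDiff.mul h.smooth, h.compactSupport.mul_left,
      tsupport_mul_subset_left.trans (hρ j)⟩
  · funext z
    rw [← Finset.sum_mul]
    by_cases hz : z ∈ tsupport φ
    · have h1 := ρ.sum_eq_one hz
      rw [finsum_eq_sum_of_support_subset] at h1
      · rw [h1, one_mul]
      · intro j hj
        rw [Finite.coe_toFinset]
        exact ⟨z, hj, hz⟩
    · rw [IsTestFunction.eq_zero hz, mul_zero]

theorem HasWeakDirDeriv.of_local {A : Set (SpaceTime n)} {w g : SpaceTime n → ℝ} {d : SpaceTime n}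
    (hA : MeasurableSet A) (hw : LocallyIntegrableOn w A) (hg : LocallyIntegrableOn g A)
    (hloc : ∀ z ∈ A, ∃ V, IsOpen V ∧ z ∈ V ∧ V ⊆ A ∧ HasWeakDirDeriv V w g d) :
    HasWeakDirDeriv A w g d := by
  intro φ hφ
  obtain ⟨ι, s, ψ, hψ, hsum, -⟩ := hφ.exists_decomposition
    (P := fun V => V ⊆ A ∧ HasWeakDirDeriv V w g d) hloc
  choose V hV hψV using hψ
  have hψA : ∀ j, IsTestFunction A (ψ j) := fun j => (hψV j).mono (hV j).1
  have hd : ∀ z, fderiv ℝ φ z d = ∑ j ∈ s, fderiv ℝ (ψ j) z d := by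
    intro z
    rw [hsum, fderiv_fun_sum fun j _ => (hψA j).differentiable z, _root_.sum_apply]
  have hv : ∀ z, φ z = ∑ j ∈ s, ψ j z := fun z => congrFun hsum z
  simp only [hd]
  rw [show (∫ z in A, g z * φ z) = ∫ z in A, g z * ∑ j ∈ s, ψ j z by simp only [← hv]]
  simp only [Finset.mul_sum]
  rw [integral_finsetSum _ fun j _ => ((hψA j).integrable_mul_fderiv hw d).integrableOn,
    integral_finsetSum _ fun j _ => ((hψA j).integrable_mul hg).integrableOn,
    ← Finset.sum_neg_distrib]
  refine Finset.sum_congr rfl fun j _ => ?_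
  rw [setIntegral_mul_eq_of_tsupport_subset (hV j).1 hA
      (fun z hz => (hψV j).fderiv_eq_zero (fun h => hz ((hψV j).support_subset h)) d),
    setIntegral_mul_eq_of_tsupport_subset (hV j).1 hA
      (fun z hz => IsTestFunction.eq_zero fun h => hz ((hψV j).support_subset h))]
  exact (hV j).2 _ (hψV j)

/-- The integral is linear in the test function, and the pieces of a nonnegative φ are nonnegative.
-/
theorem integral_super_nonneg_of_local {A : Set (SpaceTime n)} {u g f : SpaceTime n → ℝ}
    {G : SpaceTime n → EuclideanSpace ℝ (Fin n)} (hA : MeasurableSet A)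
    (hG : LocallyIntegrableOn G A) (hg : LocallyIntegrableOn g A) (hf : LocallyIntegrableOn f A)
    (hloc : ∀ z ∈ A, ∃ V, IsOpen V ∧ z ∈ V ∧ V ⊆ A ∧ IsLocalSupersolution V u g G f)
    {φ : SpaceTime n → ℝ} (hφ : IsTestFunction A φ) (h0 : ∀ z, 0 ≤ φ z) :
    0 ≤ ∫ z in A, (∑ i, G z i * fderiv ℝ φ z (spaceDir i)) + (g z + f z) * φ z := by
  obtain ⟨ι, s, ψ, hψ, hsum, hpos⟩ := hφ.exists_decomposition
    (P := fun V => V ⊆ A ∧ IsLocalSupersolution V u g G f) hloc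
  choose V hV hψV using hψ
  have hψA : ∀ j, IsTestFunction A (ψ j) := fun j => (hψV j).mono (hV j).1
  have hd : ∀ z d, fderiv ℝ φ z d = ∑ j ∈ s, fderiv ℝ (ψ j) z d := by
    intro z d
    rw [hsum, fderiv_fun_sum fun j _ => (hψA j).differentiable z, _root_.sum_apply]
  have hv : ∀ z, φ z = ∑ j ∈ s, ψ j z := fun z => congrFun hsum z
  have hint : ∀ j, Integrable (fun z => (∑ i, G z i * fderiv ℝ (ψ j) z (spaceDir i)) +
      (g z + f z) * ψ j z) := fun j =>
    (integrable_finsetSum _ fun i _ => (hψA j).integrable_mul_fderiv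
      (locallyIntegrableOn_coord hG i) _).add ((hψA j).integrable_mul (hg.add hf))
  have hdec : ∀ z, (∑ i, G z i * fderiv ℝ φ z (spaceDir i)) + (g z + f z) * φ z =
      ∑ j ∈ s, ((∑ i, G z i * fderiv ℝ (ψ j) z (spaceDir i)) + (g z + f z) * ψ j z) := by
    intro z
    rw [Finset.sum_add_distrib, Finset.sum_comm, ← Finset.mul_sum, ← hv]
    simp only [hd, Finset.mul_sum]
  simp only [hdec]
  rw [integral_finsetSum _ fun j _ => (hint j).integrableOn]
  refine Finset.sum_nonneg fun j _ => ?_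
  rw [setIntegral_eq_of_subset_of_forall_sdiff_eq_zero hA (hV j).1]
  · exact (hV j).2.super _ (hψV j) (hpos h0 j)
  · intro z hz
    have hzφ : z ∉ tsupport (ψ j) := fun h => hz.2 ((hψV j).support_subset h)
    simp [(hψV j).fderiv_eq_zero hzφ, IsTestFunction.eq_zero hzφ]

/-- The index i is selected exactly when it attains the minimum and no smaller index does; each
condition is a finite combination of sets `u i ≤ u j` inside the open sets. -/
theorem nullMeasurableSet_minIndex {A : Fin N → Set (SpaceTime n)} (hA : ∀ i, IsOpen (A i))
    {u : Fin N → SpaceTime n → ℝ} (hu : ∀ i, AEMeasurable (u i) (volume.restrict (A i)))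
    (i : Fin N) : NullMeasurableSet {z | z ∈ (⋃ i, A i) ∧ minIndex A u z = i} volume := by
  have hcmp : ∀ i j, NullMeasurableSet (A i ∩ A j ∩ {z | u i z ≤ u j z}) volume := by
    intro i j
    have hm := ((hA i).inter (hA j)).measurableSet
    rw [inter_comm, ← nullMeasurableSet_restrict hm.nullMeasurableSet]
    exact nullMeasurableSet_le ((hu i).mono_measure (Measure.restrict_mono inter_subset_left le_rfl))
      ((hu j).mono_measure (Measure.restrict_mono inter_subset_right le_rfl))
  have hAm : ∀ i, NullMeasurableSet (A i) volume := fun i => (hA i).measurableSet.nullMeasurableSet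
  have harg : ∀ i, NullMeasurableSet {z | i ∈ argminSet A u z} volume := by
    intro i
    have : {z | i ∈ argminSet A u z} =
        A i ∩ ⋂ j, ((A j)ᶜ ∪ (A i ∩ A j ∩ {z | u i z ≤ u j z})) := by
      ext z
      simp only [argminSet, mem_inter_iff, mem_iInter, mem_union, mem_compl_iff]
      constructor
      · rintro ⟨hi, hj⟩
        refine ⟨hi, fun j => ?_⟩
        by_cases hzj : z ∈ A j
        · exact Or.inr ⟨⟨hi, hzj⟩, hj j hzj⟩
        · exact Or.inl hzj
      · rintro ⟨hi, hj⟩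
        refine ⟨hi, fun j hzj => ?_⟩
        rcases hj j with h | h
        · exact absurd hzj h
        · exact h.2
    rw [this]
    exact (hAm i).inter (NullMeasurableSet.iInter fun j => (hAm j).compl.union (hcmp i j))
  have : {z | z ∈ (⋃ i, A i) ∧ minIndex A u z = i} =
      {z | i ∈ argminSet A u z} ∩ ⋂ j : {j // j < i}, {z | j.1 ∈ argminSet A u z}ᶜ := by
    ext z
    simp only [mem_inter_iff, mem_iInter, mem_compl_iff]
    constructor
    · rintro ⟨hz, rfl⟩
      have h := minIndex_isLeast A u hz
      exact ⟨h.1, fun j hj => absurd (h.2 hj) (not_le.2 j.2)⟩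
    · rintro ⟨hi, hj⟩
      have hz : z ∈ ⋃ i, A i := mem_iUnion.2 ⟨i, hi.1⟩
      refine ⟨hz, (minIndex_isLeast A u hz).unique ⟨hi, fun j hja => ?_⟩⟩
      by_contra! hlt
      exact hj ⟨j, hlt⟩ hja
  rw [this]
  exact (harg i).inter (NullMeasurableSet.iInter fun j => (harg j).compl)

/-- The patched function is the finite sum of the `w i` cut off to the sets where i is selected, up
to null sets. The set S serves to restrict to late times. -/
theorem memLp_patch {F : Type*} [NormedAddCommGroup F] {A : Fin N → Set (SpaceTime n)}
    (hA : ∀ i, IsOpen (A i)) {u : Fin N → SpaceTime n → ℝ}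
    (hu : ∀ i, AEMeasurable (u i) (volume.restrict (A i))) {w : Fin N → SpaceTime n → F}
    {p : ENNReal} {S : Set (SpaceTime n)} (hS : MeasurableSet S)
    (hw : ∀ i, MemLp (w i) p (volume.restrict (A i ∩ S))) :
    MemLp (fun z => w (minIndex A u z) z) p (volume.restrict ((⋃ i, A i) ∩ S)) := by
  set E := fun i => {z | z ∈ (⋃ i, A i) ∧ minIndex A u z = i} with hE
  have hAm : MeasurableSet (⋃ i, A i) := (isOpen_iUnion hA).measurableSet
  have hi : ∀ i, MemLp ((E i).indicator (w i)) p (volume.restrict ((⋃ i, A i) ∩ S)) := by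
    intro i
    obtain ⟨t, htE, ht, hte⟩ := (nullMeasurableSet_minIndex hA hu i).exists_measurable_subset_ae_eq
    have hind : t.indicator (w i) =ᵐ[volume] (E i).indicator (w i) :=
      indicator_ae_eq_of_ae_eq_set hte
    refine MemLp.ae_eq (ae_mono Measure.restrict_le_self hind) ?_
    rw [memLp_indicator_iff_restrict ht, Measure.restrict_restrict ht]
    have htA : t ⊆ A i := fun z hz => (htE hz).2 ▸ (minIndex_isLeast A u (htE hz).1).1.1
    exact (hw i).mono_measure (Measure.restrict_mono
      (inter_subset_inter htA inter_subset_right) le_rfl)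
  refine (memLp_finsetSum' Finset.univ fun i _ => hi i).ae_eq ?_
  filter_upwards [ae_restrict_mem (hAm.inter hS)] with z hz
  rw [Finset.sum_apply, Finset.sum_eq_single (minIndex A u z)]
  · exact indicator_of_mem (show z ∈ E _ from ⟨hz.1, rfl⟩) _
  · intro j _ hj
    exact indicator_of_notMem (fun h : z ∈ E j => hj h.2.symm) _
  · simp

/-- Every point has positive time, so a small neighbourhood stays away from the initial time. -/
theorem locallyIntegrableOn_of_memLp_lateTimes {F : Type*} [NormedAddCommGroup F]
    {A : Set (SpaceTime n)} (hpos : ∀ z ∈ A, 0 < z.2) {g : SpaceTime n → F}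
    (hg : ∀ τ > 0, MemLp g 2 (volume.restrict (lateTimes A τ))) : LocallyIntegrableOn g A := by
  intro z hz
  have hzpos := hpos z hz
  refine ⟨lateTimes A (z.2 / 2) ∩ Metric.ball z 1, ?_, ?_⟩
  · have h1 : ∀ᶠ y in 𝓝[A] z, z.2 / 2 < y.2 :=
      (continuous_snd.continuousAt.eventually (lt_mem_nhds (half_lt_self hzpos))).filter_mono
        nhdsWithin_le_nhds
    have h2 : ∀ᶠ y in 𝓝[A] z, y ∈ Metric.ball z 1 :=
      nhdsWithin_le_nhds (Metric.ball_mem_nhds z one_pos)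
    filter_upwards [h1, h2, self_mem_nhdsWithin] with y hy1 hy2 hy3
    exact ⟨⟨hy3, hy1.le⟩, hy2⟩
  · have : IsFiniteMeasure (volume.restrict (lateTimes A (z.2 / 2) ∩ Metric.ball z 1)) :=
      isFiniteMeasure_restrict.2
        ((measure_mono inter_subset_right).trans_lt Metric.isBounded_ball.measure_lt_top).ne
    exact ((hg _ (half_pos hzpos)).mono_measure
      (Measure.restrict_mono inter_subset_left le_rfl)).integrable (by norm_num)

/-- The patched function is a weak supersolution with the patched derivatives and source. -/
theorem isRegularSupersolution_patch {A : Fin N → Set (SpaceTime n)}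
    (hA : ∀ i, IsOpen (A i)) (hpos : ∀ i, ∀ z ∈ A i, 0 < z.2) {u g f : Fin N → SpaceTime n → ℝ}
    {G : Fin N → SpaceTime n → EuclideanSpace ℝ (Fin n)}
    (h : ∀ i, IsRegularSupersolution (A i) (u i) (g i) (G i) (f i))
    (hloc : ∀ z ∈ ⋃ i, A i, ∃ V, IsOpen V ∧ z ∈ V ∧ V ⊆ ⋃ i, A i ∧
      IsLocalSupersolution V (patch A u u) (patch A u g) (fun y => G (minIndex A u y) y)
        (patch A u f)) :
    IsRegularSupersolution (⋃ i, A i) (patch A u u) (patch A u g)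
      (fun y => G (minIndex A u y) y) (patch A u f) := by
  have hu : ∀ i, AEMeasurable (u i) (volume.restrict (A i)) := fun i => (h i).bounded.1.aemeasurable
  have hAm : MeasurableSet (⋃ i, A i) := (isOpen_iUnion hA).measurableSet
  have hposU : ∀ z ∈ ⋃ i, A i, 0 < z.2 := fun z hz => by
    obtain ⟨i, hi⟩ := mem_iUnion.1 hz
    exact hpos i z hi
  have htop : ∀ {w : Fin N → SpaceTime n → ℝ}, (∀ i, MemLp (w i) ⊤ (volume.restrict (A i))) →
      MemLp (patch A u w) ⊤ (volume.restrict (⋃ i, A i)) := by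
    intro w hw
    have := memLp_patch hA hu (w := w) (p := ⊤) MeasurableSet.univ (by simpa using hw)
    rwa [inter_univ] at this
  have hlate : ∀ τ : ℝ, MeasurableSet {z : SpaceTime n | τ ≤ z.2} := fun τ =>
    measurableSet_le measurable_const measurable_snd
  have hg : ∀ τ > 0, MemLp (patch A u g) 2 (volume.restrict (lateTimes (⋃ i, A i) τ)) :=
    fun τ hτ => memLp_patch hA hu (hlate τ) fun i => (h i).memLp_time τ hτ
  have hG : ∀ τ > 0, MemLp (fun y => G (minIndex A u y) y) 2
      (volume.restrict (lateTimes (⋃ i, A i) τ)) :=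
    fun τ hτ => memLp_patch hA hu (hlate τ) fun i => (h i).memLp_space τ hτ
  have hub := htop fun i => (h i).bounded
  have hfb := htop fun i => (h i).bounded_source
  have hul := locallyIntegrableOn_of_memLp_top hub
  have hgl := locallyIntegrableOn_of_memLp_lateTimes hposU hg
  have hGl := locallyIntegrableOn_of_memLp_lateTimes hposU hG
  refine ⟨hub, hfb, hg, hG, ?_, fun i => ?_, fun φ hφ h0 => ?_⟩
  · refine HasWeakDirDeriv.of_local hAm hul hgl fun z hz => ?_
    obtain ⟨V, hV, hzV, hVA, hVl⟩ := hloc z hz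
    exact ⟨V, hV, hzV, hVA, hVl.time⟩
  · refine HasWeakDirDeriv.of_local hAm hul (locallyIntegrableOn_coord hGl i) fun z hz => ?_
    obtain ⟨V, hV, hzV, hVA, hVl⟩ := hloc z hz
    exact ⟨V, hV, hzV, hVA, hVl.space i⟩
  · exact integral_super_nonneg_of_local hAm hGl hgl (locallyIntegrableOn_of_memLp_top hfb) hloc
      hφ h0

end Patching

/-! ### Explicit solutions of the reaction ODE -/

section ReactionProfile

/-- `F` solves the ordinary differential equation `F' = -k F ^ m`, `F 0 = M`, and `Φ` is its
inverse function. -/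
structure IsReactionProfile (k m M : ℝ) (F Φ : ℝ → ℝ) : Prop where
  pos : ∀ s, 0 ≤ s → 0 < F s
  le : ∀ s, 0 ≤ s → F s ≤ M
  hasDerivAt : ∀ s, 0 ≤ s → HasDerivAt F (-(k * F s ^ m)) s
  inv_antitone : AntitoneOn Φ (Ioi 0)
  inv_hasDerivAt : ∀ y, 0 < y → HasDerivAt Φ (-(1 / (k * y ^ m))) y
  inv_nonneg : ∀ y, 0 < y → y ≤ M → 0 ≤ Φ y
  le_of_le_inv : ∀ y s, 0 < y → 0 ≤ s → s ≤ Φ y → y ≤ F s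

/-- For exponent 1 the equation is linear: F decays exponentially and its inverse is a logarithm. -/
theorem isReactionProfile_exp {k M : ℝ} (hk : 0 < k) (hM : 0 < M) :
    IsReactionProfile k 1 M (fun s => M * Real.exp (-(k * s)))
      (fun y => (Real.log M - Real.log y) / k) where
  pos s _ := by positivity
  le s hs := by
    have : Real.exp (-(k * s)) ≤ 1 := Real.exp_le_one_iff.2 (by nlinarith)
    nlinarith
  hasDerivAt s _ := by
    have h := ((((hasDerivAt_id s).const_mul k).neg).exp).const_mul M
    refine h.congr_deriv ?_
    rw [Real.rpow_one]
    simp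
    ring
  inv_antitone x hx y _ hxy := by
    have := Real.log_le_log hx hxy
    dsimp only
    gcongr
  inv_hasDerivAt y hy := by
    have h := ((Real.hasDerivAt_log hy.ne').const_sub (Real.log M)).div_const k
    refine h.congr_deriv ?_
    rw [Real.rpow_one]
    field_simp
  inv_nonneg y hy hyM := div_nonneg (sub_nonneg.2 (Real.log_le_log hy hyM)) hk.le
  le_of_le_inv y s hy _ h := by
    rw [le_div_iff₀ hk] at h
    rw [← Real.log_le_log_iff hy (by positivity), Real.log_mul hM.ne' (Real.exp_ne_zero _),
      Real.log_exp]
    linarith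

/-- For exponent p + 1 the quantity `F ^ (-p)` grows linearly with slope `p * k`, which gives both F
and its inverse. -/
theorem isReactionProfile_rpow {k p M : ℝ} (hk : 0 < k) (hp : 0 < p) (hM : 0 < M) :
    IsReactionProfile k (p + 1) M (fun s => (M ^ (-p) + p * k * s) ^ (-(1 / p)))
      (fun y => (y ^ (-p) - M ^ (-p)) / (p * k)) := by
  have hMp : 0 < M ^ (-p) := Real.rpow_pos_of_pos hM _
  have hB : ∀ s, 0 ≤ s → 0 < M ^ (-p) + p * k * s := fun s hs => by positivity
  have hinv : ∀ y : ℝ, 0 < y → (y ^ (-p)) ^ (-(1 / p)) = y := fun y hy => by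
    rw [← Real.rpow_mul hy.le, show -p * -(1 / p) = 1 by field_simp, Real.rpow_one]
  have hneg : -(1 / p) ≤ 0 := by
    rw [neg_nonpos]
    positivity
  refine ⟨fun s hs => Real.rpow_pos_of_pos (hB s hs) _, fun s hs => ?_, fun s hs => ?_,
    fun x hx y hy hxy => ?_, fun y hy => ?_, fun y hy hyM => ?_, fun y s hy hs h => ?_⟩
  · calc (M ^ (-p) + p * k * s) ^ (-(1 / p)) ≤ (M ^ (-p)) ^ (-(1 / p)) :=
        Real.rpow_le_rpow_of_nonpos hMp (le_add_of_nonneg_right (by positivity)) hneg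
      _ = M := hinv M hM
  · have h := (((hasDerivAt_id s).const_mul (p * k)).const_add (M ^ (-p))).rpow_const
      (p := -(1 / p)) (Or.inl (hB s hs).ne')
    refine h.congr_deriv ?_
    rw [← Real.rpow_mul (hB s hs).le, show -(1 / p) * (p + 1) = -(1 / p) - 1 by field_simp; ring]
    simp only [id]
    field_simp
  · have := Real.rpow_le_rpow_of_nonpos (mem_Ioi.1 hx) hxy (neg_nonpos.2 hp.le)
    gcongr
  · have h := ((Real.hasDerivAt_rpow_const (p := -p) (Or.inl hy.ne')).sub_const
      (M ^ (-p))).div_const (p * k)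
    refine h.congr_deriv ?_
    rw [show -p - 1 = -(p + 1) by ring, Real.rpow_neg hy.le]
    field_simp
  · exact div_nonneg (sub_nonneg.2 (Real.rpow_le_rpow_of_nonpos hy hyM (neg_nonpos.2 hp.le)))
      (by positivity)
  · rw [le_div_iff₀ (by positivity)] at h
    calc y = (y ^ (-p)) ^ (-(1 / p)) := (hinv y hy).symm
      _ ≤ (M ^ (-p) + p * k * s) ^ (-(1 / p)) :=
        Real.rpow_le_rpow_of_nonpos (hB s hs) (by linarith) hneg

theorem exists_isReactionProfile {k m M : ℝ} (hk : 0 < k) (hm : 1 ≤ m) (hM : 0 < M) :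
    ∃ F Φ, IsReactionProfile k m M F Φ := by
  rcases hm.eq_or_lt with rfl | hm
  · exact ⟨_, _, isReactionProfile_exp hk hM⟩
  · have h := isReactionProfile_rpow (p := m - 1) hk (sub_pos.2 hm) hM
    rw [sub_add_cancel] at h
    exact ⟨_, _, h⟩

end ReactionProfile

/-! ### Monotone functions on the line and ODE comparison -/

section Lines

/-- The sum of `w` and the primitive of `f` has nonpositive slopes from t to nearby later points of
E. Since the derivative exists, it is the limit of these slopes alone. -/
theorem deriv_le_neg_of_accumulation {w f : ℝ → ℝ} {E O : Set ℝ} {t w' : ℝ} (hO : O ∈ 𝓝 t)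
    (hE : (𝓝[E ∩ Ioi t] t).NeBot) (hw : HasDerivAt w w' t)
    (hf : HasDerivAt (fun s => ∫ r in t..s, f r) (f t) t)
    (h : ∀ s ∈ E, t ≤ s → Icc t s ⊆ O → w s - w t ≤ - ∫ r in t..s, f r) : w' ≤ - f t := by
  have hD := (hw.add hf).hasDerivWithinAt (s := E ∩ Ioi t)
  rw [hasDerivWithinAt_iff_tendsto_slope' (fun h : t ∈ E ∩ Ioi t => lt_irrefl t h.2)] at hD
  have hle : ∀ᶠ s in 𝓝[E ∩ Ioi t] t,
      slope (w + fun s => ∫ r in t..s, f r) t s ≤ 0 := by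
    obtain ⟨ε, hε, hball⟩ := Metric.mem_nhds_iff.1 hO
    have hev : ∀ᶠ s in 𝓝[E ∩ Ioi t] t, s ∈ Metric.ball t ε :=
      nhdsWithin_le_nhds (Metric.ball_mem_nhds t hε)
    filter_upwards [hev, self_mem_nhdsWithin] with s hs hsE
    have hts : t < s := hsE.2
    have hsub : Icc t s ⊆ O := fun r hr => hball <| by
      rw [Metric.mem_ball, Real.dist_eq, abs_lt] at hs ⊢
      constructor <;> linarith [hr.1, hr.2, hs.2]
    have h1 := h s hsE.1 hts.le hsub
    rw [slope_def_field]
    refine div_nonpos_of_nonpos_of_nonneg ?_ (sub_nonneg.2 hts.le)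
    simp only [Pi.add_apply, intervalIntegral.integral_same]
    linarith
  have := le_of_tendsto hD hle
  linarith

/-- An interval just to the left of t has positive measure, hence contains a point where the bound
holds; monotonicity carries it to t. -/
theorem le_of_ae_le_of_antitoneOn {S : Set ℝ} (hS : IsOpen S) {w : ℝ → ℝ} (hw : AntitoneOn w S)
    {M : ℝ} (hM : ∀ᵐ t, t ∈ S → w t ≤ M) {t : ℝ} (ht : t ∈ S) : w t ≤ M := by
  obtain ⟨ε, hε, hball⟩ := Metric.mem_nhds_iff.1 (hS.mem_nhds ht)
  have hpos : volume (Ioo (t - ε) t) ≠ 0 := by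
    rw [Real.volume_Ioo]
    simpa using hε
  have hne : (ae (volume.restrict (Ioo (t - ε) t))).NeBot := by
    rw [ae_neBot, Ne, Measure.restrict_eq_zero]
    exact hpos
  have hM' : ∀ᵐ s ∂volume.restrict (Ioo (t - ε) t), s ∈ S → w s ≤ M := ae_restrict_of_ae hM
  obtain ⟨s, hs1, hs2⟩ := (hM'.and (ae_restrict_mem measurableSet_Ioo)).exists
  have hsS : s ∈ S := hball <| by
    rw [Metric.mem_ball, Real.dist_eq, abs_lt]
    constructor <;> linarith [hs2.1, hs2.2]
  exact (hw hsS ht hs2.2.le).trans (hs1 hsS)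

/-- Comparison of an antitone function decaying at least as fast as `w' ≤ -k q w ^ m` almost
everywhere with the solution of the equation. -/
theorem IsReactionProfile.antitoneOn_le {k m M : ℝ} {F Φ : ℝ → ℝ}
    (h : IsReactionProfile k m M F Φ) (hk : 0 < k) {S : Set ℝ} (hS : IsOpen S) (hS0 : S ⊆ Ioi 0)
    {w q : ℝ → ℝ} (hw : AntitoneOn w S) (hw0 : ∀ t ∈ S, 0 ≤ w t) (hwM : ∀ t ∈ S, w t ≤ M)
    (hq0 : ∀ t, 0 ≤ q t) (hqS : ∀ t, t ∉ S → q t = 0)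
    (hqi : ∀ a b, IntervalIntegrable q volume a b)
    (hode : ∀ᵐ t, t ∈ S → ∀ w', HasDerivAt w w' t → w' ≤ -(k * q t * w t ^ m))
    {b : ℝ} (hb : b ∈ S) : w b ≤ F (∫ t in (0 : ℝ)..b, q t) := by
  have hb0 : 0 ≤ b := (hS0 hb).le
  have hI0 : 0 ≤ ∫ t in (0 : ℝ)..b, q t := intervalIntegral.integral_nonneg hb0 fun t _ => hq0 t
  -- If w vanishes at b the claim is positivity of F. Otherwise `w b > 0` keeps w away from zero up
  -- to b, so Φ can be applied.
  rcases (hw0 b hb).eq_or_lt with h0 | hpos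
  · rw [← h0]
    exact (h.pos _ hI0).le
  obtain ⟨W, hW, hWS⟩ := hw.exists_antitone_extension
    ⟨0, by rintro _ ⟨t, ht, rfl⟩; exact hw0 t ht⟩ ⟨M, by rintro _ ⟨t, ht, rfl⟩; exact hwM t ht⟩
  -- Extend w across the gaps of S and truncate: the lower bound `w b` stays in the domain of Φ, and
  -- the upper bound M ensures that Φ is nonnegative at time 0. On S up to b nothing changes.
  set W₂ : ℝ → ℝ := fun t => max (min (W t) M) (w b) with hW₂
  have hW₂anti : Antitone W₂ := fun s t hst =>
    max_le_max (min_le_min (hW hst) le_rfl) le_rfl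
  have hW₂pos : ∀ t, 0 < W₂ t := fun t => hpos.trans_le (le_max_right _ _)
  have hW₂M : ∀ t, W₂ t ≤ M := fun t => max_le (min_le_right _ _) (hwM b hb)
  have hW₂eq : ∀ t ∈ S, t ≤ b → W₂ t = w t := fun t ht htb => by
    simp only [hW₂]
    rw [← hWS ht, min_eq_left (hwM t ht), max_eq_left (hw ht hb htb)]
  set ψ : ℝ → ℝ := fun t => Φ (W₂ t) with hψ
  have hψm : Monotone ψ := fun s t hst => h.inv_antitone (hW₂pos t) (hW₂pos s) (hW₂anti hst)
  have hdiff : ∀ᵐ t, DifferentiableAt ℝ W₂ t := by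
    filter_upwards [hW₂anti.neg.ae_differentiableAt] with t ht
    have h2 := ht.fun_neg
    simpa only [neg_neg] using h2
  have hle : ∀ᵐ t, t ∈ Ioo 0 b → q t ≤ deriv ψ t := by
    filter_upwards [hode, hdiff] with t ht hd htb
    by_cases htS : t ∈ S
    · have heq : W₂ =ᶠ[𝓝 t] w := by
        filter_upwards [hS.mem_nhds htS, Iio_mem_nhds htb.2] with s hs1 hs2 using
          hW₂eq s hs1 (le_of_lt hs2)
      have hd2 := hd.hasDerivAt.congr_of_eventuallyEq heq.symm
      have h1 := ht htS _ hd2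
      have hwt : W₂ t = w t := heq.self_of_nhds
      have h2 := (h.inv_hasDerivAt (W₂ t) (hW₂pos t)).comp t hd.hasDerivAt
      have h3 : deriv ψ t = -(1 / (k * W₂ t ^ m)) * deriv W₂ t := h2.deriv
      have hpw : 0 < k * W₂ t ^ m := mul_pos hk (Real.rpow_pos_of_pos (hW₂pos t) _)
      rw [← hwt] at h1
      rw [h3, neg_mul, one_div, inv_mul_eq_div, ← neg_div, le_div_iff₀ hpw]
      linarith
    -- In the gaps q vanishes, so monotonicity of ψ is enough.
    · rw [hqS t htS]
      exact hψm.deriv_nonneg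
  have hint : IntervalIntegrable (deriv ψ) volume 0 b :=
    (hψm.monotoneOn _).intervalIntegrable_deriv
  have hcmp : ∫ t in (0 : ℝ)..b, q t ≤ ∫ t in (0 : ℝ)..b, deriv ψ t := by
    refine intervalIntegral.integral_mono_ae_restrict hb0 (hqi 0 b) hint ?_
    rw [← restrict_Ioo_eq_restrict_Icc, EventuallyLE, ae_restrict_iff' measurableSet_Ioo]
    exact hle
  -- For a monotone function the integral of the derivative is at most the increment; downward jumps
  -- of w only help.
  have hftc : ∫ t in (0 : ℝ)..b, deriv ψ t ≤ ψ b - ψ 0 := by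
    have := (hψm.monotoneOn (uIcc 0 b)).intervalIntegral_deriv_mem_uIcc
    rw [uIcc_of_le (sub_nonneg.2 (hψm hb0))] at this
    exact this.2
  have h0 : 0 ≤ ψ 0 := h.inv_nonneg _ (hW₂pos 0) (hW₂M 0)
  have hψb : ψ b = Φ (w b) := by rw [hψ]; simp only [hW₂eq b hb le_rfl]
  exact h.le_of_le_inv _ _ hpos hI0 (by linarith)

end Lines

/-! ### The reaction inequality on time lines -/

section TimeLines

variable {n : ℕ}

/-- The time section of `A` over `x`. -/
def timeSection (A : Set (SpaceTime n)) (x : EuclideanSpace ℝ (Fin n)) : Set ℝ := {t | (x, t) ∈ A}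

theorem isOpen_timeSection {A : Set (SpaceTime n)} (hA : IsOpen A)
    (x : EuclideanSpace ℝ (Fin n)) : IsOpen (timeSection A x) :=
  hA.preimage (continuous_const.prodMk continuous_id)

theorem hasDerivAt_timeLine {f : SpaceTime n → ℝ} (hf : Differentiable ℝ f)
    (x : EuclideanSpace ℝ (Fin n)) (t : ℝ) :
    HasDerivAt (fun s => f (x, s)) (fderiv ℝ f (x, t) (timeDir n)) t :=
  (hf (x, t)).hasFDerivAt.comp_hasDerivAt t ((hasDerivAt_const t x).prodMk (hasDerivAt_id t))

theorem ae_ae_of_ae_spaceTime {p : SpaceTime n → Prop} (h : ∀ᵐ z, p z) :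
    ∀ᵐ x : EuclideanSpace ℝ (Fin n), ∀ᵐ t : ℝ, p (x, t) := by
  rw [Measure.volume_eq_prod] at h
  exact Measure.ae_ae_of_ae_prod h

/-- The weak inequality is tested with the reflected kernel centred at z. -/
theorem WeakReactionLE.fderiv_mollify_le {A : Set (SpaceTime n)} (hA : IsOpen A)
    {v f : SpaceTime n → ℝ} (h : WeakReactionLE A v f) (hv : IntegrableOn v A)
    (hf : IntegrableOn f A) {k : ℕ} {z : SpaceTime n}
    (hz : Metric.closedBall z (shrinkingBump (SpaceTime n) k).rOut ⊆ A) :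
    fderiv ℝ (mollify volume k (A.indicator v)) z (timeDir n) ≤
      - mollify volume k (A.indicator f) z := by
  have hφ := isTestFunction_shrinkingBump hz
  have h1 := h _ hφ fun y => ContDiffBump.nonneg_normed _ _
  have hvl := hv.locallyIntegrableOn
  have hfl := hf.locallyIntegrableOn
  have i1 : IntegrableOn (fun y => - (v y * fderiv ℝ
      (fun y => (shrinkingBump (SpaceTime n) k).normed volume (z - y)) y (timeDir n))) A :=
    (hφ.integrable_mul_fderiv hvl _).neg.integrableOn
  simp only [hφ.timeDeriv_eq, neg_mul] at h1
  rw [integral_add i1 (hφ.integrable_mul hfl).integrableOn, integral_neg] at h1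
  rw [fderiv_mollify_indicator hA.measurableSet hv, mollify_indicator hA.measurableSet]
  linarith

theorem exists_ae_abs_le_of_memLp_top {X : Type*} [MeasurableSpace X] {ν : Measure X}
    {w : X → ℝ} (hw : MemLp w ⊤ ν) : ∃ C, ∀ᵐ z ∂ν, |w z| ≤ C := by
  refine ⟨(eLpNormEssSup w ν).toReal, ?_⟩
  have hlt : eLpNormEssSup w ν < ⊤ := by simpa using hw.2
  filter_upwards [ae_le_eLpNormEssSup (f := w) (μ := ν)] with z hz
  rw [← Real.norm_eq_abs, ← toReal_enorm]
  exact ENNReal.toReal_mono hlt.ne hz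

/-- The reaction inequality integrated along almost every time line. -/
theorem WeakReactionLE.ae_timeLine {A : Set (SpaceTime n)} (hA : IsOpen A)
    (hfin : volume A ≠ ⊤) {v f : SpaceTime n → ℝ} (h : WeakReactionLE A v f)
    (hv : MemLp v ⊤ (volume.restrict A)) (hf : MemLp f ⊤ (volume.restrict A)) :
    ∀ᵐ x : EuclideanSpace ℝ (Fin n), LocallyIntegrable (fun t => A.indicator f (x, t)) ∧
      ∃ T : Set ℝ, (∀ᵐ t, t ∈ timeSection A x → t ∈ T) ∧
      ∀ t₁ ∈ T, ∀ t₂ ∈ T, t₁ ≤ t₂ → Icc t₁ t₂ ⊆ timeSection A x →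
        v (x, t₂) - v (x, t₁) ≤ - ∫ t in t₁..t₂, A.indicator f (x, t) := by
  have : IsFiniteMeasure (volume.restrict A) := isFiniteMeasure_restrict.2 hfin
  have hAm := hA.measurableSet
  have hvi : IntegrableOn v A := hv.integrable le_top
  have hfi : IntegrableOn f A := hf.integrable le_top
  have hvI : Integrable (A.indicator v) := hvi.integrable_indicator hAm
  have hfI : Integrable (A.indicator f) := hfi.integrable_indicator hAm
  obtain ⟨C, hC⟩ : ∃ C, ∀ᵐ z, |A.indicator f z| ≤ C := by
    have hb : MemLp (A.indicator f) ⊤ volume := (memLp_indicator_iff_restrict hAm).2 hf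
    exact exists_ae_abs_le_of_memLp_top hb
  have hmeas : ∀ᵐ x : EuclideanSpace ℝ (Fin n), Integrable fun t => A.indicator f (x, t) := by
    rw [Measure.volume_eq_prod] at hfI
    exact hfI.prod_right_ae
  filter_upwards [ae_ae_of_ae_spaceTime (ae_tendsto_mollify hvI.locallyIntegrable),
    ae_ae_of_ae_spaceTime (ae_tendsto_mollify hfI.locallyIntegrable), hmeas] with x hxv hxf hxi
  -- Point values of v are meaningful only where the mollifications converge to them, so T collects
  -- these times.
  refine ⟨hxi.locallyIntegrable, {t | Tendsto (fun k => mollify volume k (A.indicator v) (x, t))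
    atTop (𝓝 (v (x, t)))}, ?_, ?_⟩
  · filter_upwards [hxv] with t ht htA
    rwa [indicator_of_mem (show (x, t) ∈ A from htA)] at ht
  · intro t₁ ht₁ t₂ ht₂ h12 hsub
    set vs := fun k => mollify volume k (A.indicator v) with hvs
    set fs := fun k => mollify volume k (A.indicator f) with hfs
    have hvd : ∀ k, ContDiff ℝ ∞ (vs k) := fun k => contDiff_mollify hvI.locallyIntegrable k
    have hfd : ∀ k, ContDiff ℝ ∞ (fs k) := fun k => contDiff_mollify hfI.locallyIntegrable k
    have hline : Continuous fun t : ℝ => ((x, t) : SpaceTime n) :=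
      continuous_const.prodMk continuous_id
    have hfc : ∀ k, Continuous fun t : ℝ => fs k (x, t) := fun k => (hfd k).continuous.comp hline
    -- The compact segment has a positive distance to the complement of A, so small kernels are
    -- admissible along all of it.
    obtain ⟨δ, hδ, hδA⟩ := (isCompact_Icc.image hline).exists_cthickening_subset_open hA
      (image_subset_iff.2 hsub : (fun t : ℝ => ((x, t) : SpaceTime n)) '' Icc t₁ t₂ ⊆ A)
    have hineq : ∀ᶠ k in atTop, vs k (x, t₂) - vs k (x, t₁) ≤ - ∫ t in t₁..t₂, fs k (x, t) := by
      filter_upwards [(tendsto_shrinkingBump_rOut (X := SpaceTime n)).eventually (gt_mem_nhds hδ)]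
        with k hk
      have hcd : Continuous fun t : ℝ => fderiv ℝ (vs k) (x, t) (timeDir n) :=
        (((hvd k).continuous_fderiv (by simp)).comp hline).clm_apply continuous_const
      rw [← intervalIntegral.integral_eq_sub_of_hasDerivAt
        (fun t _ => hasDerivAt_timeLine ((hvd k).differentiable (by simp)) x t)
        (hcd.intervalIntegrable _ _), ← intervalIntegral.integral_neg]
      refine intervalIntegral.integral_mono_on h12 (hcd.intervalIntegrable _ _)
        ((hfc k).neg.intervalIntegrable _ _) fun t ht => ?_
      refine h.fderiv_mollify_le hA hvi hfi (((Metric.closedBall_subset_closedBall hk.le).trans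
        (Metric.closedBall_subset_cthickening (mem_image_of_mem _ ht) δ)).trans hδA)
    have hlim : Tendsto (fun k => ∫ t in t₁..t₂, fs k (x, t)) atTop
        (𝓝 (∫ t in t₁..t₂, A.indicator f (x, t))) := by
      refine intervalIntegral.tendsto_integral_filter_of_dominated_convergence (fun _ => C)
        (Eventually.of_forall fun k => (hfc k).aestronglyMeasurable)
        (Eventually.of_forall fun k => Eventually.of_forall fun t _ => abs_mollify_le hC k _)
        intervalIntegrable_const ?_
      filter_upwards [hxf] with t ht _ using ht
    exact le_of_tendsto_of_tendsto (ht₂.sub ht₁) hlim.neg hineq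

end TimeLines

/-! ### The reactant V built from the accumulated source -/

section ReactionSolution

variable {n : ℕ}

/-- The integral of `q` over the part of the time line before `z` at positive times. -/
noncomputable def accumulated (q : SpaceTime n → ℝ) (z : SpaceTime n) : ℝ :=
  ∫ r in Ioc 0 z.2, q (z.1, r)

theorem accumulated_nonneg {q : SpaceTime n → ℝ} (hq : ∀ z, 0 ≤ q z) (z : SpaceTime n) :
    0 ≤ accumulated q z := integral_nonneg fun _ => hq _

theorem accumulated_eq {q : SpaceTime n → ℝ} {x : EuclideanSpace ℝ (Fin n)} {t : ℝ}
    (ht : 0 ≤ t) : accumulated q (x, t) = ∫ r in (0 : ℝ)..t, q (x, r) :=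
  (intervalIntegral.integral_of_le ht).symm

/-- The varying upper limit is moved into a jointly measurable indicator, so that the integral is
one over a fixed line with parameter z. -/
theorem measurable_accumulated {q : SpaceTime n → ℝ} (hq : Measurable q) :
    Measurable (accumulated q) := by
  have h1 : Measurable fun p : SpaceTime n × ℝ =>
      ({p : SpaceTime n × ℝ | 0 < p.2 ∧ p.2 ≤ p.1.2}.indicator (fun p => q (p.1.1, p.2)) p) := by
    refine Measurable.indicator (hq.comp (by fun_prop)) ?_
    exact (measurableSet_lt measurable_const measurable_snd).inter
      (measurableSet_le measurable_snd (by fun_prop))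
  have h2 := (h1.stronglyMeasurable.integral_prod_right' (ν := (volume : Measure ℝ))).measurable
  convert h2 using 2 with z
  rw [accumulated, ← integral_indicator measurableSet_Ioc]
  rfl

theorem intervalIntegrable_timeLine {q : SpaceTime n → ℝ} (hq : Measurable q) {C : ℝ}
    (hC : ∀ z, |q z| ≤ C) (x : EuclideanSpace ℝ (Fin n)) (a b : ℝ) :
    IntervalIntegrable (fun r => q (x, r)) volume a b := by
  have hm : Measurable fun r : ℝ => q (x, r) := hq.comp (by fun_prop)
  exact (intervalIntegrable_const (c := C)).mono_fun hm.aestronglyMeasurable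
    (Eventually.of_forall fun r => (hC _).trans (le_abs_self C))

/-- Continuity of q at z itself suffices, so q may jump at the boundary of A. -/
theorem hasDerivAt_accumulated {q : SpaceTime n → ℝ} (hq : Measurable q) {C : ℝ}
    (hC : ∀ z, |q z| ≤ C) {z : SpaceTime n} (hz : 0 < z.2) (hcont : ContinuousAt q z) :
    HasDerivAt (fun t => accumulated q (z.1, t)) (q z) z.2 := by
  have hm : Measurable fun r : ℝ => q (z.1, r) := hq.comp (by fun_prop)
  have hc : ContinuousAt (fun r : ℝ => q (z.1, r)) z.2 :=
    ContinuousAt.comp (f := fun r : ℝ => ((z.1, r) : SpaceTime n)) (g := q) hcont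
      (by fun_prop)
  have h1 := intervalIntegral.integral_hasDerivAt_right
    (intervalIntegrable_timeLine hq hC z.1 0 z.2)
    (hm.stronglyMeasurable.stronglyMeasurableAtFilter) hc
  refine h1.congr_of_eventuallyEq ?_
  filter_upwards [lt_mem_nhds hz] with t ht using accumulated_eq ht.le

/-- Along time lines, `F (accumulated q)` solves `∂_t v = -k q v ^ m`, also in the weak sense. -/
theorem IsReactionProfile.hasWeakDirDeriv {k m M : ℝ} {F Φ : ℝ → ℝ}
    (h : IsReactionProfile k m M F Φ) {A : Set (SpaceTime n)} (hA : IsOpen A)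
    (hpos : ∀ z ∈ A, 0 < z.2) {q : SpaceTime n → ℝ} (hq : Measurable q) (hq0 : ∀ z, 0 ≤ q z)
    {C : ℝ} (hC : ∀ z, |q z| ≤ C) (hqc : ContinuousOn q A) {V : SpaceTime n → ℝ}
    (hV : V = fun z => F (accumulated q z)) (hVm : Measurable V) {CV Cg : ℝ}
    (hVb : ∀ z, |V z| ≤ CV) (hgb : ∀ z, |k * q z * V z ^ m| ≤ Cg) :
    HasWeakDirDeriv A V (fun z => -(k * q z * V z ^ m)) (timeDir n) := by
  intro φ hφ
  set g : SpaceTime n → ℝ := fun z => -(k * q z * V z ^ m) with hg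
  have hgm : Measurable g := ((hq.const_mul k).mul (hVm.pow_const m)).neg
  have hgb' : ∀ z, |g z| ≤ Cg := fun z => by rw [hg, abs_neg]; exact hgb z
  have hφi : Integrable φ := hφ.continuous.integrable_of_hasCompactSupport hφ.compactSupport
  have hdφi : Integrable fun z => fderiv ℝ φ z (timeDir n) :=
    (hφ.continuous_fderiv_apply _).integrable_of_hasCompactSupport
      (hφ.hasCompactSupport_fderiv_apply _)
  have i1 : Integrable fun z => V z * fderiv ℝ φ z (timeDir n) :=
    hdφi.bdd_mul hVm.aestronglyMeasurable (Eventually.of_forall hVb)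
  have i2 : Integrable fun z => g z * φ z :=
    hφi.bdd_mul hgm.aestronglyMeasurable (Eventually.of_forall hgb')
  rw [setIntegral_eq_integral_of_forall_compl_eq_zero (fun z hz => by
      rw [hφ.fderiv_eq_zero (fun h => hz (hφ.support_subset h)), mul_zero]),
    setIntegral_eq_integral_of_forall_compl_eq_zero (fun z hz => by
      rw [IsTestFunction.eq_zero (fun h => hz (hφ.support_subset h)), mul_zero]),
    eq_neg_iff_add_eq_zero, ← integral_add i1 i2]
  have i3 := i1.add i2
  rw [Measure.volume_eq_prod] at i3 ⊢
  -- By Fubini it suffices that, on each line, the integral of the time derivative of `V * φ`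
  -- vanishes.
  have hfub := integral_prod _ i3
  refine hfub.trans ?_
  rw [← integral_zero (EuclideanSpace ℝ (Fin n)) ℝ]
  refine integral_congr_ae (Eventually.of_forall fun x => ?_)
  have hline : Continuous fun t : ℝ => ((x, t) : SpaceTime n) :=
    continuous_const.prodMk continuous_id
  have hcs : HasCompactSupport fun t : ℝ => φ (x, t) := by
    refine HasCompactSupport.of_support_subset_isCompact
      (hφ.compactSupport.isCompact.image continuous_snd) fun t ht => ?_
    exact ⟨(x, t), subset_tsupport _ ht, rfl⟩
  have hcs' : HasCompactSupport fun t : ℝ => fderiv ℝ φ (x, t) (timeDir n) := by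
    refine HasCompactSupport.of_support_subset_isCompact
      (hφ.compactSupport.isCompact.image continuous_snd) fun t ht => ?_
    refine ⟨(x, t), ?_, rfl⟩
    by_contra hne
    exact ht (hφ.fderiv_eq_zero hne _)
  have j0 : Integrable fun t : ℝ => φ (x, t) :=
    (hφ.continuous.comp hline).integrable_of_hasCompactSupport hcs
  have j0' : Integrable fun t : ℝ => fderiv ℝ φ (x, t) (timeDir n) :=
    ((hφ.continuous_fderiv_apply _).comp hline).integrable_of_hasCompactSupport hcs'
  have j1 : Integrable fun t : ℝ => V (x, t) * φ (x, t) :=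
    j0.bdd_mul (hVm.comp hline.measurable).aestronglyMeasurable
      (Eventually.of_forall fun t => hVb _)
  have j2 : Integrable fun t : ℝ => V (x, t) * fderiv ℝ φ (x, t) (timeDir n) :=
    j0'.bdd_mul (hVm.comp hline.measurable).aestronglyMeasurable
      (Eventually.of_forall fun t => hVb _)
  have j3 : Integrable fun t : ℝ => g (x, t) * φ (x, t) :=
    j0.bdd_mul (hgm.comp hline.measurable).aestronglyMeasurable
      (Eventually.of_forall fun t => hgb' _)
  refine integral_eq_zero_of_hasDerivAt_of_integrable (f := fun t => V (x, t) * φ (x, t))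
    (fun t => ?_) (j2.add j3) j1
  have hdφ := hasDerivAt_timeLine hφ.differentiable x t
  by_cases ht : (x, t) ∈ tsupport φ
  · have hz : (x, t) ∈ A := hφ.support_subset ht
    have hacc := hasDerivAt_accumulated hq hC (hpos _ hz) (hqc.continuousAt (hA.mem_nhds hz))
    have hVd : HasDerivAt (fun s => V (x, s)) (g (x, t)) t := by
      have h1 := (h.hasDerivAt _ (accumulated_nonneg hq0 (x, t))).comp t hacc
      rw [hV] at hg
      rw [hV, hg]
      refine h1.congr_deriv ?_
      ring
    refine (hVd.mul hdφ).congr_deriv ?_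
    simp only [Pi.add_apply]
    ring
  -- Off the support of φ, V need not be differentiable, but the product vanishes nearby.
  · have hev : (fun s => V (x, s) * φ (x, s)) =ᶠ[𝓝 t] fun _ => 0 := by
      have hopen : ∀ᶠ s in 𝓝 t, (x, s) ∉ tsupport φ :=
        hline.continuousAt.eventually ((isClosed_tsupport φ).isOpen_compl.mem_nhds ht)
      filter_upwards [hopen] with s hs
      rw [IsTestFunction.eq_zero hs, mul_zero]
    refine ((hasDerivAt_const t (0 : ℝ)).congr_of_eventuallyEq hev).congr_deriv ?_
    simp [hφ.fderiv_eq_zero ht, IsTestFunction.eq_zero ht]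

end ReactionSolution

/-! ### Comparison of the patched reactant with V -/

section Comparison

variable {n N : ℕ} [NeZero N]

theorem memLp_top_rpow {A : Set (SpaceTime n)} (hA : MeasurableSet A) {w : SpaceTime n → ℝ}
    (hw : MemLp w ⊤ (volume.restrict A)) (hw0 : ∀ z ∈ A, 0 ≤ w z) {p : ℝ} (hp : 0 ≤ p) :
    MemLp (fun z => w z ^ p) ⊤ (volume.restrict A) := by
  obtain ⟨C, hC⟩ := exists_ae_abs_le_of_memLp_top hw
  refine memLp_top_of_bound (hw.1.aemeasurable.pow_const p).aestronglyMeasurable (C ^ p) ?_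
  filter_upwards [hC, ae_restrict_mem hA] with z hz hzA
  rw [Real.norm_of_nonneg (Real.rpow_nonneg (hw0 z hzA) p)]
  exact Real.rpow_le_rpow (hw0 z hzA) ((le_abs_self _).trans hz) hp

theorem patch_nonneg {A : Fin N → Set (SpaceTime n)} {u w : Fin N → SpaceTime n → ℝ}
    (hw : ∀ i, ∀ z ∈ A i, 0 ≤ w i z) {z : SpaceTime n} (hz : z ∈ ⋃ i, A i) :
    0 ≤ patch A u w z := hw _ z (minIndex_isLeast A u hz).1.1

/-- The patched reactant stays below the solution of the reaction equation with large initial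
value. -/
theorem ae_patch_le_reaction {k m₃ m₄ M : ℝ} (hk : 0 < k) (hm₃ : 0 ≤ m₃) (hm₄ : 0 ≤ m₄)
    {A : Fin N → Set (SpaceTime n)} (hA : ∀ i, IsOpen (A i)) (hfin : ∀ i, volume (A i) ≠ ⊤)
    (hpos : ∀ i, ∀ z ∈ A i, 0 < z.2) {u v : Fin N → SpaceTime n → ℝ}
    (huv : ∀ i, IsSupersolutionPair k m₃ m₄ (A i) (u i) (v i))
    (hmono : ∀ x : EuclideanSpace ℝ (Fin n),
      AntitoneOn (fun t : ℝ => patch A u v (x, t)) {t | (x, t) ∈ ⋃ i, A i})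
    {F Φ : ℝ → ℝ} (hF : IsReactionProfile k m₄ M F Φ)
    (hM : ∀ᵐ z, ∀ i, z ∈ A i → v i z ≤ M) {q : SpaceTime n → ℝ} (hq : Measurable q)
    (hqu : q = (⋃ i, A i).indicator fun z => patch A u u z ^ m₃) {C : ℝ} (hC : ∀ z, |q z| ≤ C) :
    ∀ᵐ z, z ∈ (⋃ i, A i) → patch A u v z ≤ F (accumulated q z) := by
  have hAo : IsOpen (⋃ i, A i) := isOpen_iUnion hA
  have hq0 : ∀ z, 0 ≤ q z := fun z => by
    rw [hqu]
    refine indicator_nonneg (fun y hy => Real.rpow_nonneg ?_ _) z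
    exact patch_nonneg (fun i => (huv i).u_nonneg) hy
  have hf : ∀ i, MemLp (fun z => k * u i z ^ m₃ * v i z ^ m₄) ⊤ (volume.restrict (A i)) :=
    fun i => MemLp.mul (p := ⊤) (q := ⊤)
      (memLp_top_rpow (hA i).measurableSet (huv i).memV.bounded (huv i).v_nonneg hm₄)
      ((memLp_top_rpow (hA i).measurableSet (huv i).memU.bounded (huv i).u_nonneg hm₃).const_mul k)
  have hlines := ae_all_iff.2 fun i => (huv i).reaction.ae_timeLine (hA i) (hfin i)
    (huv i).memV.bounded (hf i)
  have key : ∀ᵐ x : EuclideanSpace ℝ (Fin n), ∀ t, (x, t) ∈ (⋃ i, A i) →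
      patch A u v (x, t) ≤ F (accumulated q (x, t)) := by
    filter_upwards [hlines, ae_ae_of_ae_spaceTime hM] with x hx hMx t ht
    have hSo : IsOpen (timeSection (⋃ i, A i) x) := isOpen_timeSection hAo x
    have hSpos : timeSection (⋃ i, A i) x ⊆ Ioi 0 := fun s hs => by
      obtain ⟨i, hi⟩ := mem_iUnion.1 (show (x, s) ∈ ⋃ i, A i from hs)
      exact hpos i _ hi
    -- The bound M is known only almost everywhere; monotonicity in time makes it hold at every time
    -- of the section.
    have hwM : ∀ s ∈ timeSection (⋃ i, A i) x, patch A u v (x, s) ≤ M := fun s hs => by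
      refine le_of_ae_le_of_antitoneOn hSo (hmono x) ?_ hs
      filter_upwards [hMx] with r hr hrS
      exact hr _ (minIndex_isLeast A u hrS).1.1
    rw [accumulated_eq (hSpos ht).le]
    refine hF.antitoneOn_le hk hSo hSpos (w := fun s => patch A u v (x, s))
      (q := fun s => q (x, s)) (hmono x)
      (fun s hs => patch_nonneg (fun i => (huv i).v_nonneg) hs) hwM (fun s => hq0 _)
      (fun s hs => ?_) (intervalIntegrable_timeLine hq hC x) ?_ ht
    · rw [hqu]
      exact indicator_of_notMem (show (x, s) ∉ ⋃ i, A i from hs) _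
    · choose hloc T hT hTineq using hx
      set E : Fin N → Set ℝ := fun i =>
        {s | s ∈ timeSection (⋃ i, A i) x ∧ minIndex A u (x, s) = i} ∩ T i with hE
      -- A subset of the line has only countably many points isolated from the right. Almost every
      -- time is therefore a right accumulation point of times with the same index.
      have hiso : ∀ᵐ s, ∀ i, s ∉ {s ∈ E i | 𝓝[E i ∩ Ioi s] s = ⊥} := ae_all_iff.2 fun i =>
        (countable_setOfPred_isolated_right_within (s := E i)).ae_notMem volume
      have hleb := ae_all_iff.2 fun i => _root_.LocallyIntegrable.ae_hasDerivAt_integral (hloc i)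
      filter_upwards [hiso, hleb, ae_all_iff.2 hT] with s hs1 hs2 hs3 hsS w' hw'
      set i := minIndex A u (x, s) with hi
      have hsi : (x, s) ∈ A i := (minIndex_isLeast A u hsS).1.1
      have hsE : s ∈ E i := ⟨⟨hsS, rfl⟩, hs3 i hsi⟩
      have hne : (𝓝[E i ∩ Ioi s] s).NeBot := ⟨fun hbot => hs1 i ⟨hsE, hbot⟩⟩
      have h1 := deriv_le_neg_of_accumulation ((isOpen_timeSection (hA i) x).mem_nhds hsi) hne hw'
        (hs2 i s) fun r hr hsr hsub => by
          have h2 := hTineq i s hsE.2 r hr.2 hsr hsub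
          have h3 : patch A u v (x, r) = v i (x, r) := by rw [patch, hr.1.2]
          have h4 : patch A u v (x, s) = v i (x, s) := rfl
          rw [h3, h4]
          exact h2
      rw [indicator_of_mem hsi] at h1
      rw [hqu, indicator_of_mem (show (x, s) ∈ ⋃ i, A i from hsS)]
      exact h1
  -- The bound holds at all times for a.e. x, and the preimage of a null set under the first
  -- projection is null.
  have hz : ∀ᵐ z : SpaceTime n, ∀ t, (z.1, t) ∈ (⋃ i, A i) →
      patch A u v (z.1, t) ≤ F (accumulated q (z.1, t)) := by
    rw [Measure.volume_eq_prod]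
    exact Measure.quasiMeasurePreserving_fst.ae key
  filter_upwards [hz] with z hz using hz z.2

/-- An upper bound valid almost everywhere holds everywhere for continuous functions on open
sets. -/
theorem le_of_ae_le_of_continuousOn {A : Set (SpaceTime n)} (hA : IsOpen A)
    {w : SpaceTime n → ℝ} (hw : ContinuousOn w A) {C : ℝ}
    (hC : ∀ᵐ z ∂volume.restrict A, w z ≤ C) : ∀ z ∈ A, w z ≤ C := by
  by_contra! hne
  obtain ⟨z, hzA, hz⟩ := hne
  have hopen : IsOpen (A ∩ w ⁻¹' Ioi C) := hw.isOpen_inter_preimage hA isOpen_Ioi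
  have hpos := hopen.measure_pos volume ⟨z, hzA, hz⟩
  rw [ae_restrict_iff' hA.measurableSet] at hC
  refine hpos.ne' (measure_mono_null (fun y hy => ?_) hC)
  exact fun hle => not_lt.2 (hle hy.1) hy.2

end Comparison

end FastReaction

/-! ### Proof of the theorem -/

open FastReaction

theorem theorem2p3 {n N : ℕ} [NeZero N]
    (Ω : Set (EuclideanSpace ℝ (Fin n))) (T k m₃ m₄ : ℝ)
    (hΩ_open : IsOpen Ω) (hΩ_conn : IsConnected Ω) (hΩ_bdd : Bornology.IsBounded Ω)
    (hT : 0 < T) (hk : 0 < k) (hm₃ : 1 ≤ m₃) (hm₄ : 1 ≤ m₄)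
    (A : Fin N → Set (FastReaction.SpaceTime n))
    (hA : ∀ i, FastReaction.IsLipschitzDomain (A i))
    (hAQ : ∀ i, A i ⊆ FastReaction.cylinder Ω T)
    (u v : Fin N → FastReaction.SpaceTime n → ℝ)
    (huv : ∀ i, FastReaction.IsSupersolutionPair k m₃ m₄ (A i) (u i) (v i))
    -- choice of representatives at the internal boundaries
    (hrep : ∀ i, ∀ z ∈ A i ∩ ⋃ j, frontier (A j), FastReaction.EssLiminfLE (u i) z)
    (hmono : ∀ x : EuclideanSpace ℝ (Fin n),
      AntitoneOn (fun t : ℝ => FastReaction.patch A u v (x, t)) {t | (x, t) ∈ ⋃ i, A i})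
    (hcont : ContinuousOn (FastReaction.patch A u u) (⋃ i, A i))
    (hδ : ∀ B : Set (FastReaction.SpaceTime n), IsCompact B → B ⊆ ⋃ i, A i →
      ∃ δ > 0, ∃ B' : Set (FastReaction.SpaceTime n), IsOpen B' ∧ B' ⊆ ⋃ i, A i ∧
        B ∩ ⋃ i, frontier (A i) ⊆ B' ∧
        ∀ z ∈ B', ∀ i, z ∈ A i → i ≠ FastReaction.minIndex A u z →
          FastReaction.patch A u u z + δ < u i z) :
    ∃ v' : FastReaction.SpaceTime n → ℝ,
      FastReaction.IsSupersolutionPair k m₃ m₄ (⋃ i, A i) (FastReaction.patch A u u) v' := by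
  have hAo : ∀ i, IsOpen (A i) := fun i => (hA i).isOpen
  have hAU : IsOpen (⋃ i, A i) := isOpen_iUnion hAo
  have hAm : MeasurableSet (⋃ i, A i) := hAU.measurableSet
  have hpos : ∀ i, ∀ z ∈ A i, 0 < z.2 := fun i z hz => (hAQ i hz).2.1
  have hposU : ∀ z ∈ ⋃ i, A i, 0 < z.2 := fun z hz => by
    obtain ⟨i, hi⟩ := mem_iUnion.1 hz
    exact hpos i z hi
  have hbdd : Bornology.IsBounded (cylinder Ω T) := hΩ_bdd.prod (Metric.isBounded_Ioo 0 T)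
  have hfin : ∀ i, volume (A i) ≠ ⊤ := fun i => (hbdd.subset (hAQ i)).measure_lt_top.ne
  have hfinU : volume (⋃ i, A i) ≠ ⊤ := (hbdd.subset (iUnion_subset hAQ)).measure_lt_top.ne
  have hm₃' : 0 ≤ m₃ := zero_le_one.trans hm₃
  have hm₄' : 0 ≤ m₄ := zero_le_one.trans hm₄
  choose g G hreg using fun i => (huv i).exists_isRegularSupersolution (hAo i)
  have hpatch := isRegularSupersolution_patch hAo hpos hreg fun z hz =>
    exists_isLocalSupersolution_patch hAo hpos hreg hrep hcont (fun y hy => by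
      -- The gap is needed only near one boundary point at a time, so the compact set is taken to be
      -- a point.
      obtain ⟨δ, hδ0, B', h1, h2, h3, h4⟩ := hδ {y} isCompact_singleton
        (singleton_subset_iff.2 hy.1)
      exact ⟨δ, hδ0, B', h1, h2, h3 ⟨rfl, hy.2⟩, h4⟩) hz
  set U := patch A u u with hU
  set f := patch A u (fun i z => k * u i z * v i z) with hf
  have hU0 : ∀ z ∈ ⋃ i, A i, 0 ≤ U z := fun z hz => patch_nonneg (fun i => (huv i).u_nonneg) hz
  have hUl := locallyIntegrableOn_of_memLp_top hpatch.bounded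
  have hgl := locallyIntegrableOn_of_memLp_lateTimes hposU hpatch.memLp_time
  have hGl := locallyIntegrableOn_of_memLp_lateTimes hposU hpatch.memLp_space
  have hfl := locallyIntegrableOn_of_memLp_top hpatch.bounded_source
  obtain ⟨CU, hCU⟩ := exists_ae_abs_le_of_memLp_top hpatch.bounded
  have hUle : ∀ z ∈ ⋃ i, A i, U z ≤ CU :=
    le_of_ae_le_of_continuousOn hAU hcont (hCU.mono fun z hz => (le_abs_self _).trans hz)
  choose Cv hCv using fun i => exists_ae_abs_le_of_memLp_top (huv i).memV.bounded
  -- A common bound for all the `v i`; the summand 1 makes it strictly positive, as the reaction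
  -- profile requires.
  set M := ∑ i, |Cv i| + 1 with hMdef
  have hM0 : 0 < M := by positivity
  have hM : ∀ᵐ z, ∀ i, z ∈ A i → v i z ≤ M := by
    refine ae_all_iff.2 fun i => ?_
    have h1 := hCv i
    rw [ae_restrict_iff' (hAo i).measurableSet] at h1
    filter_upwards [h1] with z hz hzA
    have h2 := Finset.single_le_sum (f := fun i => |Cv i|) (fun i _ => abs_nonneg _)
      (Finset.mem_univ i)
    linarith [hz hzA, le_abs_self (v i z), le_abs_self (Cv i)]
  obtain ⟨F, Φ, hF⟩ := exists_isReactionProfile (m := m₄) hk hm₄ hM0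
  set q := (⋃ i, A i).indicator fun z => U z ^ m₃ with hq
  have hqc : ContinuousOn (fun z => U z ^ m₃) (⋃ i, A i) :=
    hcont.rpow_const fun z _ => Or.inr hm₃'
  have hqA : ∀ z ∈ ⋃ i, A i, q z = U z ^ m₃ := fun z hz => indicator_of_mem hz _
  have hqm : Measurable q := by
    classical
    rw [hq, ← piecewise_eq_indicator]
    exact hqc.measurable_piecewise continuousOn_const hAm
  have hq0 : ∀ z, 0 ≤ q z := fun z =>
    indicator_nonneg (fun y hy => Real.rpow_nonneg (hU0 y hy) _) z
  have hqC : ∀ z, |q z| ≤ |CU| ^ m₃ := fun z => by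
    rw [abs_of_nonneg (hq0 z)]
    by_cases hz : z ∈ ⋃ i, A i
    · rw [hqA z hz]
      exact Real.rpow_le_rpow (hU0 z hz) ((hUle z hz).trans (le_abs_self _)) hm₃'
    · rw [hq, indicator_of_notMem hz]
      positivity
  set V : SpaceTime n → ℝ := fun z => F (accumulated q z) with hV
  have hV0 : ∀ z, 0 < V z := fun z => hF.pos _ (accumulated_nonneg hq0 z)
  have hVM : ∀ z, V z ≤ M := fun z => hF.le _ (accumulated_nonneg hq0 z)
  have hVabs : ∀ z, |V z| ≤ M := fun z => by rw [abs_of_pos (hV0 z)]; exact hVM z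
  have hVm : Measurable V := by
    -- F is controlled only for nonnegative arguments; freezing it at 0 gives a continuous function
    -- on the whole line that agrees with F on the values of the accumulated source.
    have hFc : Continuous fun s => F (max s 0) := continuous_iff_continuousAt.2 fun s =>
      ContinuousAt.comp (g := F) (hF.hasDerivAt _ (le_max_right s 0)).continuousAt
        (continuous_id.max continuous_const).continuousAt
    have hVeq : V = (fun s => F (max s 0)) ∘ accumulated q := funext fun z =>
      congrArg F (max_eq_left (accumulated_nonneg hq0 z)).symm
    rw [hVeq]
    exact hFc.measurable.comp (measurable_accumulated hqm)
  have hgb : ∀ z, |k * q z * V z ^ m₄| ≤ k * |CU| ^ m₃ * M ^ m₄ := fun z => by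
    rw [abs_of_nonneg (mul_nonneg (mul_nonneg hk.le (hq0 z)) (Real.rpow_nonneg (hV0 z).le _))]
    have h1 := (le_abs_self _).trans (hqC z)
    have h2 := Real.rpow_le_rpow (hV0 z).le (hVM z) hm₄'
    have h3 := Real.rpow_nonneg (hV0 z).le m₄
    gcongr
  have hweak := hF.hasWeakDirDeriv hAU hposU hqm hq0 hqC (hqc.congr hqA) hV hVm hVabs hgb
  have hVtop : MemLp V ⊤ (volume.restrict (⋃ i, A i)) :=
    memLp_top_of_bound hVm.aestronglyMeasurable M (Eventually.of_forall hVabs)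
  have hVl := locallyIntegrableOn_of_memLp_top hVtop
  have hgtop : MemLp (fun z => -(k * q z * V z ^ m₄)) ⊤ (volume.restrict (⋃ i, A i)) :=
    memLp_top_of_bound ((hqm.const_mul k).mul (hVm.pow_const m₄)).neg.aestronglyMeasurable _
      (Eventually.of_forall fun z => by rw [norm_neg]; exact hgb z)
  have hgVl := locallyIntegrableOn_of_memLp_top hgtop
  have hle := ae_patch_le_reaction hk hm₃' hm₄' hAo hfin hpos huv hmono hF hM hqm hq hqC
  have : IsFiniteMeasure (volume.restrict (⋃ i, A i)) := isFiniteMeasure_restrict.2 hfinU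
  have hsp := hasWeakSpaceGrad_of_dir hUl hGl hpatch.space
  refine ⟨V, ⟨hpatch.bounded, ⟨_, hasWeakTimeDeriv_of_dir hUl hgl hpatch.time,
    hpatch.memLp_time⟩, ⟨_, hsp, hpatch.memLp_space⟩⟩, ⟨hVtop, _,
    hasWeakTimeDeriv_of_dir hVl hgVl hweak, hgtop.integrable le_top⟩, hU0,
    fun z _ => (hV0 z).le, ⟨_, hsp, fun φ hφ h0 => ?_⟩, fun φ hφ h0 => ?_⟩
  · have h1 := hpatch.super φ hφ h0
    have hd := hpatch.time φ hφ
    have i1 : Integrable (fun z => -(U z * fderiv ℝ φ z (timeDir n)))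
        (volume.restrict (⋃ i, A i)) := (hφ.integrable_mul_fderiv hUl _).neg.integrableOn
    have i2 : Integrable (fun z => ∑ i, G (minIndex A u z) z i * fderiv ℝ φ z (spaceDir i))
        (volume.restrict (⋃ i, A i)) :=
      integrable_finsetSum _ fun i _ => (hφ.integrable_mul_fderiv
        (locallyIntegrableOn_coord hGl i) _).integrableOn
    have hUV : MemLp (fun z => k * U z * V z) ⊤ (volume.restrict (⋃ i, A i)) :=
      MemLp.mul (p := ⊤) (q := ⊤) hVtop (hpatch.bounded.const_mul k)
    have i3 : Integrable (fun z => k * U z * V z * φ z) (volume.restrict (⋃ i, A i)) :=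
      (hφ.integrable_mul (locallyIntegrableOn_of_memLp_top hUV)).integrableOn
    have i4 : Integrable (fun z => patch A u g z * φ z) (volume.restrict (⋃ i, A i)) :=
      (hφ.integrable_mul hgl).integrableOn
    have i5 : Integrable (fun z => f z * φ z) (volume.restrict (⋃ i, A i)) :=
      (hφ.integrable_mul hfl).integrableOn
    -- Here the source built from `v_ℓ` is replaced by the one built from V, using `v_ℓ ≤ V` a.e.
    -- and u, φ ≥ 0.
    have hcmp : ∫ z in ⋃ i, A i, f z * φ z ≤ ∫ z in ⋃ i, A i, k * U z * V z * φ z := by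
      refine integral_mono_ae i5 i3 ?_
      filter_upwards [ae_restrict_mem hAm, ae_restrict_of_ae hle] with z hzA hz
      have hfz : f z = k * U z * patch A u v z := rfl
      rw [hfz]
      exact mul_le_mul_of_nonneg_right (mul_le_mul_of_nonneg_left (hz hzA)
        (mul_nonneg hk.le (hU0 z hzA))) (h0 z)
    simp only [add_mul] at h1
    rw [integral_add i2 (by exact i4.add i5), integral_add i4 i5] at h1
    simp only [hφ.timeDeriv_eq, hφ.inner_spaceGrad, neg_mul]
    rw [integral_add (by exact i1.add i2) i3, integral_add i1 i2, integral_neg, hd, neg_neg]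
    linarith
  · have hd := hweak φ hφ
    have i1 : Integrable (fun z => -(V z * fderiv ℝ φ z (timeDir n)))
        (volume.restrict (⋃ i, A i)) := (hφ.integrable_mul_fderiv hVl _).neg.integrableOn
    have i2 : Integrable (fun z => -(k * q z * V z ^ m₄) * φ z)
        (volume.restrict (⋃ i, A i)) := (hφ.integrable_mul hgVl).integrableOn
    -- V solves the reaction equation exactly, so the integral is zero.
    have hcongr : ∫ z in ⋃ i, A i, (-V z * timeDeriv φ z + k * U z ^ m₃ * V z ^ m₄ * φ z) =
        ∫ z in ⋃ i, A i, (-(V z * fderiv ℝ φ z (timeDir n)) -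
          -(k * q z * V z ^ m₄) * φ z) := by
      refine setIntegral_congr_fun hAm fun z hz => ?_
      simp only [hφ.timeDeriv_eq, hqA z hz]
      ring
    refine le_of_eq (hcongr.trans ?_)
    rw [integral_sub i1 i2, integral_neg, hd]
    ring
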